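/- Let $G$ be a finite group, $k$ a field, $\overline G=G\setminus\{1\}$. All (co)chains are normalized: a tuple having an entry $1$ in a $\overline G$-position counts as $0$. **Complexes.** The Tate–Hochschild complex $\mathcal D^*=\mathcal D^*(kG,kG)$ has $\mathcal D^n=\mathrm{Map}(\overline G^{\,n},kG)$ for $n\ge 0$ and $\mathcal D^{-s-1}=k[G\times\overline G^{\,s}]$ for $s\ge 0$. Its differential is the Hochschild differential $(\delta\varphi)(g_1,\dots,g_{n+1})=g_1\varphi(g_2,\dots)+\sum_{i=1}^n(-1)^i\varphi(\dots,g_ig_{i+1},\dots)+(-1)^{n+1}\varphi(g_1,\dots,g_n)g_{n+1}$ in degrees $n\ge 0$, the map $\partial(g_0,g_1,\dots,g_s)=(g_0g_1,g_2,\dots)+\sum_{i=1}^{s-1}(-1)^i(g_0,\dots,g_ig_{i+1},\dots)+(-1)^s(g_sg_0,g_1,\dots,g_{s-1})$ in degrees $-s-1\le -2$, and $x\mapsto\sum_{g\in G}gxg^{-1}$ from degree $-1$ to degree $0$. The Tate complex $\widehat C^*=\widehat C^*(G,k)$ has $\widehat C^n=\mathrm{Map}(\overline G^{\,n},k)$,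 $\widehat C^{-s-1}=k[\overline G^{\,s}]$, with the usual group cohomology and group homology differentials (trivial coefficients) and multiplication by $|G|$ from degree $-1$ to degree $0$. Their cohomologies are $\widehat{\mathrm{HH}}{}^*(kG,kG)$ and $\widehat{\mathrm H}{}^*(G,k)$. **Operations on $\mathcal D^*$.** The unit is $1\in kG=\mathcal D^0$. The cup product is, for cochains $\alpha,\beta$ on $n$- and $m$-tuples and chains $(g_0,g_{1,s})=(g_0,g_1,\dots,g_s)$, $(h_0,h_{1,t})$: * $(\alpha\cup\beta)(g_{1,n+m})=\alpha(g_{1,n})\beta(g_{n+1,n+m})$; * $(g_0,g_{1,s})\cup(h_0,h_{1,t})=\sum_{g\in G}(gh_0,h_{1,t},g^{-1}g_0,g_{1,s})$; * $\alpha\cup(h_0,h_{1,t})=(\alpha(h_{t-n+1,t})h_0,h_{1,t-n})$ if $n\le t$, and $(\alpha\cup(h_0,h_{1,t}))(x_{1,n-t-1})=\sum_{g\in G}\alpha(x_{1,n-t-1},g^{-1},h_{1,t})h_0g$ if $n>t$; * $(g_0,g_{1,s})\cup\beta=(g_0\beta(g_{1,m}),g_{m+1,s})$ if $m\le s$, and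 $((g_0,g_{1,s})\cup\beta)(x_{1,m-s-1})=\sum_{g\in G}gg_0\beta(g_{1,s},g^{-1},x_{1,m-s-1})$ if $m>s$. The BV operator $\widehat\Delta:\mathcal D^n\to\mathcal D^{n-1}$ is $0$ for $n=0$; for $n>0$ it is $\Delta(\alpha)(g_{1,n-1})=\sum_{g_n\in G}\sum_{i=1}^n(-1)^{i(n-1)}\langle\alpha(g_{i,n-1},g_n,g_{1,i-1}),1\rangle g_n^{-1}$, where $\langle x,1\rangle$ is the coefficient of $x\in kG$ at $1$; for $n=-s-1<0$ it is $\varepsilon^nB$ with Connes' operator $B(g_0,g_{1,s})=\sum_{i=0}^s(-1)^{is}(1,g_{i,s},g_{0,i-1})$. Here $\varepsilon\in\{1,-1\}$ is an arbitrary fixed sign convention. **Operations on $\widehat C^*$.** The unit is $1\in k=\widehat C^0$. The cup product is given by * $(\alpha\cup\beta)(g_{1,n+m})=\alpha(g_{1,n})\beta(g_{n+1,n+m})$; * $(g_{1,s})\cup(h_{1,t})=\sum_{g\in G}(h_{1,t},g,g_{1,s})$; * $\alpha\cup(h_{1,t})=\alpha(h_{t-n+1,t})(h_{1,t-n})$ if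 $n\le t$, and $(\alpha\cup(h_{1,t}))(x_{1,n-t-1})=\sum_{g\in G}\alpha(x_{1,n-t-1},g,h_{1,t})$ if $n>t$; * $(g_{1,s})\cup\beta=\beta(g_{1,m})(g_{m+1,s})$ if $m\le s$, and $((g_{1,s})\cup\beta)(x_{1,m-s-1})=\sum_{g\in G}\beta(g_{1,s},g,x_{1,m-s-1})$ if $m>s$. The operator $\widehat\Delta$ is $0$ in degree $0$; for $n>0$, $\widehat\Delta(\psi)(h_{1,n-1})=\sum_{i=1}^n(-1)^{i(n-1)}\psi(h_{i,n-1},h_{n-1}^{-1}\cdots h_1^{-1},h_{1,i-1})$; for $n=-s-1<0$ it is $\varepsilon^n$ times $(h_{1,s})\mapsto\sum_{i=0}^s(-1)^{is}(h_{i,s},h_{0,i-1})$ with $h_0=h_s^{-1}\cdots h_1^{-1}$. **The inclusion.** $\widehat\iota_{x=1}:\widehat C^*\to\mathcal D^*$ sends a cochain $\varphi$ to $g_{1,n}\mapsto\varphi(g_{1,n})\,g_1\cdots g_n$ and a chain $(g_{1,s})$ to $(g_s^{-1}\cdots g_1^{-1},g_{1,s})$. **Statement.** In both complexes the differential squares to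 zero. The unit, the cup product and $\widehat\Delta$ descend to $\widehat{\mathrm{HH}}{}^*(kG,kG)$ and to $\widehat{\mathrm H}{}^*(G,k)$; on each of them the class of $1$ is a two-sided unit and $\widehat\Delta^2=0$. Put $$[a,b]=-(-1)^{(|a|-1)|b|}\bigl(\widehat\Delta(a\cup b)-\widehat\Delta(a)\cup b-(-1)^{|a|}a\cup\widehat\Delta(b)\bigr)$$ on both cohomologies. Then $\widehat\iota_{x=1}$ induces a $k$-linear map $\widehat{\mathrm H}{}^*(G,k)\hookrightarrow\widehat{\mathrm{HH}}{}^*(kG,kG)$ that is a unital embedding for the BV structures: it is injective in every degree, sends the unit to the unit, and commutes with the cup product, with $\widehat\Delta$ and with the bracket $[\cdot,\cdot]$. -/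

import Mathlib

/-! Tate cochain complex of a finite group `G`, Tate-Hochschild cochain complex of the group algebra
`kG`, and the unit, products and BV operators on them.

All complexes are normalized.  `NonId G` is the set `G - {1}`.  A tuple of elements of `G` having an
entry equal to `1` is read as zero: `evalAt` extends cochains by zero to such tuples, and
`hBasis`, `gBasis` send them to the zero chain.  A complex indexed by `ℤ` has cochains on `m`-tuples in
degree `m ≥ 0` (`Int.ofNat m`) and chains on `s`-tuples in degree `-s-1` (`Int.negSucc s`). -/

noncomputable section

namespace TateHH

universe u v

/-- The set `G - {1}`. -/
abbrev NonId (G : Type v) [Group G] : Type v := {g : G // g ≠ 1}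

/-- Underlying tuple in `G` of a tuple in `G - {1}`. -/
def vals {G : Type v} [Group G] {n : ℕ} (g : Fin n → NonId G) : Fin n → G := fun i => (g i : G)

/-- The product `g₁ ⋯ gₙ` of the entries of a tuple. -/
def tupleProd {G : Type v} [Group G] {n : ℕ} (g : Fin n → G) : G := (List.ofFn g).prod

/-- The cyclic rotation `(gᵢ, …, gₘ, g₀, …, gᵢ₋₁)` of `(g₀, …, gₘ)`; indices are taken modulo `m + 1`. -/
def rot {G : Type v} {m : ℕ} (g : Fin (m + 1) → G) (i : Fin (m + 1)) : Fin (m + 1) → G :=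
  fun j => g (j + i)

section Tuples

variable (k : Type u) [Field k] {G : Type v} [Group G]

open Classical in
/-- Value of a cochain at an arbitrary tuple of elements of `G`; it is zero if some entry is `1`. -/
def evalAt {M : Type*} [AddCommGroup M] [Module k M] {n : ℕ} (g : Fin n → G) :
    ((Fin n → NonId G) → M) →ₗ[k] M :=
  if h : ∀ i, g i ≠ 1 then LinearMap.proj (fun i => ⟨g i, h i⟩) else 0

open Classical in
/-- The Hochschild chain `(g₀, g₁, …, gₛ)`; it is zero if one of `g₁, …, gₛ` is `1`. -/
def hBasis {s : ℕ} (g₀ : G) (g : Fin s → G) : (G × (Fin s → NonId G)) →₀ k :=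
  if h : ∀ i, g i ≠ 1 then Finsupp.single (g₀, fun i => ⟨g i, h i⟩) 1 else 0

open Classical in
/-- The group chain `(g₁, …, gₛ)`; it is zero if one of the entries is `1`. -/
def gBasis {s : ℕ} (g : Fin s → G) : (Fin s → NonId G) →₀ k :=
  if h : ∀ i, g i ≠ 1 then Finsupp.single (fun i => ⟨g i, h i⟩) 1 else 0

end Tuples

/-! ### The Tate-Hochschild cochain complex `𝒟*(kG, kG)` -/

section Hochschild

variable (k : Type u) [Field k] (G : Type v) [Group G]

/-- Hochschild cochains `Cⁿ(kG, kG) = Map((G - {1})ⁿ, kG)`. -/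
abbrev HCochain (n : ℕ) : Type (max u v) := (Fin n → NonId G) → MonoidAlgebra k G

/-- Hochschild chains `C_s(kG, kG) = k[G × (G - {1})ˢ]`. -/
abbrev HChain (s : ℕ) : Type (max u v) := (G × (Fin s → NonId G)) →₀ k

/-- The element `g` of `kG`. -/
abbrev el {G : Type v} [Group G] (g : G) : MonoidAlgebra k G := MonoidAlgebra.single g 1

/-- The Hochschild codifferential. -/
def hδ (n : ℕ) : HCochain k G n →ₗ[k] HCochain k G (n + 1) :=
  LinearMap.pi fun g =>
    LinearMap.mulLeft k (el k (g 0 : G)) ∘ₗ evalAt k (vals (Fin.tail g))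
    + ∑ i : Fin n, (-1 : k) ^ (i.val + 1) • evalAt k (Fin.contractNth i.castSucc (· * ·) (vals g))
    + (-1 : k) ^ (n + 1) •
        (LinearMap.mulRight k (el k (g (Fin.last n) : G)) ∘ₗ evalAt k (vals (Fin.init g)))

/-- The Hochschild differential. -/
def hBd (s : ℕ) : HChain k G (s + 1) →ₗ[k] HChain k G s :=
  Finsupp.linearCombination k fun b =>
    hBasis k (b.1 * (b.2 0 : G)) (vals (Fin.tail b.2))
    + ∑ i : Fin s, (-1 : k) ^ (i.val + 1) •
        hBasis k b.1 (Fin.contractNth i.castSucc (· * ·) (vals b.2))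
    + (-1 : k) ^ (s + 1) • hBasis k ((b.2 (Fin.last s) : G) * b.1) (vals (Fin.init b.2))

/-- The trace map `x ↦ ∑ g x g⁻¹` from degree `-1` to degree `0`. -/
def hτ [Fintype G] : HChain k G 0 →ₗ[k] HCochain k G 0 :=
  Finsupp.linearCombination k fun b => fun _ => ∑ g : G, el k (g * b.1 * g⁻¹)

/-- The components of the Tate-Hochschild cochain complex
`⋯ → C₁ → C₀ -τ→ C⁰ → C¹ → ⋯`, with `C_s` in degree `-s-1`. -/
def HTate : ℤ → Type (max u v)
  | .ofNat n => HCochain k G n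
  | .negSucc s => HChain k G s

instance : ∀ n, AddCommGroup (HTate k G n)
  | .ofNat n => inferInstanceAs (AddCommGroup (HCochain k G n))
  | .negSucc s => inferInstanceAs (AddCommGroup (HChain k G s))

instance : ∀ n, Module k (HTate k G n)
  | .ofNat n => inferInstanceAs (Module k (HCochain k G n))
  | .negSucc s => inferInstanceAs (Module k (HChain k G s))

/-- Cocycles of the Tate-Hochschild complex: kernel of the differential leaving degree `n`. -/
def hCocycles [Fintype G] : ∀ n, Submodule k (HTate k G n)
  | .ofNat n => LinearMap.ker (hδ k G n)
  | .negSucc 0 => LinearMap.ker (hτ k G)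
  | .negSucc (s + 1) => LinearMap.ker (hBd k G s)

/-- Coboundaries of the Tate-Hochschild complex: range of the differential arriving in degree `n`. -/
def hCoboundaries [Fintype G] : ∀ n, Submodule k (HTate k G n)
  | .ofNat 0 => LinearMap.range (hτ k G)
  | .ofNat (n + 1) => LinearMap.range (hδ k G n)
  | .negSucc s => LinearMap.range (hBd k G s)

/-- The Tate-Hochschild cohomology of `kG` in degree `n`. -/
abbrev HHHat [Fintype G] (n : ℤ) : Type (max u v) :=
  hCocycles k G n ⧸ (hCoboundaries k G n).submoduleOf (hCocycles k G n)

variable {G}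

/-- `x ↦ (x, g₁, …, gₛ)`, linear in `x ∈ kG`. -/
def hPlace {s : ℕ} (g : Fin s → NonId G) : MonoidAlgebra k G →ₗ[k] HChain k G s :=
  Finsupp.lmapDomain k k (fun x => (x, g)) ∘ₗ (MonoidAlgebra.coeffLinearEquiv k).toLinearMap

variable (G)

/-- Cup product of two cochains: `(α ∪ β)(g) = α(g₁, …, gₙ) β(gₙ₊₁, …, gₙ₊ₘ)`. -/
def hCupPP (n m : ℕ) : HCochain k G n →ₗ[k] HCochain k G m →ₗ[k] HCochain k G (n + m) :=
  LinearMap.mk₂ k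
    (fun α β g => α (fun i => g (Fin.castAdd m i)) * β (fun i => g (Fin.natAdd n i)))
    (by intros; ext1; simp [add_mul]) (by intros; ext1; simp)
    (by intros; ext1; simp [mul_add]) (by intros; ext1; simp)

/-- Product of two chains:
`(g₀, g₁, …, gₛ) ∪ (h₀, h₁, …, hₜ) = ∑ (g h₀, h₁, …, hₜ, g⁻¹ g₀, g₁, …, gₛ)`, sum over `g ∈ G`. -/
def hCupNN [Fintype G] (s t : ℕ) :
    HChain k G s →ₗ[k] HChain k G t →ₗ[k] HChain k G (t + (s + 1)) :=
  Finsupp.linearCombination k fun a => Finsupp.linearCombination k fun b =>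
    ∑ g : G, hBasis k (g * b.1)
      (Fin.append (vals b.2) (Fin.cons (g⁻¹ * a.1) (vals a.2) : Fin (s + 1) → G))

/-- Cochain times chain, result a chain (cap product), with `t = r + n`:
`α ∪ (h₀, h₁, …, hₜ) = (α(hᵣ₊₁, …, hₜ) h₀, h₁, …, hᵣ)`. -/
def hCupPN_N (n r : ℕ) : HCochain k G n →ₗ[k] HChain k G (r + n) →ₗ[k] HChain k G r :=
  LinearMap.flip <| Finsupp.linearCombination k fun b =>
    hPlace k (fun i => b.2 (Fin.castAdd n i)) ∘ₗ LinearMap.mulRight k (el k b.1) ∘ₗ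
      LinearMap.proj (fun i => b.2 (Fin.natAdd r i))

/-- Cochain times chain, result a cochain, with `n = w + (t + 1)`:
`(α ∪ (g₀, g₁, …, gₜ))(h₁, …, h_w) = ∑ α(h₁, …, h_w, g⁻¹, g₁, …, gₜ) g₀ g`, sum over `g ∈ G`. -/
def hCupPN_P [Fintype G] (w t : ℕ) :
    HCochain k G (w + (t + 1)) →ₗ[k] HChain k G t →ₗ[k] HCochain k G w :=
  LinearMap.flip <| Finsupp.linearCombination k fun b => LinearMap.pi fun h =>
    ∑ g : G, LinearMap.mulRight k (el k (b.1 * g)) ∘ₗ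
      evalAt k (Fin.append (vals h) (Fin.cons g⁻¹ (vals b.2) : Fin (t + 1) → G))

/-- Chain times cochain, result a chain, with `s = m + r`:
`(g₀, g₁, …, gₛ) ∪ β = (g₀ β(g₁, …, gₘ), gₘ₊₁, …, gₛ)`. -/
def hCupNP_N (m r : ℕ) : HChain k G (m + r) →ₗ[k] HCochain k G m →ₗ[k] HChain k G r :=
  Finsupp.linearCombination k fun a =>
    hPlace k (fun i => a.2 (Fin.natAdd m i)) ∘ₗ LinearMap.mulLeft k (el k a.1) ∘ₗ
      LinearMap.proj (fun i => a.2 (Fin.castAdd r i))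

/-- Chain times cochain, result a cochain, with `m = s + (w + 1)`:
`((g₀, g₁, …, gₛ) ∪ β)(h₁, …, h_w) = ∑ g g₀ β(g₁, …, gₛ, g⁻¹, h₁, …, h_w)`, sum over `g ∈ G`. -/
def hCupNP_P [Fintype G] (s w : ℕ) :
    HChain k G s →ₗ[k] HCochain k G (s + (w + 1)) →ₗ[k] HCochain k G w :=
  Finsupp.linearCombination k fun a => LinearMap.pi fun h =>
    ∑ g : G, LinearMap.mulLeft k (el k (g * a.1)) ∘ₗ
      evalAt k (Fin.append (vals a.2) (Fin.cons g⁻¹ (vals h) : Fin (w + 1) → G))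

/-- The cup product `𝒟ᵖ ⊗ 𝒟^q → 𝒟ʳ`, `r = p + q`, on the Tate-Hochschild complex, by cases on the signs
of the degrees.  The last two patterns cannot satisfy `p + q = r`. -/
def hCup [Fintype G] : ∀ p q r : ℤ, p + q = r → HTate k G p →ₗ[k] HTate k G q →ₗ[k] HTate k G r
  | .ofNat n, .ofNat m, .ofNat l, e =>
      have h : l = n + m := by simp only [Int.ofNat_eq_natCast] at e; omega
      h ▸ hCupPP k G n m
  | .negSucc s, .negSucc t, .negSucc r, e =>
      have h : r = t + (s + 1) := by omega
      h ▸ hCupNN k G s t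
  | .ofNat n, .negSucc t, .negSucc r, e =>
      have h : t = r + n := by simp only [Int.ofNat_eq_natCast] at e; omega
      h ▸ hCupPN_N k G n r
  | .ofNat n, .negSucc t, .ofNat w, e =>
      have h : n = w + (t + 1) := by simp only [Int.ofNat_eq_natCast] at e; omega
      h ▸ hCupPN_P k G w t
  | .negSucc s, .ofNat m, .negSucc r, e =>
      have h : s = m + r := by simp only [Int.ofNat_eq_natCast] at e; omega
      h ▸ hCupNP_N k G m r
  | .negSucc s, .ofNat m, .ofNat w, e =>
      have h : m = s + (w + 1) := by simp only [Int.ofNat_eq_natCast] at e; omega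
      h ▸ hCupNP_P k G s w
  | .ofNat _, .ofNat _, .negSucc _, _ => 0
  | .negSucc _, .negSucc _, .ofNat _, _ => 0

/-- The unit cochain `1 ∈ kG = C⁰(kG, kG)`. -/
def hOne : HTate k G 0 := (fun _ => 1 : HCochain k G 0)

/-- The operator `Δ` on Hochschild cochains, dual to the operator `B`:
`Δ(α)(g₁, …, gₘ) = ∑_{g₀ ∈ G} ∑ᵢ (-1)^{im} ⟨α(gᵢ, …, gₘ, g₀, …, gᵢ₋₁), 1⟩ g₀⁻¹`, where `⟨x, 1⟩` is the
coefficient of `x ∈ kG` at `1`. -/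
def hΔ [Fintype G] (m : ℕ) : HCochain k G (m + 1) →ₗ[k] HCochain k G m :=
  LinearMap.pi fun g => ∑ g₀ : G, ∑ i : Fin (m + 1), (-1 : k) ^ (i.val * m) •
    (LinearMap.toSpanSingleton k (MonoidAlgebra k G) (el k g₀⁻¹) ∘ₗ Finsupp.lapply (1 : G) ∘ₗ
      (MonoidAlgebra.coeffLinearEquiv k).toLinearMap ∘ₗ
      evalAt k (rot (Fin.cons g₀ (vals g) : Fin (m + 1) → G) i))

/-- Connes' operator
`B(g₀, g₁, …, gₛ) = ∑ᵢ (-1)^{is} (1, gᵢ, …, gₛ, g₀, …, gᵢ₋₁)` on Hochschild chains. -/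
def hB (s : ℕ) : HChain k G s →ₗ[k] HChain k G (s + 1) :=
  Finsupp.linearCombination k fun b => ∑ i : Fin (s + 1), (-1 : k) ^ (i.val * s) •
    hBasis k 1 (rot (Fin.cons b.1 (vals b.2) : Fin (s + 1) → G) i)

/-- The operator `Δ̂ : 𝒟ᵖ → 𝒟^q`, `q = p - 1`, on the Tate-Hochschild complex: it is `Δ` for `p > 0`,
zero for `p = 0`, and `εᵖ B` for `p < 0`, where `ε = ±1` is a sign convention. -/
def hBV [Fintype G] (ε : ℤˣ) : ∀ p q : ℤ, q + 1 = p → HTate k G p →ₗ[k] HTate k G q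
  | .ofNat n, .ofNat m, e =>
      have h : n = m + 1 := by simp only [Int.ofNat_eq_natCast] at e; omega
      h ▸ hΔ k G m
  | .ofNat _, .negSucc _, _ => 0
  | .negSucc s, .negSucc t, e =>
      have h : t = s + 1 := by omega
      h ▸ (((ε ^ (s + 1) : ℤˣ) : ℤ) • hB k G s)
  | .negSucc _, .ofNat _, _ => 0

end Hochschild

/-! ### The Tate cochain complex `Ĉ*(G, k)` with trivial coefficients -/

section Tate

variable (k : Type u) [Field k] (G : Type v) [Group G]

/-- Group cochains `Cⁿ(G, k) = Map((G - {1})ⁿ, k)`. -/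
abbrev GCochain (n : ℕ) : Type (max u v) := (Fin n → NonId G) → k

/-- Group chains `C_s(G, k) = k[(G - {1})ˢ]`. -/
abbrev GChain (s : ℕ) : Type (max u v) := (Fin s → NonId G) →₀ k

/-- The group cohomology differential. -/
def gδ (n : ℕ) : GCochain k G n →ₗ[k] GCochain k G (n + 1) :=
  LinearMap.pi fun g =>
    evalAt k (vals (Fin.tail g))
    + ∑ i : Fin n, (-1 : k) ^ (i.val + 1) • evalAt k (Fin.contractNth i.castSucc (· * ·) (vals g))
    + (-1 : k) ^ (n + 1) • evalAt k (vals (Fin.init g))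

/-- The group homology differential. -/
def gBd (s : ℕ) : GChain k G (s + 1) →ₗ[k] GChain k G s :=
  Finsupp.linearCombination k fun b =>
    gBasis k (vals (Fin.tail b))
    + ∑ i : Fin s, (-1 : k) ^ (i.val + 1) •
        gBasis k (Fin.contractNth i.castSucc (· * ·) (vals b))
    + (-1 : k) ^ (s + 1) • gBasis k (vals (Fin.init b))

/-- The norm map, multiplication by `|G|`, from degree `-1` to degree `0`. -/
def gτ [Fintype G] : GChain k G 0 →ₗ[k] GCochain k G 0 :=
  Finsupp.linearCombination k fun _ => fun _ => ∑ _g : G, (1 : k)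

/-- The components of the Tate cochain complex, with `C_s` in degree `-s-1`. -/
def GTate : ℤ → Type (max u v)
  | .ofNat n => GCochain k G n
  | .negSucc s => GChain k G s

instance : ∀ n, AddCommGroup (GTate k G n)
  | .ofNat n => inferInstanceAs (AddCommGroup (GCochain k G n))
  | .negSucc s => inferInstanceAs (AddCommGroup (GChain k G s))

instance : ∀ n, Module k (GTate k G n)
  | .ofNat n => inferInstanceAs (Module k (GCochain k G n))
  | .negSucc s => inferInstanceAs (Module k (GChain k G s))

/-- Cocycles of the Tate complex. -/
def gCocycles [Fintype G] : ∀ n, Submodule k (GTate k G n)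
  | .ofNat n => LinearMap.ker (gδ k G n)
  | .negSucc 0 => LinearMap.ker (gτ k G)
  | .negSucc (s + 1) => LinearMap.ker (gBd k G s)

/-- Coboundaries of the Tate complex. -/
def gCoboundaries [Fintype G] : ∀ n, Submodule k (GTate k G n)
  | .ofNat 0 => LinearMap.range (gτ k G)
  | .ofNat (n + 1) => LinearMap.range (gδ k G n)
  | .negSucc s => LinearMap.range (gBd k G s)

/-- The Tate cohomology of `G` with coefficients in `k` in degree `n`. -/
abbrev HHat [Fintype G] (n : ℤ) : Type (max u v) :=
  gCocycles k G n ⧸ (gCoboundaries k G n).submoduleOf (gCocycles k G n)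

/-- `(α ∪ β)(g) = α(g₁, …, gₙ) β(gₙ₊₁, …, gₙ₊ₘ)`. -/
def gCupPP (n m : ℕ) : GCochain k G n →ₗ[k] GCochain k G m →ₗ[k] GCochain k G (n + m) :=
  LinearMap.mk₂ k
    (fun α β g => α (fun i => g (Fin.castAdd m i)) * β (fun i => g (Fin.natAdd n i)))
    (by intros; ext1; simp [add_mul]) (by intros; ext1; simp [mul_assoc])
    (by intros; ext1; simp [mul_add]) (by intros; ext1; simp [mul_left_comm])

/-- `(g₁, …, gₛ) ∪ (h₁, …, hₜ) = ∑ (h₁, …, hₜ, g, g₁, …, gₛ)`, sum over `g ∈ G`. -/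
def gCupNN [Fintype G] (s t : ℕ) :
    GChain k G s →ₗ[k] GChain k G t →ₗ[k] GChain k G (t + (s + 1)) :=
  Finsupp.linearCombination k fun a => Finsupp.linearCombination k fun b =>
    ∑ g : G, gBasis k (Fin.append (vals b) (Fin.cons g (vals a) : Fin (s + 1) → G))

/-- `α ∪ (h₁, …, hₜ) = α(hᵣ₊₁, …, hₜ) (h₁, …, hᵣ)`, where `t = r + n`. -/
def gCupPN_N (n r : ℕ) : GCochain k G n →ₗ[k] GChain k G (r + n) →ₗ[k] GChain k G r :=
  LinearMap.flip <| Finsupp.linearCombination k fun b =>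
    Finsupp.lsingle (fun i => b (Fin.castAdd n i)) ∘ₗ LinearMap.proj (fun i => b (Fin.natAdd r i))

/-- `(α ∪ (g₁, …, gₜ))(h₁, …, h_w) = ∑ α(h₁, …, h_w, g, g₁, …, gₜ)`, sum over `g ∈ G`. -/
def gCupPN_P [Fintype G] (w t : ℕ) :
    GCochain k G (w + (t + 1)) →ₗ[k] GChain k G t →ₗ[k] GCochain k G w :=
  LinearMap.flip <| Finsupp.linearCombination k fun b => LinearMap.pi fun h =>
    ∑ g : G, evalAt k (Fin.append (vals h) (Fin.cons g (vals b) : Fin (t + 1) → G))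

/-- `(g₁, …, gₛ) ∪ β = β(g₁, …, gₘ) (gₘ₊₁, …, gₛ)`, where `s = m + r`. -/
def gCupNP_N (m r : ℕ) : GChain k G (m + r) →ₗ[k] GCochain k G m →ₗ[k] GChain k G r :=
  Finsupp.linearCombination k fun a =>
    Finsupp.lsingle (fun i => a (Fin.natAdd m i)) ∘ₗ LinearMap.proj (fun i => a (Fin.castAdd r i))

/-- `((g₁, …, gₛ) ∪ β)(h₁, …, h_w) = ∑ β(g₁, …, gₛ, g, h₁, …, h_w)`, sum over `g ∈ G`. -/
def gCupNP_P [Fintype G] (s w : ℕ) :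
    GChain k G s →ₗ[k] GCochain k G (s + (w + 1)) →ₗ[k] GCochain k G w :=
  Finsupp.linearCombination k fun a => LinearMap.pi fun h =>
    ∑ g : G, evalAt k (Fin.append (vals a) (Fin.cons g (vals h) : Fin (w + 1) → G))

/-- The cup product on the Tate complex.  The last two patterns cannot satisfy `p + q = r`. -/
def gCup [Fintype G] : ∀ p q r : ℤ, p + q = r → GTate k G p →ₗ[k] GTate k G q →ₗ[k] GTate k G r
  | .ofNat n, .ofNat m, .ofNat l, e =>
      have h : l = n + m := by simp only [Int.ofNat_eq_natCast] at e; omega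
      h ▸ gCupPP k G n m
  | .negSucc s, .negSucc t, .negSucc r, e =>
      have h : r = t + (s + 1) := by omega
      h ▸ gCupNN k G s t
  | .ofNat n, .negSucc t, .negSucc r, e =>
      have h : t = r + n := by simp only [Int.ofNat_eq_natCast] at e; omega
      h ▸ gCupPN_N k G n r
  | .ofNat n, .negSucc t, .ofNat w, e =>
      have h : n = w + (t + 1) := by simp only [Int.ofNat_eq_natCast] at e; omega
      h ▸ gCupPN_P k G w t
  | .negSucc s, .ofNat m, .negSucc r, e =>
      have h : s = m + r := by simp only [Int.ofNat_eq_natCast] at e; omega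
      h ▸ gCupNP_N k G m r
  | .negSucc s, .ofNat m, .ofNat w, e =>
      have h : m = s + (w + 1) := by simp only [Int.ofNat_eq_natCast] at e; omega
      h ▸ gCupNP_P k G s w
  | .ofNat _, .ofNat _, .negSucc _, _ => 0
  | .negSucc _, .negSucc _, .ofNat _, _ => 0

/-- The unit cochain `1 ∈ k = C⁰(G, k)`. -/
def gOne : GTate k G 0 := (fun _ => 1 : GCochain k G 0)

/-- `Δ(ψ)(h₁, …, hₘ) = ∑ᵢ (-1)^{im} ψ(hᵢ, …, hₘ, h₀, …, hᵢ₋₁)` with `h₀ = (h₁ ⋯ hₘ)⁻¹`. -/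
def gΔ (m : ℕ) : GCochain k G (m + 1) →ₗ[k] GCochain k G m :=
  LinearMap.pi fun h => ∑ i : Fin (m + 1), (-1 : k) ^ (i.val * m) •
    evalAt k (rot (Fin.cons (tupleProd (vals h))⁻¹ (vals h) : Fin (m + 1) → G) i)

/-- `B(h₁, …, hₛ) = ∑ᵢ (-1)^{is} (hᵢ, …, hₛ, h₀, …, hᵢ₋₁)` with `h₀ = (h₁ ⋯ hₛ)⁻¹`. -/
def gB (s : ℕ) : GChain k G s →ₗ[k] GChain k G (s + 1) :=
  Finsupp.linearCombination k fun h => ∑ i : Fin (s + 1), (-1 : k) ^ (i.val * s) •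
    gBasis k (rot (Fin.cons (tupleProd (vals h))⁻¹ (vals h) : Fin (s + 1) → G) i)

/-- The operator `Δ̂` on the Tate complex, with the same sign convention `ε = ±1` in negative degrees. -/
def gBV (ε : ℤˣ) : ∀ p q : ℤ, q + 1 = p → GTate k G p →ₗ[k] GTate k G q
  | .ofNat n, .ofNat m, e =>
      have h : n = m + 1 := by simp only [Int.ofNat_eq_natCast] at e; omega
      h ▸ gΔ k G m
  | .ofNat _, .negSucc _, _ => 0
  | .negSucc s, .negSucc t, e =>
      have h : t = s + 1 := by omega
      h ▸ (((ε ^ (s + 1) : ℤˣ) : ℤ) • gB k G s)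
  | .negSucc _, .ofNat _, _ => 0

/-- The inclusion `ι̂` of the Tate complex into the Tate-Hochschild complex at the conjugacy class of
`1`: a cochain `φ` goes to `g ↦ φ(g₁, …, gₙ) g₁ ⋯ gₙ`, a chain `(g₁, …, gₛ)` goes to
`((g₁ ⋯ gₛ)⁻¹, g₁, …, gₛ)`. -/
def iotaHat : ∀ n, GTate k G n →ₗ[k] HTate k G n
  | .ofNat n => (LinearMap.pi fun g =>
      LinearMap.toSpanSingleton k (MonoidAlgebra k G) (el k (tupleProd (vals g))) ∘ₗ LinearMap.proj g :
      GCochain k G n →ₗ[k] HCochain k G n)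
  | .negSucc s => (Finsupp.lmapDomain k k fun g => ((tupleProd (vals g))⁻¹, g) :
      GChain k G s →ₗ[k] HChain k G s)

end Tate

/-! ### Graded algebras with a BV operator -/

/-- `x` is a cocycle (an element of `Z`) and `c` is its class modulo `B`. -/
def Represents {k : Type*} [Field k] {M : Type*} [AddCommGroup M] [Module k M]
    {Z B : Submodule k M} (x : M) (c : Z ⧸ B.submoduleOf Z) : Prop :=
  ∃ h : x ∈ Z, Submodule.Quotient.mk ⟨x, h⟩ = c

/-- The operations of a BV algebra on a `ℤ`-graded space `H`: a unit, a product of degree `0` and a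
square-zero operator `Δ` of degree `-1`.  The bracket is determined by them, see `BVOps.bracket`. -/
structure BVOps (k : Type*) [Field k] (H : ℤ → Type*) [∀ n, AddCommGroup (H n)]
    [∀ n, Module k (H n)] where
  one : H 0
  mul : ∀ p q r : ℤ, p + q = r → H p →ₗ[k] H q →ₗ[k] H r
  Δ : ∀ p q : ℤ, q + 1 = p → H p →ₗ[k] H q
  one_mul : ∀ (p : ℤ) (a : H p), mul 0 p p (zero_add p) one a = a
  mul_one : ∀ (p : ℤ) (a : H p), mul p 0 p (add_zero p) a one = a
  Δ_Δ : ∀ (p q r : ℤ) (h : q + 1 = p) (h' : r + 1 = q) (a : H p), Δ q r h' (Δ p q h a) = 0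

section BV

variable {k : Type*} [Field k] {H : ℤ → Type*} [∀ n, AddCommGroup (H n)] [∀ n, Module k (H n)]
  {K : ℤ → Type*} [∀ n, AddCommGroup (K n)] [∀ n, Module k (K n)]

/-- The bracket of degree `-1`:
`[a, b] = -(-1)^{(|a|-1)|b|} (Δ(a b) - Δ(a) b - (-1)^{|a|} a Δ(b))`. -/
def BVOps.bracket (A : BVOps k H) (p q r : ℤ) (h : r + 1 = p + q) (a : H p) (b : H q) : H r :=
  -(((p - 1) * q).negOnePow • (A.Δ (p + q) r h (A.mul p q (p + q) rfl a b)
      - A.mul (p - 1) q r (by omega) (A.Δ p (p - 1) (by omega) a) b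
      - p.negOnePow • A.mul p (q - 1) r (by omega) a (A.Δ q (q - 1) (by omega) b)))

/-- `f` is injective in every degree and preserves the unit, the product, the BV operator and the
bracket. -/
structure BVOps.IsUnitalEmbedding (A : BVOps k H) (B : BVOps k K) (f : ∀ n, H n →ₗ[k] K n) :
    Prop where
  injective : ∀ n, Function.Injective (f n)
  map_one : f 0 A.one = B.one
  map_mul : ∀ (p q r : ℤ) (h : p + q = r) (a : H p) (b : H q),
    f r (A.mul p q r h a b) = B.mul p q r h (f p a) (f q b)
  map_Δ : ∀ (p q : ℤ) (h : q + 1 = p) (a : H p), f q (A.Δ p q h a) = B.Δ p q h (f p a)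
  map_bracket : ∀ (p q r : ℤ) (h : r + 1 = p + q) (a : H p) (b : H q),
    f r (A.bracket p q r h a b) = B.bracket p q r h (f p a) (f q b)

end BV

end TateHH

end

/-! The Tate complex of `G` is a direct summand of the Tate-Hochschild complex of `kG`, compatibly
with all the structure.

The Tate-Hochschild complex splits over the conjugacy classes of `G`: a cochain `φ` has a component for
each class, given by the coefficients of `φ(g₁, …, gₙ)` at the elements `x g₁ ⋯ gₙ` with `x` in the
class, and a chain `(g₀, g₁, …, gₛ)` belongs to the class of `g₀ g₁ ⋯ gₛ`.  The summand of the class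
of `1` is a copy of the Tate complex: `iotaHat` is its inclusion, and `piHat` is a chain map with
`piHat ∘ iotaHat = id` (`piHat_iotaHat`, `piHat_hd`).  The inclusion commutes, on cochains and not only
up to homotopy, with the differential, the unit, the cup product and `Δ̂` (`iotaHat_gd`, `iotaHat_one`,
`iotaHat_gCup`, `iotaHat_gBV`).  Hence `x` is a cocycle, or a coboundary, of the Tate complex if and only
if `iotaHat x` is one of the Tate-Hochschild complex (`iotaHat_mem_hCocycles`,
`iotaHat_mem_hCoboundaries`).  This gives injectivity on cohomology, and it reduces every assertion
about the Tate complex to the same assertion about the Tate-Hochschild complex.  The bracket is defined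
by the product and `Δ̂`, so nothing is left to prove for it.

For the Tate-Hochschild complex three facts are needed: the differential has square zero (`hd_hd`), it
satisfies a Leibniz rule for the cup product (`hd_hCup`), and it commutes up to sign with `Δ̂` (`hBV_hd`),
which itself has square zero because of the normalization (`hBV_hBV`).  For these, the tuples are
replaced by words, that is lists.  All the differentials are signed sums over the faces of a word that
multiply two neighbouring letters, `faces`, and they differ only in what is evaluated on the faces: the
end letters of the word are the ones that act on `kG`.  The square-zero law is that of the two-sided bar
construction (`faces_faces`).  The Leibniz rule holds because the faces of a word split at each of its
letters into the faces to the left and those to the right (`faces_append`); when a product involves a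
letter summed over `G`, the faces multiplying that letter with a neighbour are reindexed
(`sum_leftFaces_concat`, `sum_rightFaces_cons`).  Connes' operator and its dual `Δ` are both signed
sums over rotations of a word, and their compatibility with the differential is the identity
`cycSum_faces` on cyclic words: the inner faces of all rotations of a cyclic word add up to all its
cyclic faces, and the two outer faces cancel. -/

noncomputable section

namespace TateHH

universe u v

/-! ### Signed sums of faces of a word -/

section Faces

variable {G : Type*} {M N : Type*} [AddCommGroup M] [AddCommGroup N]

/-- Signed sum of the faces of the word `(x, l)` that multiply two neighbouring letters; the first
letter of a face is passed to `Φ` separately from the rest. -/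
def leftFaces [Mul G] : G → List G → (G → List G → M) → M
  | _, [], _ => 0
  | x, a :: l, Φ => Φ (x * a) l - leftFaces a l fun b m => Φ x (b :: m)

/-- Signed sum of the faces of the word `(x, l, y)` that multiply two neighbouring letters, for
nonempty `l`; the end letters of a face are passed to `Φ` separately from the rest. -/
def faces [Mul G] : G → List G → G → (G → List G → G → M) → M
  | _, [], _, _ => 0
  | x, [a], y, Φ => Φ (x * a) [] y - Φ x [] (a * y)
  | x, a :: b :: l, y, Φ =>
      Φ (x * a) (b :: l) y - faces a (b :: l) y fun a' m y' => Φ x (a' :: m) y'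

/-- Signed sum of the faces of the word `(l, y)` that multiply two neighbouring letters; the last
letter of a face is passed to `Φ` separately from the rest. -/
def rightFaces [Mul G] : List G → G → (List G → G → M) → M
  | [], _, _ => 0
  | [a], y, Φ => Φ [] (a * y)
  | a :: b :: l, y, Φ => faces a (b :: l) y fun a' m y' => Φ (a' :: m) y'

theorem faces_cons [Mul G] (x a y : G) (l : List G) (Φ : G → List G → G → M) :
    faces x (a :: l) y Φ = Φ (x * a) l y - rightFaces (a :: l) y (Φ x) := by
  cases l <;> rfl

theorem rightFaces_cons [Mul G] (a y : G) {l : List G} (hl : l ≠ []) (Φ : List G → G → M) :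
    rightFaces (a :: l) y Φ = faces a l y fun a' m y' => Φ (a' :: m) y' := by
  cases l
  · exact absurd rfl hl
  · rfl

/-- The faces of a word split at each letter `a` into those to its left, where `a` counts as last
letter, and those to its right, where it counts as first letter. -/
theorem leftFaces_append [Mul G] (x a : G) (u v : List G) (Φ : G → List G → M) :
    leftFaces x (u ++ a :: v) Φ = leftFaces x (u ++ [a]) (fun x' m => Φ x' (m ++ v))
      + (-1 : ℤ) ^ (u.length + 1) • leftFaces a v fun b m => Φ x (u ++ b :: m) := by
  induction u generalizing x Φ with
  | nil => simp [leftFaces, sub_eq_add_neg]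
  | cons b u ih =>
    simp only [List.cons_append, leftFaces, ih, List.append_assoc, List.length_cons, List.nil_append]
    rw [pow_succ _ (u.length + 1)]
    module

/-- The faces of a word split at each inner letter `a` into those that involve only letters up to
`a` and those that involve only letters from `a` on.  This is the combinatorial form of the Leibniz rule. -/
theorem faces_append [Mul G] (x a y : G) (u v : List G) (Φ : G → List G → G → M) :
    faces x (u ++ a :: v) y Φ = leftFaces x (u ++ [a]) (fun x' m => Φ x' (m ++ v) y)
      + (-1 : ℤ) ^ (u.length + 1) • rightFaces (a :: v) y fun m y' => Φ x (u ++ m) y' := by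
  induction u generalizing x Φ with
  | nil => simp [leftFaces, faces_cons, sub_eq_add_neg]
  | cons b u ih =>
    rw [List.cons_append, faces_cons, rightFaces_cons _ _ (by simp), ih]
    simp only [List.cons_append, leftFaces, List.append_assoc, List.length_cons, List.nil_append]
    rw [pow_succ _ (u.length + 1)]
    module

theorem faces_concat [Mul G] (x a y : G) (u : List G) (Φ : G → List G → G → M) :
    faces x (u ++ [a]) y Φ = leftFaces x (u ++ [a]) (fun x' m => Φ x' m y)
      + (-1 : ℤ) ^ (u.length + 1) • Φ x u (a * y) := by
  simpa [rightFaces] using faces_append x a y u [] Φ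

theorem faces_map [Mul G] (f : M →+ N) (x : G) (l : List G) (y : G) (Φ : G → List G → G → M) :
    f (faces x l y Φ) = faces x l y fun x' l' y' => f (Φ x' l' y') := by
  induction l generalizing x Φ with
  | nil => simp [faces]
  | cons a l ih => cases l <;> simp [faces, ih]

theorem leftFaces_map [Mul G] (f : M →+ N) (x : G) (l : List G) (Φ : G → List G → M) :
    f (leftFaces x l Φ) = leftFaces x l fun x' l' => f (Φ x' l') := by
  induction l generalizing x Φ with
  | nil => simp [leftFaces]
  | cons a l ih => simp [leftFaces, ih]

theorem rightFaces_map [Mul G] (f : M →+ N) (l : List G) (y : G) (Φ : List G → G → M) :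
    f (rightFaces l y Φ) = rightFaces l y fun l' y' => f (Φ l' y') := by
  rcases l with _ | ⟨a, _ | ⟨b, l⟩⟩
  · simp [rightFaces]
  · simp [rightFaces]
  · simp [rightFaces, faces_map]

theorem faces_sum [Mul G] {ι : Type*} (s : Finset ι) (x : G) (l : List G) (y : G)
    (Φ : ι → G → List G → G → M) :
    faces x l y (fun x' l' y' => ∑ i ∈ s, Φ i x' l' y') = ∑ i ∈ s, faces x l y (Φ i) := by
  induction l generalizing x Φ with
  | nil => simp [faces]
  | cons a l ih => cases l <;> simp [faces, ih, Finset.sum_sub_distrib]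

theorem faces_sub [Mul G] (x : G) (l : List G) (y : G) (Φ Ψ : G → List G → G → M) :
    faces x l y (fun x' l' y' => Φ x' l' y' - Ψ x' l' y') = faces x l y Φ - faces x l y Ψ := by
  induction l generalizing x Φ Ψ with
  | nil => simp [faces]
  | cons a l ih => cases l <;> simp only [faces, ih] <;> abel

/-- Faces of a word have one letter less and the same product. -/
theorem faces_congr [Monoid G] {x : G} {l : List G} {y : G} {Φ Ψ : G → List G → G → M}
    (h : ∀ x' l' y', l'.length + 1 = l.length → x' * l'.prod * y' = x * l.prod * y →
      Φ x' l' y' = Ψ x' l' y') : faces x l y Φ = faces x l y Ψ := by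
  induction l generalizing x Φ Ψ with
  | nil => rfl
  | cons a l ih =>
    cases l with
    | nil =>
      simp only [faces]
      rw [h _ _ _ (by simp) (by simp), h _ _ _ (by simp) (by simp [mul_assoc])]
    | cons b l =>
      simp only [faces]
      rw [h _ _ _ (by simp) (by simp [mul_assoc]), ih]
      intro x' l' y' hl hp
      refine h _ _ _ (by simpa using hl) ?_
      simp only [List.prod_cons, mul_assoc] at hp ⊢
      rw [hp]

theorem faces_congr_length [Monoid G] {x : G} {l : List G} {y : G} {Φ Ψ : G → List G → G → M}
    (h : ∀ x' l' y', l'.length + 1 = l.length → Φ x' l' y' = Ψ x' l' y') :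
    faces x l y Φ = faces x l y Ψ :=
  faces_congr fun x' l' y' hl _ => h x' l' y' hl

theorem leftFaces_congr [Mul G] {x : G} {l : List G} {Φ Ψ : G → List G → M}
    (h : ∀ x' l', l'.length + 1 = l.length → Φ x' l' = Ψ x' l') :
    leftFaces x l Φ = leftFaces x l Ψ := by
  induction l generalizing x Φ Ψ with
  | nil => rfl
  | cons a l ih =>
    simp only [leftFaces]
    rw [h _ _ (by simp), ih]
    intro x' l' hl
    exact h _ _ (by simpa using hl)

theorem rightFaces_congr [Monoid G] {l : List G} {y : G} {Φ Ψ : List G → G → M}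
    (h : ∀ l' y', l'.length + 1 = l.length → Φ l' y' = Ψ l' y') :
    rightFaces l y Φ = rightFaces l y Ψ := by
  rcases l with _ | ⟨a, _ | ⟨b, l⟩⟩
  · rfl
  · exact h _ _ (by simp)
  · exact faces_congr_length fun x' l' y' hl => h _ _ (by simpa using hl)

/-- The end letters of a word may be multiplied from outside before or after taking faces. -/
theorem faces_mul [Monoid G] (c d x y : G) {l : List G} (Φ : G → List G → G → M) :
    faces x l y (fun x' l' y' => Φ (c * x') l' (y' * d)) = faces (c * x) l (y * d) Φ := by
  induction l generalizing x c Φ with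
  | nil => rfl
  | cons a l ih =>
    cases l with
    | nil => simp [faces, mul_assoc]
    | cons b l =>
      have := ih 1 a fun a' m y' => Φ (c * x) (a' :: m) y'
      simp only [one_mul] at this
      simp [faces, mul_assoc, this]

/-- The square of the differential of the two-sided bar construction is zero. -/
theorem faces_faces [Monoid G] (x y : G) {l : List G} (Φ : G → List G → G → M)
    (hl : 2 ≤ l.length) : faces x l y (fun x' l' y' => faces x' l' y' Φ) = 0 := by
  induction l generalizing x Φ with
  | nil => rfl
  | cons a l ih =>
    rcases l with _ | ⟨b, _ | ⟨c, l⟩⟩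
    · simp at hl
    · simp [faces, mul_assoc]
    · rw [faces_cons, rightFaces_cons _ _ (by simp)]
      have h1 : faces a (b :: c :: l) y (fun a' m y' => faces x (a' :: m) y' Φ)
          = faces a (b :: c :: l) y (fun a' m y' => Φ (x * a') m y')
            - faces a (b :: c :: l) y
              (fun a' m y' => faces a' m y' fun a'' m' y'' => Φ x (a'' :: m') y'') := by
        rw [← faces_sub]
        refine faces_congr_length fun x' l' y' hl' => ?_
        rw [faces_cons, rightFaces_cons _ _ (by rintro rfl; simp at hl')]
      have h2 := faces_mul x 1 a y (l := b :: c :: l) Φ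
      simp only [mul_one] at h2
      rw [h1, ih a _ (by simp), h2, sub_zero, sub_self]

theorem leftFaces_eq_zero [Mul G] {x : G} {l : List G} {Φ : G → List G → M}
    (h : ∀ x' l', l'.length + 1 = l.length → Φ x' l' = 0) : leftFaces x l Φ = 0 := by
  rw [leftFaces_congr h]
  simpa using (leftFaces_map (0 : M →+ M) x l Φ).symm

theorem faces_eq_zero [Monoid G] {x : G} {l : List G} {y : G} {Φ : G → List G → G → M}
    (h : ∀ x' l' y', l'.length + 1 = l.length → Φ x' l' y' = 0) : faces x l y Φ = 0 := by
  rw [faces_congr_length h]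
  simpa using (faces_map (0 : M →+ M) x l y Φ).symm

/-- The two faces that multiply an inner letter `1` into a neighbour cancel, so normalized functions
are preserved by the differential of the bar construction. -/
theorem faces_eq_zero_of_one_mem [Monoid G] {x : G} {l : List G} {y : G} {Φ : G → List G → G → M}
    (hΦ : ∀ x' l' y', 1 ∈ l' → Φ x' l' y' = 0) (hl : 1 ∈ l) : faces x l y Φ = 0 := by
  obtain ⟨u, v, rfl⟩ := List.append_of_mem hl
  have hL : leftFaces x (u ++ [1]) (fun x' m => Φ x' (m ++ v) y)
      = (-1 : ℤ) ^ u.length • Φ x (u ++ v) y := by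
    rcases List.eq_nil_or_concat u with rfl | ⟨u', b, rfl⟩
    · simp [leftFaces]
    · rw [List.concat_eq_append, List.append_assoc, List.singleton_append, leftFaces_append]
      simp only [leftFaces, mul_one, sub_zero, List.append_assoc, List.singleton_append,
        List.length_append, List.length_singleton]
      rw [leftFaces_eq_zero fun x' l' _ => hΦ _ _ _ (by simp), zero_add]
  have hR : rightFaces (1 :: v) y (fun m y' => Φ x (u ++ m) y') = Φ x (u ++ v) y := by
    rcases v with _ | ⟨b, v⟩
    · simp [rightFaces]
    · have h1 := faces_cons 1 b y v fun a' m y' => Φ x (u ++ a' :: m) y'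
      rw [rightFaces_cons _ _ (by simp), h1, one_mul]
      cases v with
      | nil => simp [rightFaces, hΦ x (u ++ [1]) (b * y) (by simp)]
      | cons c v =>
        rw [rightFaces_cons _ _ (by simp), faces_eq_zero fun x' l' y' _ => hΦ _ _ _ (by simp),
          sub_zero]
  rw [faces_append, hL, hR, pow_succ]
  module

/-- The differential of the bar construction on tuples. -/
theorem faces_ofFn [Mul G] {n : ℕ} (x y : G) (g : Fin (n + 1) → G) (Φ : G → List G → G → M) :
    faces x (List.ofFn g) y Φ = Φ (x * g 0) (List.ofFn (Fin.tail g)) y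
      + ∑ i : Fin n, (-1 : ℤ) ^ (i.val + 1) •
          Φ x (List.ofFn (Fin.contractNth i.castSucc (· * ·) g)) y
      + (-1 : ℤ) ^ (n + 1) • Φ x (List.ofFn (Fin.init g)) (g (Fin.last n) * y) := by
  induction n generalizing x Φ with
  | zero => simp [faces, sub_eq_add_neg]
  | succ n ih =>
    have h1 : List.ofFn g = g 0 :: List.ofFn (Fin.tail g) := by
      rw [List.ofFn_succ]; rfl
    have h2 : List.ofFn (Fin.init g) = g 0 :: List.ofFn (Fin.init (Fin.tail g)) := by
      rw [List.ofFn_succ]; rfl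
    have h3 : List.ofFn (Fin.contractNth (0 : Fin (n + 1)).castSucc (· * ·) g)
        = (g 0 * Fin.tail g 0) :: List.ofFn (Fin.tail (Fin.tail g)) := by
      rw [List.ofFn_succ]
      congr 1
    have h4 : ∀ i : Fin n, List.ofFn (Fin.contractNth i.succ.castSucc (· * ·) g)
        = g 0 :: List.ofFn (Fin.contractNth i.castSucc (· * ·) (Fin.tail g)) := by
      intro i
      rw [List.ofFn_succ]
      congr 1
      congr 1
      ext j
      simp [Fin.contractNth, Fin.tail]
    rw [h1, faces_cons, rightFaces_cons _ _ (by simp), ih, Fin.sum_univ_succ, h3, h2]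
    simp only [h4, Fin.val_succ, Fin.val_zero, zero_add, pow_one]
    simp only [pow_succ (-1 : ℤ) (_ + 1), neg_smul, one_smul,
      Finset.sum_neg_distrib, mul_neg, mul_one]
    simp only [Fin.tail, Fin.succ_last]
    abel

/-- Left faces of a word with last letter `a` are the faces of the word with end letter `a`, which is
put back into each face. -/
theorem leftFaces_concat [Mul G] (x a : G) {u : List G} (hu : u ≠ []) (Ψ : G → List G → M) :
    leftFaces x (u ++ [a]) Ψ = faces x u a fun x' u' a' => Ψ x' (u' ++ [a']) := by
  induction u generalizing x Ψ with
  | nil => exact absurd rfl hu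
  | cons b u ih =>
    cases u with
    | nil => simp [leftFaces, faces]
    | cons c u =>
      rw [List.cons_append, leftFaces, ih _ (by simp)]
      rfl

/-! ### Reindexing a letter summed over the group -/

section Group

variable [Group G] [Fintype G]

/-- In left faces of a word whose last letter is summed over the group, the product of that letter
with its left neighbour can be made the letter of summation.  What remains are the faces of a
word without that letter, and the factor taken out of it acts on the function. -/
theorem sum_leftFaces_concat (x : G) {u : List G} (hu : u ≠ []) (Ψ : G → G → List G → M) :
    ∑ g, leftFaces x (u ++ [g]) (Ψ g)
      = faces x u 1 fun x' u' y => ∑ g, Ψ (y⁻¹ * g) x' (u' ++ [g]) := by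
  have h1 : ∀ g, leftFaces x (u ++ [g]) (Ψ g)
      = faces x u 1 fun x' u' y => Ψ g x' (u' ++ [y * g]) := by
    intro g
    have := faces_mul 1 g x 1 (l := u) fun x' u' y => Ψ g x' (u' ++ [y])
    simp only [one_mul] at this
    rw [leftFaces_concat _ _ hu, this]
  simp only [h1]
  rw [← faces_sum]
  refine faces_congr_length fun x' u' y _ => ?_
  exact Fintype.sum_equiv (Equiv.mulLeft y) _ _ fun g => by simp

/-- The mirror image of `sum_leftFaces_concat`, for a first letter summed over the group. -/
theorem sum_rightFaces_cons (y : G) {v : List G} (hv : v ≠ []) (Ψ : G → List G → G → M) :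
    ∑ g, rightFaces (g :: v) y (Ψ g)
      = faces 1 v y fun x v' y' => ∑ g, Ψ (g * x⁻¹) (g :: v') y' := by
  have h1 : ∀ g, rightFaces (g :: v) y (Ψ g)
      = faces 1 v y fun x v' y' => Ψ g (g * x :: v') y' := by
    intro g
    have := faces_mul g 1 1 y (l := v) fun x v' y' => Ψ g (x :: v') y'
    simp only [mul_one] at this
    rw [rightFaces_cons _ _ hv, this]
  simp only [h1]
  rw [← faces_sum]
  refine faces_congr_length fun x v' y' _ => ?_
  exact Fintype.sum_equiv (Equiv.mulRight x) _ _ fun g => by simp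

end Group

end Faces

/-! ### Signed cyclic sums -/

section Cyclic

variable {G : Type*} {M N : Type*} [AddCommGroup M] [AddCommGroup N]

/-- The word `l` with its letters in positions `j` and `j + 1` (counted from `0`) multiplied. -/
def mergeAt [Mul G] : ℕ → List G → List G
  | 0, a :: b :: l => a * b :: l
  | j + 1, a :: l => a :: mergeAt j l
  | _, l => l

theorem mergeAt_append [Mul G] (u v : List G) : mergeAt u.length (u ++ v) = u ++ mergeAt 0 v := by
  induction u with
  | nil => rfl
  | cons a u ih => simp [mergeAt, ih]

theorem mergeAt_zero_append [Mul G] {u : List G} (hu : 2 ≤ u.length) (v : List G) :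
    mergeAt 0 (u ++ v) = mergeAt 0 u ++ v := by
  rcases u with _ | ⟨a, _ | ⟨b, u⟩⟩
  · simp at hu
  · simp at hu
  · rfl

theorem length_mergeAt_zero [Mul G] {u : List G} (hu : 2 ≤ u.length) :
    (mergeAt 0 u).length = u.length - 1 := by
  rcases u with _ | ⟨a, _ | ⟨b, u⟩⟩
  · simp at hu
  · simp at hu
  · simp [mergeAt]

/-- For a function of the whole word, left faces are an alternating sum of merged words. -/
theorem leftFaces_eq_sum [Mul G] (x : G) (l : List G) (F : List G → M) :
    leftFaces x l (fun x' m => F (x' :: m))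
      = ∑ j ∈ Finset.range l.length, (-1 : ℤ) ^ j • F (mergeAt j (x :: l)) := by
  induction l generalizing x F with
  | nil => simp [leftFaces]
  | cons a l ih =>
    have := ih a fun m => F (x :: m)
    simp only [leftFaces, this, List.length_cons, Finset.sum_range_succ', mergeAt, pow_succ]
    simp [Finset.sum_neg_distrib, sub_eq_add_neg, add_comm]

/-- The sum of all rotations of a cyclic word of `n` letters, a rotation by one letter carrying the
sign `(-1) ^ (n - 1)`. -/
def cycSum (l : List G) (F : List G → M) : M :=
  ∑ i ∈ Finset.range l.length, (-1 : ℤ) ^ ((l.length - 1) * i) • F (l.rotate i)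

theorem cycSum_map (f : M →+ N) (l : List G) (F : List G → M) :
    f (cycSum l F) = cycSum l fun m => f (F m) := by
  simp [cycSum]

theorem cycSum_congr {l : List G} {F F' : List G → M}
    (h : ∀ m, m.length = l.length → (∀ x, x ∈ m ↔ x ∈ l) → F m = F' m) :
    cycSum l F = cycSum l F' :=
  Finset.sum_congr rfl fun i _ => by rw [h _ (by simp) (by simp)]

theorem cycSum_add (l : List G) (F F' : List G → M) :
    cycSum l (fun m => F m + F' m) = cycSum l F + cycSum l F' := by
  simp [cycSum, Finset.sum_add_distrib]

theorem cycSum_sum {ι : Type*} (s : Finset ι) (l : List G) (F : ι → List G → M) :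
    cycSum l (fun m => ∑ i ∈ s, F i m) = ∑ i ∈ s, cycSum l (F i) := by
  simp only [cycSum, Finset.smul_sum]
  exact Finset.sum_comm

theorem cycSum_smul (c : ℤ) (l : List G) (F : List G → M) :
    cycSum l (fun m => c • F m) = c • cycSum l F := by
  simp only [cycSum, Finset.smul_sum, smul_comm c]

theorem exists_append_of_le_length {l : List G} {j : ℕ} (hj : j ≤ l.length) :
    ∃ u v, l = u ++ v ∧ u.length = j :=
  ⟨l.take j, l.drop j, (List.take_append_drop j l).symm, by simpa using hj⟩

theorem neg_one_pow_mul_self (n : ℕ) : (-1 : ℤ) ^ (n * n) = (-1) ^ n := by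
  rcases Nat.even_or_odd n with h | h
  · rw [h.neg_one_pow, (h.mul_right _).neg_one_pow]
  · rw [h.neg_one_pow, (h.mul h).neg_one_pow]

theorem even_pred_mul_self (n : ℕ) : Even ((n - 1) * n) := by
  cases n with
  | zero => simp
  | succ n => simpa using Nat.even_mul_succ_self n

/-- Invariance of cyclic sums under signed rotation of the summand. -/
theorem cycSum_rotate (l : List G) (F : List G → M) (i : ℕ) :
    cycSum l F = (-1 : ℤ) ^ ((l.length - 1) * i) • cycSum l fun m => F (m.rotate i) := by
  induction i generalizing F with
  | zero => simp
  | succ i ih =>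
    have key : ∀ F : List G → M, cycSum l F
        = (-1 : ℤ) ^ (l.length - 1) • cycSum l fun m => F (m.rotate 1) := by
      intro F
      simp only [cycSum, List.rotate_rotate, Finset.smul_sum, smul_smul, ← pow_add]
      have h1 := Finset.sum_range_succ'
        (fun i => (-1 : ℤ) ^ ((l.length - 1) * i) • F (l.rotate i)) l.length
      rw [Finset.sum_range_succ, (even_pred_mul_self _).neg_one_pow, List.rotate_length] at h1
      simp only [mul_zero, pow_zero, List.rotate_zero, add_left_inj] at h1
      rw [h1]
      exact Finset.sum_congr rfl fun i _ => by rw [mul_add, mul_one, add_comm]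
    rw [ih, key]
    simp only [List.rotate_rotate]
    rw [smul_smul, ← pow_add, mul_add, mul_one, add_comm 1 i]

/-- Signed rotation of the argument of a cyclic sum. -/
theorem cycSum_append_comm (u v : List G) (F : List G → M) :
    cycSum (u ++ v) F = (-1 : ℤ) ^ ((u.length + v.length - 1) * u.length) • cycSum (v ++ u) F := by
  have h := cycSum_rotate (u ++ v) F u.length
  rw [h, List.length_append]
  congr 1
  rw [← List.rotate_append_length_eq u v]
  simp only [cycSum, List.length_rotate, List.length_append, List.rotate_rotate]
  exact Finset.sum_congr rfl fun i _ => by rw [add_comm i]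

/-- Merging two neighbouring letters of a cyclic word in all rotations and positions. -/
theorem cycSum_merge [Mul G] {l : List G} (hl : 2 ≤ l.length) (F : List G → M) :
    cycSum l (fun m => ∑ j ∈ Finset.range (l.length - 1), (-1 : ℤ) ^ j • F (mergeAt j m))
      = cycSum l fun m => cycSum (mergeAt 0 m) F := by
  set n := l.length with hn
  -- `g i` collects the words obtained by merging the first two letters and then rotating by `i`; it
  -- depends on `i` modulo `n - 1` only, so the sum can be taken over `n - 1 - j` instead.
  let g : ℕ → M := fun i => (-1 : ℤ) ^ ((n - 1 - 1) * i) •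
    cycSum l fun m => F ((mergeAt 0 m).rotate i)
  have hR : cycSum l (fun m => cycSum (mergeAt 0 m) F) = ∑ i ∈ Finset.range (n - 1), g i := by
    simp only [g, ← cycSum_smul]
    rw [← cycSum_sum]
    refine cycSum_congr fun m hm _ => ?_
    rw [cycSum, length_mergeAt_zero (by omega), hm, ← hn]
  have hg : g (n - 1) = g 0 := by
    simp only [g, (even_pred_mul_self (n - 1)).neg_one_pow, mul_zero, pow_zero, List.rotate_zero]
    congr 1
    refine cycSum_congr fun m hm _ => ?_
    have h := List.rotate_length (mergeAt 0 m)
    rw [length_mergeAt_zero (by omega), hm, ← hn] at h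
    rw [h]
  have hsum : ∑ i ∈ Finset.range (n - 1), g i = ∑ j ∈ Finset.range (n - 1), g (n - 1 - j) := by
    have h1 := (Finset.sum_range_succ g (n - 1)).symm.trans (Finset.sum_range_succ' g (n - 1))
    rw [hg, add_left_inj] at h1
    rw [h1, ← Finset.sum_range_reflect]
    refine Finset.sum_congr rfl fun j hj => ?_
    rw [Finset.mem_range] at hj
    congr 1
    omega
  rw [hR, hsum, cycSum_sum]
  refine Finset.sum_congr rfl fun j hj => ?_
  rw [Finset.mem_range] at hj
  obtain ⟨c, hc⟩ : ∃ c, n = j + 2 + c := ⟨n - (j + 2), by omega⟩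
  -- Merging in position `j` after rotating by `n - j` merges the first two letters of `m`.
  have h2 : cycSum l (fun m => F (mergeAt j (m.rotate (n - j))))
      = cycSum l fun m => F ((mergeAt 0 m).rotate (n - 1 - j)) := by
    refine cycSum_congr fun m hm _ => ?_
    obtain ⟨u, v, rfl, hu⟩ := exists_append_of_le_length (l := m) (j := n - j) (by omega)
    have hv : v.length = j := by rw [List.length_append] at hm; omega
    have h0 : (mergeAt 0 u).length = n - 1 - j := by
      rw [length_mergeAt_zero (by omega), hu]; omega
    rw [mergeAt_zero_append (by omega), ← hu, List.rotate_append_length_eq, ← h0,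
      List.rotate_append_length_eq, ← hv, mergeAt_append]
  rw [cycSum_smul, cycSum_rotate l _ (n - j), h2, smul_smul, ← pow_add, ← hn]
  congr 1
  have e : j + (n - 1) * (n - j) = (n - 1 - 1) * (n - 1 - j) + 2 * (j + c + 1) := by
    rw [hc, show j + 2 + c - 1 = j + 1 + c by omega, show j + 2 + c - j = c + 2 by omega,
      show j + 1 + c - 1 = j + c by omega, show j + 1 + c - j = c + 1 by omega]
    ring
  rw [e, pow_add _ ((n - 1 - 1) * (n - 1 - j)), (even_two_mul _).neg_one_pow, mul_one]

/-- On cyclic sums, the inner faces of all rotations add up to all the faces of a cyclic word. -/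
theorem cycSum_inner_faces [Monoid G] (x : G) {l : List G} (hl : l ≠ []) (F : List G → M) :
    cycSum (x :: l) (fun m => ∑ j ∈ Finset.range l.length, (-1 : ℤ) ^ j • F (mergeAt j m))
      = faces x l 1 fun x' l' y' => cycSum (y' * x' :: l') F := by
  have h := cycSum_merge (l := x :: l)
    (by have := List.length_pos_of_ne_nil hl; simp only [List.length_cons]; omega) F
  simp only [List.length_cons, Nat.add_sub_cancel] at h
  rw [h]
  obtain ⟨u, a, rfl⟩ := (List.eq_nil_or_concat l).resolve_left hl
  rw [List.concat_eq_append, faces_concat]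
  simp only [one_mul, mul_one]
  rw [leftFaces_eq_sum x (u ++ [a]) fun m => cycSum m F]
  conv_lhs => rw [cycSum, List.length_cons, Finset.sum_range_succ]
  congr 1
  · refine Finset.sum_congr rfl fun j hj => ?_
    rw [Finset.mem_range] at hj
    obtain ⟨p, q, hpq, hp⟩ := exists_append_of_le_length (l := x :: (u ++ [a])) (j := j)
      (by simp only [List.length_cons]; omega)
    have hlen : p.length + q.length = u.length + 2 := by
      rw [← List.length_append, ← hpq]; simp
    simp only [List.length_append, List.length_singleton] at hj
    rw [hpq, ← hp, List.rotate_append_length_eq, mergeAt_append,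
      mergeAt_zero_append (by omega), cycSum_append_comm p, smul_smul, ← pow_add,
      length_mergeAt_zero (by omega)]
    congr 2
    simp only [List.length_append, List.length_singleton, Nat.add_sub_cancel]
    rw [show p.length + (q.length - 1) - 1 = u.length by omega]
    ring
  · have h1 : (x :: (u ++ [a])).rotate (u ++ [a]).length = a :: x :: u := by
      simp
    rw [h1]
    simp only [mergeAt, List.length_append, List.length_cons, List.length_nil, zero_add,
      Nat.add_sub_cancel]
    rw [neg_one_pow_mul_self]

theorem faces_cons_concat [Monoid G] {x a : G} (u : List G) (Φ : G → List G → G → M) :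
    faces 1 (x :: (u ++ [a])) 1 Φ = Φ x (u ++ [a]) 1
      - ∑ j ∈ Finset.range (u.length + 1), (-1 : ℤ) ^ j • Φ 1 (mergeAt j (x :: (u ++ [a]))) 1
      + (-1 : ℤ) ^ (u.length + 2) • Φ 1 (x :: u) a := by
  rw [faces_cons, rightFaces_cons _ _ (by simp), faces_concat,
    leftFaces_eq_sum x (u ++ [a]) fun m => Φ 1 m 1]
  simp only [one_mul, mul_one, List.length_append, List.length_singleton, pow_succ]
  module

/-- Connes' operator anticommutes with the Hochschild differential.  A cyclic word starting with `1`
has, besides its inner faces, two outer faces, and these cancel in the sum over all rotations. -/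
theorem cycSum_faces [Monoid G] (x : G) {l : List G} (hl : l ≠ []) (Φ : G → List G → G → M)
    (hΦ : ∀ a m, Φ a m 1 = Φ 1 m a) :
    cycSum (x :: l) (fun m => faces 1 m 1 Φ)
      = -faces x l 1 fun x' l' y' => cycSum (y' * x' :: l') fun m => Φ 1 m 1 := by
  rw [← cycSum_inner_faces x hl]
  have hpos := List.length_pos_of_ne_nil hl
  -- `H` gives the first outer face; the last one is `H` of a rotated word, by `hΦ`.
  let H : List G → M := fun m => Φ (m.headD 1) m.tail 1
  have h1 : cycSum (x :: l) (fun m => faces 1 m 1 Φ) = cycSum (x :: l) fun m =>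
      H m + ((-1 : ℤ) • (∑ j ∈ Finset.range l.length, (-1 : ℤ) ^ j • Φ 1 (mergeAt j m) 1)
        + (-1 : ℤ) ^ (l.length + 1) • H (m.rotate l.length)) := by
    refine cycSum_congr fun m hm _ => ?_
    rcases m with _ | ⟨b, m⟩
    · simp at hm
    obtain rfl | ⟨u, a, rfl⟩ := List.eq_nil_or_concat m
    · exact absurd (by simpa using hm) (Ne.symm hl)
    rw [List.concat_eq_append] at hm ⊢
    simp only [List.length_cons, List.length_append, add_left_inj, List.length_nil,
      zero_add] at hm
    have h2 : (b :: (u ++ [a])).rotate (u.length + 1) = a :: b :: u := by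
      simp
    rw [faces_cons_concat, ← hm, h2]
    simp only [H, List.headD_cons, List.tail_cons, hΦ]
    module
  rw [h1, cycSum_add, cycSum_add, cycSum_smul, cycSum_smul, cycSum_rotate (x :: l) H l.length,
    List.length_cons, Nat.add_sub_cancel]
  rw [neg_one_pow_mul_self, pow_succ]
  module

end Cyclic

/-! ### Cochains and chains evaluated on words -/

section Words

variable (k : Type u) [Field k] {G : Type v} [Group G]

theorem neg_one_pow_smul {M : Type*} [AddCommGroup M] [Module k M] (n : ℕ) (x : M) :
    (-1 : k) ^ n • x = (-1 : ℤ) ^ n • x := by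
  rcases Nat.even_or_odd n with h | h <;> simp [h.neg_one_pow]

theorem exists_eq_ofFn {G : Type*} {s : ℕ} {l : List G} (hl : l.length = s) :
    ∃ g : Fin s → G, l = List.ofFn g := by
  subst hl
  exact ⟨l.get, (List.ofFn_get l).symm⟩

theorem exists_eq_ofFn_vals {s : ℕ} {l : List G} (hl : l.length = s) (h1 : 1 ∉ l) :
    ∃ g : Fin s → NonId G, l = List.ofFn (vals g) := by
  obtain ⟨g, rfl⟩ := exists_eq_ofFn hl
  refine ⟨fun i => ⟨g i, fun h => h1 ?_⟩, rfl⟩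
  rw [List.mem_ofFn]
  exact ⟨i, h⟩

variable {M : Type*} [AddCommGroup M] [Module k M]

theorem evalAt_vals {n : ℕ} (g : Fin n → NonId G) (α : (Fin n → NonId G) → M) :
    evalAt k (vals g) α = α g := by
  have h : ∀ i, vals g i ≠ 1 := fun i => (g i).2
  rw [evalAt, dif_pos h]
  rfl

theorem evalAt_of_one {n : ℕ} {g : Fin n → G} {i : Fin n} (hi : g i = 1)
    (α : (Fin n → NonId G) → M) : evalAt k g α = 0 := by
  rw [evalAt, dif_neg fun h => h i hi]
  rfl

/-- Value of an `n`-cochain on a word of length `n`; it is zero on words of another length and on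
words containing `1`. -/
def evalWord (n : ℕ) : ((Fin n → NonId G) → M) →ₗ[k] (List G → M) :=
  LinearMap.pi fun l =>
    if h : l.length = n then evalAt k fun i => l.get (i.cast h.symm) else 0

theorem evalWord_ofFn {n : ℕ} (α : (Fin n → NonId G) → M) (g : Fin n → G) :
    evalWord k n α (List.ofFn g) = evalAt k g α := by
  rw [evalWord, LinearMap.pi_apply, dif_pos (List.length_ofFn)]
  congr 2
  ext i
  simp

theorem evalWord_of_one_mem {n : ℕ} (α : (Fin n → NonId G) → M) {l : List G} (hl : 1 ∈ l) :
    evalWord k n α l = 0 := by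
  rw [evalWord, LinearMap.pi_apply]
  split_ifs with h
  · obtain ⟨g, rfl⟩ := exists_eq_ofFn h
    obtain ⟨i, hi⟩ := List.mem_ofFn.1 hl
    exact evalAt_of_one k (i := i) (by simpa using hi) α
  · rfl

theorem evalWord_ext {n : ℕ} {α β : (Fin n → NonId G) → M}
    (h : ∀ l : List G, l.length = n → evalWord k n α l = evalWord k n β l) : α = β := by
  ext1 g
  rw [← evalAt_vals k g α, ← evalAt_vals k g β, ← evalWord_ofFn, ← evalWord_ofFn]
  exact h _ (List.length_ofFn)

/-- To compute a cochain on words, it suffices to do so on words without `1` if the proposed values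
vanish on the other words. -/
theorem evalWord_eq {n : ℕ} {α : (Fin n → NonId G) → M} {F : List G → M}
    (hF : ∀ l, 1 ∈ l → F l = 0) (h : ∀ g : Fin n → NonId G, α g = F (List.ofFn (vals g)))
    {l : List G} (hl : l.length = n) : evalWord k n α l = F l := by
  by_cases h1 : 1 ∈ l
  · rw [evalWord_of_one_mem k α h1, hF l h1]
  · obtain ⟨g, rfl⟩ := exists_eq_ofFn_vals hl h1
    rw [evalWord_ofFn, evalAt_vals, h]

open Classical in
/-- The Hochschild chain `(z, l)`, linear in `z ∈ kG`; it is zero if the word `l` does not have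
length `s` or contains `1`. -/
def hWord (s : ℕ) (l : List G) : MonoidAlgebra k G →ₗ[k] HChain k G s :=
  if h : l.length = s ∧ ∀ i : Fin l.length, l.get i ≠ 1 then
    hPlace k fun i => ⟨l.get (i.cast h.1.symm), h.2 _⟩ else 0

open Classical in
/-- The group chain `l`; it is zero if the word `l` does not have length `s` or contains `1`. -/
def gWord (s : ℕ) (l : List G) : GChain k G s :=
  if h : l.length = s ∧ ∀ i : Fin l.length, l.get i ≠ 1 then
    Finsupp.single (fun i => ⟨l.get (i.cast h.1.symm), h.2 _⟩) 1 else 0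

theorem hPlace_single {s : ℕ} (g : Fin s → NonId G) (x : G) (c : k) :
    hPlace k g (MonoidAlgebra.single x c) = Finsupp.single (x, g) c := by
  simp [hPlace, Finsupp.lmapDomain_apply]

theorem hWord_ofFn_vals {s : ℕ} (g : Fin s → NonId G) :
    hWord k s (List.ofFn (vals g)) = hPlace k g := by
  rw [hWord, dif_pos ⟨List.length_ofFn, fun i => by simpa [vals] using (g _).2⟩]
  congr 1
  ext i
  simp [vals]

theorem gWord_ofFn_vals {s : ℕ} (g : Fin s → NonId G) :
    gWord k s (List.ofFn (vals g)) = Finsupp.single g 1 := by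
  rw [gWord, dif_pos ⟨List.length_ofFn, fun i => by simpa [vals] using (g _).2⟩]
  congr 1
  ext i
  simp [vals]

theorem hWord_of_one_mem {s : ℕ} {l : List G} (hl : 1 ∈ l) : hWord k s l = 0 := by
  rw [hWord, dif_neg]
  rintro ⟨-, h⟩
  obtain ⟨i, hi⟩ := List.get_of_mem hl
  exact h i hi

theorem gWord_of_one_mem {s : ℕ} {l : List G} (hl : 1 ∈ l) : gWord k s l = 0 := by
  rw [gWord, dif_neg]
  rintro ⟨-, h⟩
  obtain ⟨i, hi⟩ := List.get_of_mem hl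
  exact h i hi

theorem hBasis_eq {s : ℕ} (x : G) (g : Fin s → G) :
    hBasis k x g = hWord k s (List.ofFn g) (el k x) := by
  by_cases h : ∀ i, g i ≠ 1
  · rw [hBasis, dif_pos h]
    have := hWord_ofFn_vals k (fun i => (⟨g i, h i⟩ : NonId G))
    rw [show vals (fun i => (⟨g i, h i⟩ : NonId G)) = g from rfl] at this
    rw [this, el, hPlace_single]
  · rw [hBasis, dif_neg h, hWord_of_one_mem]
    · rfl
    · push Not at h
      exact List.mem_ofFn.2 h

theorem gBasis_eq {s : ℕ} (g : Fin s → G) : gBasis k g = gWord k s (List.ofFn g) := by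
  by_cases h : ∀ i, g i ≠ 1
  · rw [gBasis, dif_pos h]
    have := gWord_ofFn_vals k (fun i => (⟨g i, h i⟩ : NonId G))
    rw [show vals (fun i => (⟨g i, h i⟩ : NonId G)) = g from rfl] at this
    rw [this]
  · rw [gBasis, dif_neg h, gWord_of_one_mem]
    push Not at h
    exact List.mem_ofFn.2 h

/-- Two linear functions of `z ∈ kG` and of a word agree on words of a given length if they agree on
group elements and words without `1`, provided that they vanish on the other words. -/
theorem linear_eq_of_words {s : ℕ} {F F' : List G → MonoidAlgebra k G →ₗ[k] M}
    (hF : ∀ l, 1 ∈ l → F l = 0) (hF' : ∀ l, 1 ∈ l → F' l = 0)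
    (h : ∀ (g : Fin s → NonId G) (x : G),
      F (List.ofFn (vals g)) (el k x) = F' (List.ofFn (vals g)) (el k x))
    {l : List G} (hl : l.length = s) : F l = F' l := by
  by_cases h1 : 1 ∈ l
  · rw [hF l h1, hF' l h1]
  · obtain ⟨g, rfl⟩ := exists_eq_ofFn_vals hl h1
    exact MonoidAlgebra.lhom_ext' fun x => LinearMap.ext_ring (h g x)

theorem hChain_induction {s : ℕ} {p : HChain k G s → Prop} (hadd : ∀ x y, p x → p y → p (x + y))
    (hword : ∀ l z, l.length = s → p (hWord k s l z)) (x : HChain k G s) : p x := by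
  induction x using Finsupp.induction_linear with
  | zero => simpa using hword (List.replicate s 1) 0 (by simp)
  | add f g hf hg => exact hadd f g hf hg
  | single a c =>
    have := hword (List.ofFn (vals a.2)) (MonoidAlgebra.single a.1 c) (List.length_ofFn)
    rwa [hWord_ofFn_vals, hPlace_single] at this

theorem gChain_ext {s : ℕ} {f f' : GChain k G s →ₗ[k] M}
    (h : ∀ l, l.length = s → f (gWord k s l) = f' (gWord k s l)) : f = f' := by
  refine Finsupp.lhom_ext' fun g => LinearMap.ext_ring ?_
  have := h (List.ofFn (vals g)) (List.length_ofFn)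
  rwa [gWord_ofFn_vals] at this

end Words

/-! ### Differentials and cup products of Tate-Hochschild cochains and chains on words -/

section Components

variable (k : Type u) [Field k] {G : Type v} [Group G]

theorem vals_append {n m : ℕ} (g : Fin n → NonId G) (h : Fin m → NonId G) :
    vals (Fin.append g h) = Fin.append (vals g) (vals h) := by
  ext i
  refine Fin.addCases (fun i => ?_) (fun i => ?_) i <;> simp [vals]

theorem ofFn_vals_append {n m : ℕ} (g : Fin n → NonId G) (h : Fin m → NonId G) :
    List.ofFn (vals g) ++ List.ofFn (vals h) = List.ofFn (vals (Fin.append g h)) := by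
  rw [vals_append, List.ofFn_fin_append]

theorem ofFn_append_cons {G : Type*} {n m : ℕ} (g : Fin n → G) (a : G) (h : Fin m → G) :
    List.ofFn (Fin.append g (Fin.cons a h : Fin (m + 1) → G)) = List.ofFn g ++ a :: List.ofFn h := by
  rw [List.ofFn_fin_append, List.ofFn_cons]

theorem hδ_word {n : ℕ} (α : HCochain k G n) {l : List G} (hl : l.length = n + 1) :
    evalWord k (n + 1) (hδ k G n α) l
      = faces 1 l 1 fun x l' y => el k x * evalWord k n α l' * el k y := by
  refine evalWord_eq k (fun l h1 => faces_eq_zero_of_one_mem (fun x l' y h => ?_) h1)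
    (fun g => ?_) hl
  · rw [evalWord_of_one_mem k α h]; simp
  · rw [faces_ofFn]
    have h1 : el k (1 : G) = 1 := rfl
    have h2 : List.ofFn (Fin.tail (vals g)) = List.ofFn (vals (Fin.tail g)) := rfl
    have h3 : List.ofFn (Fin.init (vals g)) = List.ofFn (vals (Fin.init g)) := rfl
    simp only [hδ, LinearMap.pi_apply, LinearMap.add_apply, LinearMap.comp_apply,
      LinearMap.sum_apply, LinearMap.smul_apply, LinearMap.mulLeft_apply, LinearMap.mulRight_apply,
      neg_one_pow_smul, h1, h2, h3, evalWord_ofFn, one_mul, mul_one]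
    rfl

theorem hBd_word {s : ℕ} {l : List G} (hl : l.length = s + 1) (z : MonoidAlgebra k G) :
    hBd k G s (hWord k (s + 1) l z)
      = faces 1 l 1 fun x l' y => hWord k s l' (el k y * z * el k x) := by
  have key := linear_eq_of_words k (F := fun l => hBd k G s ∘ₗ hWord k (s + 1) l)
    (F' := fun l => faces 1 l 1 fun x l' y =>
      hWord k s l' ∘ₗ LinearMap.mulRight k (el k x) ∘ₗ LinearMap.mulLeft k (el k y))
    (fun l h => by simp only [hWord_of_one_mem k h, LinearMap.comp_zero])
    (fun l h => faces_eq_zero_of_one_mem (fun x l' y h => by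
      rw [hWord_of_one_mem k h, LinearMap.zero_comp]) h)
    (fun g a => ?_) hl
  · have := DFunLike.congr_fun key z
    simp only [LinearMap.comp_apply] at this
    rw [this]
    exact faces_map (G := G) (M := MonoidAlgebra k G →ₗ[k] HChain k G s) (N := HChain k G s)
      (LinearMap.applyₗ z : _ →ₗ[k] _).toAddMonoidHom _ _ _ _
  · have h2 : List.ofFn (Fin.tail (vals g)) = List.ofFn (vals (Fin.tail g)) := rfl
    have h3 : List.ofFn (Fin.init (vals g)) = List.ofFn (vals (Fin.init g)) := rfl
    rw [faces_ofFn, LinearMap.comp_apply, hWord_ofFn_vals, el, hPlace_single, hBd,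
      Finsupp.linearCombination_single]
    simp only [LinearMap.add_apply, LinearMap.comp_apply, LinearMap.sum_apply,
      LinearMap.smul_apply, LinearMap.mulLeft_apply, LinearMap.mulRight_apply, h2, h3,
      neg_one_pow_smul, hBasis_eq, el, MonoidAlgebra.single_mul_single, one_mul, mul_one, one_smul]
    rfl

theorem hτ_word [Fintype G] (z : MonoidAlgebra k G) :
    evalWord k 0 (hτ k G (hWord k 0 [] z)) [] = ∑ g : G, el k g * z * el k g⁻¹ := by
  have h0 := hWord_ofFn_vals k (Fin.elim0 : Fin 0 → NonId G)
  have h1 : ∀ α : HCochain k G 0, evalWord k 0 α [] = α Fin.elim0 := fun α => by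
    have := evalWord_ofFn k α (vals (Fin.elim0 : Fin 0 → NonId G))
    rwa [evalAt_vals] at this
  simp only [List.ofFn_zero] at h0
  rw [h0, h1]
  induction z using MonoidAlgebra.induction_linear with
  | zero => simp
  | add f g hf hg => simp [hf, hg, mul_add, add_mul, Finset.sum_add_distrib]
  | single x c =>
    rw [hPlace_single, hτ, Finsupp.linearCombination_single]
    simp [MonoidAlgebra.single_mul_single, Finset.smul_sum]

theorem hCupPP_word {n m : ℕ} (α : HCochain k G n) (β : HCochain k G m) {u v : List G}
    (hu : u.length = n) (hv : v.length = m) :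
    evalWord k (n + m) (hCupPP k G n m α β) (u ++ v) = evalWord k n α u * evalWord k m β v := by
  by_cases h1 : 1 ∈ u
  · simp [evalWord_of_one_mem k _ h1, evalWord_of_one_mem k _ (List.mem_append_left v h1)]
  by_cases h2 : 1 ∈ v
  · simp [evalWord_of_one_mem k _ h2, evalWord_of_one_mem k _ (List.mem_append_right u h2)]
  obtain ⟨g, rfl⟩ := exists_eq_ofFn_vals hu h1
  obtain ⟨h, rfl⟩ := exists_eq_ofFn_vals hv h2
  rw [ofFn_vals_append, evalWord_ofFn, evalWord_ofFn, evalWord_ofFn]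
  simp [evalAt_vals, hCupPP]

theorem hCupNN_word [Fintype G] {s t : ℕ} {l r : List G} (hl : l.length = s) (hr : r.length = t)
    (z w : MonoidAlgebra k G) :
    hCupNN k G s t (hWord k s l z) (hWord k t r w)
      = ∑ g : G, hWord k (t + (s + 1)) (r ++ g :: l) (z * el k g⁻¹ * w) := by
  by_cases h1 : 1 ∈ l
  · rw [hWord_of_one_mem k h1, Finset.sum_eq_zero]
    · simp
    · intro g _
      rw [hWord_of_one_mem k (by simp [h1])]
      rfl
  by_cases h2 : 1 ∈ r
  · rw [hWord_of_one_mem k h2, Finset.sum_eq_zero]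
    · simp
    · intro g _
      rw [hWord_of_one_mem k (by simp [h2])]
      rfl
  obtain ⟨a, rfl⟩ := exists_eq_ofFn_vals hl h1
  obtain ⟨b, rfl⟩ := exists_eq_ofFn_vals hr h2
  rw [hWord_ofFn_vals, hWord_ofFn_vals]
  induction z using MonoidAlgebra.induction_linear with
  | zero => simp
  | add f g hf hg => simp [hf, hg, add_mul, Finset.sum_add_distrib]
  | single x c =>
  induction w using MonoidAlgebra.induction_linear with
  | zero => simp
  | add f g hf hg => simp [hf, hg, mul_add, Finset.sum_add_distrib]
  | single y d =>
    rw [hPlace_single, hPlace_single, hCupNN, Finsupp.linearCombination_single,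
      LinearMap.smul_apply, Finsupp.linearCombination_single, Finset.smul_sum, Finset.smul_sum]
    refine Fintype.sum_equiv ((Equiv.inv G).trans (Equiv.mulRight x)) _ _ fun g => ?_
    rw [hBasis_eq, ofFn_append_cons, ← map_smul, ← map_smul]
    simp [MonoidAlgebra.single_mul_single]

theorem hCupPN_N_word {n r : ℕ} (α : HCochain k G n) {u v : List G} (hu : u.length = r)
    (hv : v.length = n) (z : MonoidAlgebra k G) :
    hCupPN_N k G n r α (hWord k (r + n) (u ++ v) z) = hWord k r u (evalWord k n α v * z) := by
  by_cases h1 : 1 ∈ u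
  · simp [hWord_of_one_mem k h1, hWord_of_one_mem k (List.mem_append_left v h1)]
  by_cases h2 : 1 ∈ v
  · simp [evalWord_of_one_mem k _ h2, hWord_of_one_mem k (List.mem_append_right u h2)]
  obtain ⟨a, rfl⟩ := exists_eq_ofFn_vals hu h1
  obtain ⟨b, rfl⟩ := exists_eq_ofFn_vals hv h2
  rw [ofFn_vals_append, hWord_ofFn_vals, hWord_ofFn_vals, evalWord_ofFn, evalAt_vals]
  induction z using MonoidAlgebra.induction_linear with
  | zero => simp
  | add f g hf hg => simp [hf, hg, mul_add]
  | single x c =>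
    rw [hPlace_single, hCupPN_N, LinearMap.flip_apply, Finsupp.linearCombination_single]
    have : MonoidAlgebra.single x c = c • el k x := by simp
    rw [this]
    simp [-MonoidAlgebra.smul_single]

theorem hCupPN_P_word [Fintype G] {w t : ℕ} (α : HCochain k G (w + (t + 1))) {u v : List G}
    (hu : u.length = w) (hv : v.length = t) (z : MonoidAlgebra k G) :
    evalWord k w (hCupPN_P k G w t α (hWord k t v z)) u
      = ∑ g : G, evalWord k (w + (t + 1)) α (u ++ g :: v) * z * el k g⁻¹ := by
  by_cases h1 : 1 ∈ u
  · rw [evalWord_of_one_mem k _ h1, Finset.sum_eq_zero]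
    intro g _
    rw [evalWord_of_one_mem k _ (by simp [h1])]
    simp
  by_cases h2 : 1 ∈ v
  · rw [hWord_of_one_mem k h2, Finset.sum_eq_zero]
    · simp
    · intro g _
      rw [evalWord_of_one_mem k _ (by simp [h2])]
      simp
  obtain ⟨a, rfl⟩ := exists_eq_ofFn_vals hu h1
  obtain ⟨b, rfl⟩ := exists_eq_ofFn_vals hv h2
  rw [hWord_ofFn_vals]
  induction z using MonoidAlgebra.induction_linear with
  | zero => simp
  | add f g hf hg => simp [hf, hg, mul_add, add_mul, Finset.sum_add_distrib]
  | single x c =>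
    rw [hPlace_single, hCupPN_P, LinearMap.flip_apply, Finsupp.linearCombination_single,
      evalWord_ofFn, evalAt_vals]
    simp only [LinearMap.smul_apply, Pi.smul_apply, LinearMap.pi_apply, LinearMap.sum_apply,
      LinearMap.comp_apply, LinearMap.mulRight_apply, Finset.smul_sum]
    refine Fintype.sum_equiv (Equiv.inv G) _ _ fun g => ?_
    rw [← evalWord_ofFn, ofFn_append_cons]
    have : MonoidAlgebra.single x c = c • el k x := by simp
    rw [this, mul_assoc, smul_mul_assoc, mul_smul_comm]
    simp [MonoidAlgebra.single_mul_single, -MonoidAlgebra.smul_single]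

theorem hCupNP_N_word {m r : ℕ} (β : HCochain k G m) {u v : List G} (hu : u.length = m)
    (hv : v.length = r) (z : MonoidAlgebra k G) :
    hCupNP_N k G m r (hWord k (m + r) (u ++ v) z) β = hWord k r v (z * evalWord k m β u) := by
  by_cases h1 : 1 ∈ u
  · simp [evalWord_of_one_mem k _ h1, hWord_of_one_mem k (List.mem_append_left v h1)]
  by_cases h2 : 1 ∈ v
  · simp [hWord_of_one_mem k h2, hWord_of_one_mem k (List.mem_append_right u h2)]
  obtain ⟨a, rfl⟩ := exists_eq_ofFn_vals hu h1
  obtain ⟨b, rfl⟩ := exists_eq_ofFn_vals hv h2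
  rw [ofFn_vals_append, hWord_ofFn_vals, hWord_ofFn_vals, evalWord_ofFn, evalAt_vals]
  induction z using MonoidAlgebra.induction_linear with
  | zero => simp
  | add f g hf hg => simp [hf, hg, add_mul]
  | single x c =>
    rw [hPlace_single, hCupNP_N, Finsupp.linearCombination_single]
    have : MonoidAlgebra.single x c = c • el k x := by simp
    rw [this]
    simp [-MonoidAlgebra.smul_single]

theorem hCupNP_P_word [Fintype G] {s w : ℕ} (β : HCochain k G (s + (w + 1))) {u v : List G}
    (hu : u.length = s) (hv : v.length = w) (z : MonoidAlgebra k G) :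
    evalWord k w (hCupNP_P k G s w (hWord k s u z) β) v
      = ∑ g : G, el k g⁻¹ * z * evalWord k (s + (w + 1)) β (u ++ g :: v) := by
  by_cases h1 : 1 ∈ v
  · rw [evalWord_of_one_mem k _ h1, Finset.sum_eq_zero]
    intro g _
    rw [evalWord_of_one_mem k _ (by simp [h1])]
    simp
  by_cases h2 : 1 ∈ u
  · rw [hWord_of_one_mem k h2, Finset.sum_eq_zero]
    · simp
    · intro g _
      rw [evalWord_of_one_mem k _ (by simp [h2])]
      simp
  obtain ⟨a, rfl⟩ := exists_eq_ofFn_vals hv h1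
  obtain ⟨b, rfl⟩ := exists_eq_ofFn_vals hu h2
  rw [hWord_ofFn_vals]
  induction z using MonoidAlgebra.induction_linear with
  | zero => simp
  | add f g hf hg => simp [hf, hg, mul_add, add_mul, Finset.sum_add_distrib]
  | single x c =>
    rw [hPlace_single, hCupNP_P, Finsupp.linearCombination_single,
      evalWord_ofFn, evalAt_vals]
    simp only [LinearMap.smul_apply, Pi.smul_apply, LinearMap.pi_apply, LinearMap.sum_apply,
      LinearMap.comp_apply, LinearMap.mulLeft_apply, Finset.smul_sum]
    refine Fintype.sum_equiv (Equiv.inv G) _ _ fun g => ?_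
    rw [← evalWord_ofFn, ofFn_append_cons]
    have : MonoidAlgebra.single x c = c • el k x := by simp
    rw [this, mul_smul_comm, smul_mul_assoc]
    simp [MonoidAlgebra.single_mul_single, -MonoidAlgebra.smul_single]

end Components

/-! ### The Tate-Hochschild complex as a complex indexed by the integers -/

section Degrees

variable (k : Type u) [Field k] {G : Type v} [Group G]

/-- Value on words of an element of nonnegative degree of the Tate-Hochschild complex. -/
def hEval (n : ℕ) : HTate k G (Int.ofNat n) →ₗ[k] (List G → MonoidAlgebra k G) :=
  (evalWord k n : HCochain k G n →ₗ[k] (List G → MonoidAlgebra k G))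

/-- The chain `(z, l)` as an element of degree `-s-1` of the Tate-Hochschild complex. -/
def hChain (s : ℕ) (l : List G) : MonoidAlgebra k G →ₗ[k] HTate k G (Int.negSucc s) :=
  (hWord k s l : MonoidAlgebra k G →ₗ[k] HChain k G s)

theorem hEval_ext {n : ℕ} {α β : HTate k G (Int.ofNat n)}
    (h : ∀ l : List G, l.length = n → hEval k n α l = hEval k n β l) : α = β :=
  evalWord_ext k (α := (α : HCochain k G n)) (β := (β : HCochain k G n)) h

theorem hTate_induction {s : ℕ} {p : HTate k G (Int.negSucc s) → Prop}
    (hadd : ∀ x y, p x → p y → p (x + y))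
    (hword : ∀ l z, l.length = s → p (hChain k s l z)) (x : HTate k G (Int.negSucc s)) : p x :=
  hChain_induction k (p := p) hadd hword x

variable (G) [Fintype G]

/-- The differential of the Tate-Hochschild complex.  The last four patterns cannot satisfy
`p + 1 = q`. -/
def hd : ∀ p q : ℤ, p + 1 = q → HTate k G p →ₗ[k] HTate k G q
  | .ofNat n, .ofNat m, e =>
      have h : m = n + 1 := by simp only [Int.ofNat_eq_natCast] at e; omega
      h ▸ hδ k G n
  | .negSucc (s + 1), .negSucc t, e =>
      have h : t = s := by omega
      h ▸ hBd k G s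
  | .negSucc 0, .ofNat 0, _ => hτ k G
  | .negSucc (_ + 1), .ofNat _, _ => 0
  | .negSucc 0, .ofNat (_ + 1), _ => 0
  | .ofNat _, .negSucc _, _ => 0
  | .negSucc 0, .negSucc _, _ => 0

variable {G}

theorem hd_cochain {n m : ℕ} (e : Int.ofNat n + 1 = Int.ofNat m) (α : HTate k G (Int.ofNat n))
    {l : List G} (hl : l.length = m) :
    hEval k m (hd k G _ _ e α) l
      = faces 1 l 1 fun x l' y => el k x * hEval k n α l' * el k y := by
  obtain rfl : m = n + 1 := by simp only [Int.ofNat_eq_natCast] at e; omega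
  exact hδ_word k α hl

theorem hd_chain {s t : ℕ} (e : Int.negSucc s + 1 = Int.negSucc t) {l : List G}
    (hl : l.length = s) (z : MonoidAlgebra k G) :
    hd k G _ _ e (hChain k s l z)
      = faces 1 l 1 fun x l' y => hChain k t l' (el k y * z * el k x) := by
  obtain rfl : s = t + 1 := by omega
  exact hBd_word k hl z

theorem hd_trace {s m : ℕ} (e : Int.negSucc s + 1 = Int.ofNat m) {l u : List G}
    (hl : l.length = s) (hu : u.length = m) (z : MonoidAlgebra k G) :
    hEval k m (hd k G _ _ e (hChain k s l z)) u = ∑ g : G, el k g * z * el k g⁻¹ := by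
  simp only [Int.ofNat_eq_natCast] at e
  obtain rfl : s = 0 := by omega
  obtain rfl : m = 0 := by omega
  obtain rfl := List.length_eq_zero_iff.1 hl
  obtain rfl := List.length_eq_zero_iff.1 hu
  exact hτ_word k z

/-- Products on words.  The letters `P` and `N` stand for degrees `≥ 0` and `< 0` of the two factors;
a last letter `P` or `N` gives the sign of the degree of the product. -/
theorem hCup_PP {n m r : ℕ} (e : Int.ofNat n + Int.ofNat m = Int.ofNat r)
    (α : HTate k G (Int.ofNat n)) (β : HTate k G (Int.ofNat m)) {u v : List G}
    (hu : u.length = n) (hv : v.length = m) :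
    hEval k r (hCup k G _ _ _ e α β) (u ++ v) = hEval k n α u * hEval k m β v := by
  obtain rfl : r = n + m := by simp only [Int.ofNat_eq_natCast] at e; omega
  exact hCupPP_word k α β hu hv

theorem hCup_NN {s t r : ℕ} (e : Int.negSucc s + Int.negSucc t = Int.negSucc r) {u v : List G}
    (hu : u.length = s) (hv : v.length = t) (z w : MonoidAlgebra k G) :
    hCup k G _ _ _ e (hChain k s u z) (hChain k t v w)
      = ∑ g : G, hChain k r (v ++ g :: u) (z * el k g⁻¹ * w) := by
  obtain rfl : r = t + (s + 1) := by omega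
  exact hCupNN_word k hu hv z w

theorem hCup_PN_N {n t r : ℕ} (e : Int.ofNat n + Int.negSucc t = Int.negSucc r)
    (α : HTate k G (Int.ofNat n)) {u v : List G} (hu : u.length = r) (hv : v.length = n)
    (z : MonoidAlgebra k G) :
    hCup k G _ _ _ e α (hChain k t (u ++ v) z) = hChain k r u (hEval k n α v * z) := by
  obtain rfl : t = r + n := by simp only [Int.ofNat_eq_natCast] at e; omega
  exact hCupPN_N_word k α hu hv z

theorem hCup_PN_P {n t w : ℕ} (e : Int.ofNat n + Int.negSucc t = Int.ofNat w)
    (α : HTate k G (Int.ofNat n)) {u v : List G} (hu : u.length = w) (hv : v.length = t)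
    (z : MonoidAlgebra k G) :
    hEval k w (hCup k G _ _ _ e α (hChain k t v z)) u
      = ∑ g : G, hEval k n α (u ++ g :: v) * z * el k g⁻¹ := by
  obtain rfl : n = w + (t + 1) := by simp only [Int.ofNat_eq_natCast] at e; omega
  exact hCupPN_P_word k α hu hv z

theorem hCup_NP_N {s m r : ℕ} (e : Int.negSucc s + Int.ofNat m = Int.negSucc r)
    (β : HTate k G (Int.ofNat m)) {u v : List G} (hu : u.length = m) (hv : v.length = r)
    (z : MonoidAlgebra k G) :
    hCup k G _ _ _ e (hChain k s (u ++ v) z) β = hChain k r v (z * hEval k m β u) := by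
  obtain rfl : s = m + r := by simp only [Int.ofNat_eq_natCast] at e; omega
  exact hCupNP_N_word k β hu hv z

theorem hCup_NP_P {s m w : ℕ} (e : Int.negSucc s + Int.ofNat m = Int.ofNat w)
    (β : HTate k G (Int.ofNat m)) {u v : List G} (hu : u.length = s) (hv : v.length = w)
    (z : MonoidAlgebra k G) :
    hEval k w (hCup k G _ _ _ e (hChain k s u z) β) v
      = ∑ g : G, el k g⁻¹ * z * hEval k m β (u ++ g :: v) := by
  obtain rfl : m = s + (w + 1) := by simp only [Int.ofNat_eq_natCast] at e; omega
  exact hCupNP_P_word k β hu hv z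

theorem hCocycles_eq (p q : ℤ) (e : p + 1 = q) : hCocycles k G p = LinearMap.ker (hd k G p q e) := by
  subst e
  rcases p with n | _ | s <;> rfl

theorem hCoboundaries_eq (p q : ℤ) (e : p + 1 = q) :
    hCoboundaries k G q = LinearMap.range (hd k G p q e) := by
  subst e
  rcases p with n | _ | s <;> rfl

end Degrees

/-! ### The Leibniz rule -/

section Leibniz

variable (k : Type u) [Field k] {G : Type v} [Group G]

theorem el_mul (x y : G) : el k (x * y) = el k x * el k y := by
  simp [el, MonoidAlgebra.single_mul_single]

theorem el_inv_mul (x : G) : el k x⁻¹ * el k x = 1 := by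
  rw [← el_mul, inv_mul_cancel]
  rfl

theorem el_one : el k (1 : G) = 1 := rfl

theorem mul_faces_mul (A B : MonoidAlgebra k G) (x : G) (l : List G) (y : G)
    (Φ : G → List G → G → MonoidAlgebra k G) :
    A * faces x l y Φ * B = faces x l y fun x' l' y' => A * Φ x' l' y' * B :=
  faces_map ((AddMonoidHom.mulRight B).comp (AddMonoidHom.mulLeft A)) x l y Φ

theorem mul_leftFaces_mul (A B : MonoidAlgebra k G) (x : G) (l : List G)
    (Φ : G → List G → MonoidAlgebra k G) :
    A * leftFaces x l Φ * B = leftFaces x l fun x' l' => A * Φ x' l' * B :=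
  leftFaces_map ((AddMonoidHom.mulRight B).comp (AddMonoidHom.mulLeft A)) x l Φ

theorem mul_rightFaces_mul (A B : MonoidAlgebra k G) (l : List G) (y : G)
    (Φ : List G → G → MonoidAlgebra k G) :
    A * rightFaces l y Φ * B = rightFaces l y fun l' y' => A * Φ l' y' * B :=
  rightFaces_map ((AddMonoidHom.mulRight B).comp (AddMonoidHom.mulLeft A)) l y Φ

variable [Fintype G]

/-- The product of a cochain and the boundary of a chain, in degrees `≥ 0`.  The sum over the
letter `g` covers also a chain of degree `-1`, whose boundary is a trace. -/
theorem hCup_hd_chain_of_cochain {n t w : ℕ} {q' : ℤ} (e₁ : Int.negSucc t + 1 = q')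
    (e₂ : Int.ofNat n + q' = Int.ofNat w) (α : HTate k G (Int.ofNat n)) {u v : List G}
    (hu : u.length = w) (hv : v.length = t) (z : MonoidAlgebra k G) :
    hEval k w (hCup k G _ _ _ e₂ α (hd k G _ _ e₁ (hChain k t v z))) u
      = ∑ g : G, rightFaces (g :: v) 1
          fun m y => hEval k n α (u ++ m) * (el k y * z) * el k g⁻¹ := by
  rcases q' with m | t'
  · have h0 := e₁
    simp only [Int.ofNat_eq_natCast] at h0
    obtain rfl : t = 0 := by omega
    obtain rfl : m = 0 := by omega
    obtain rfl : n = w := by simpa using e₂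
    obtain rfl := List.length_eq_zero_iff.1 hv
    have h := hCup_PP k e₂ α (hd k G _ _ e₁ (hChain k 0 [] z)) hu (v := []) rfl
    rw [List.append_nil, hd_trace k e₁ List.length_nil List.length_nil] at h
    rw [h, Finset.mul_sum]
    simp [rightFaces, mul_assoc]
  · rw [hd_chain k e₁ hv, sum_rightFaces_cons _ (by rintro rfl; simp at hv; omega)]
    refine (faces_map (((LinearMap.proj u) ∘ₗ hEval k w ∘ₗ
      hCup k G _ _ _ e₂ α).toAddMonoidHom) _ _ _ _).trans ?_
    refine faces_congr_length fun x l y hl => ?_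
    refine (hCup_PN_P k e₂ α hu (by omega) _).trans ?_
    simp [-MonoidAlgebra.single_mul_single, el_mul, mul_assoc]

/-- The product of the boundary of a chain and a cochain, in degrees `≥ 0`; the chain may have degree
`-1`. -/
theorem hCup_hd_cochain_of_chain {s m w : ℕ} {p' : ℤ} (e₁ : Int.negSucc s + 1 = p')
    (e₂ : p' + Int.ofNat m = Int.ofNat w) (β : HTate k G (Int.ofNat m)) {u v : List G}
    (hu : u.length = s) (hv : v.length = w) (z : MonoidAlgebra k G) :
    hEval k w (hCup k G _ _ _ e₂ (hd k G _ _ e₁ (hChain k s u z)) β) v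
      = ∑ g : G, leftFaces 1 (u ++ [g])
          fun x m' => el k g⁻¹ * (z * el k x) * hEval k m β (m' ++ v) := by
  rcases p' with n | s'
  · have h0 := e₁
    simp only [Int.ofNat_eq_natCast] at h0
    obtain rfl : s = 0 := by omega
    obtain rfl : n = 0 := by omega
    obtain rfl : m = w := by simpa using e₂
    obtain rfl := List.length_eq_zero_iff.1 hu
    have h := hCup_PP k e₂ (hd k G _ _ e₁ (hChain k 0 [] z)) β (u := []) rfl hv
    rw [List.nil_append, hd_trace k e₁ List.length_nil List.length_nil] at h
    rw [h, Finset.sum_mul]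
    refine Fintype.sum_equiv (Equiv.inv G) _ _ fun g => ?_
    simp [leftFaces, mul_assoc]
  · rw [hd_chain k e₁ hu, sum_leftFaces_concat _ (by rintro rfl; simp at hu; omega)]
    refine (faces_map (((LinearMap.proj v) ∘ₗ hEval k w ∘ₗ
      (hCup k G _ _ _ e₂).flip β).toAddMonoidHom) _ _ _ _).trans ?_
    refine faces_congr_length fun x l y hl => ?_
    refine (hCup_NP_P k e₂ β (by omega) hv _).trans ?_
    simp [-MonoidAlgebra.single_mul_single, el_mul, mul_assoc]

/-- The product of a chain and the boundary of a chain, which may be a trace. -/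
theorem hCup_chain_hd_chain {s t r : ℕ} {q' : ℤ} (e₁ : Int.negSucc t + 1 = q')
    (e₂ : Int.negSucc s + q' = Int.negSucc r) {u v : List G}
    (hu : u.length = s) (hv : v.length = t) (z w : MonoidAlgebra k G) :
    hCup k G _ _ _ e₂ (hChain k s u z) (hd k G _ _ e₁ (hChain k t v w))
      = ∑ g : G, leftFaces 1 (v ++ [g])
          fun x m => hChain k r (m ++ u) (z * el k g⁻¹ * w * el k x) := by
  rcases q' with m | t'
  · have h0 := e₁
    simp only [Int.ofNat_eq_natCast] at h0
    obtain rfl : t = 0 := by omega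
    obtain rfl : m = 0 := by omega
    obtain rfl : s = r := by simpa using e₂
    obtain rfl := List.length_eq_zero_iff.1 hv
    have h := hCup_NP_N k e₂ (hd k G _ _ e₁ (hChain k 0 [] w)) (u := []) rfl hu z
    rw [List.nil_append, hd_trace k e₁ List.length_nil List.length_nil] at h
    rw [h, Finset.mul_sum, map_sum]
    refine Fintype.sum_equiv (Equiv.inv G) _ _ fun g => ?_
    simp [leftFaces, mul_assoc]
  · rw [hd_chain k e₁ hv, sum_leftFaces_concat _ (by rintro rfl; simp at hv; omega)]
    refine (faces_map (hCup k G _ _ _ e₂ (hChain k s u z)).toAddMonoidHom _ _ _ _).trans ?_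
    refine faces_congr_length fun x l y hl => ?_
    refine (hCup_NN k e₂ hu (by omega) _ _).trans ?_
    simp [-MonoidAlgebra.single_mul_single, el_mul, mul_assoc]

/-- The product of the boundary of a chain, which may be a trace, and a chain. -/
theorem hCup_hd_chain_chain {s t r : ℕ} {p' : ℤ} (e₁ : Int.negSucc s + 1 = p')
    (e₂ : p' + Int.negSucc t = Int.negSucc r) {u v : List G}
    (hu : u.length = s) (hv : v.length = t) (z w : MonoidAlgebra k G) :
    hCup k G _ _ _ e₂ (hd k G _ _ e₁ (hChain k s u z)) (hChain k t v w)
      = ∑ g : G, rightFaces (g :: u) 1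
          fun m y => hChain k r (v ++ m) (el k y * (z * el k g⁻¹ * w)) := by
  rcases p' with m | s'
  · have h0 := e₁
    simp only [Int.ofNat_eq_natCast] at h0
    obtain rfl : s = 0 := by omega
    obtain rfl : m = 0 := by omega
    obtain rfl : t = r := by simpa using e₂
    obtain rfl := List.length_eq_zero_iff.1 hu
    have h := hCup_PN_N k e₂ (hd k G _ _ e₁ (hChain k 0 [] z)) hv (v := []) rfl w
    rw [List.append_nil, hd_trace k e₁ List.length_nil List.length_nil] at h
    rw [h, Finset.sum_mul, map_sum]
    simp [rightFaces, mul_assoc]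
  · rw [hd_chain k e₁ hu, sum_rightFaces_cons _ (by rintro rfl; simp at hu; omega)]
    refine (faces_map ((hCup k G _ _ _ e₂).flip (hChain k t v w)).toAddMonoidHom
      _ _ _ _).trans ?_
    refine faces_congr_length fun x l y hl => ?_
    refine (hCup_NN k e₂ (by omega) hv _ _).trans ?_
    simp [-MonoidAlgebra.single_mul_single, el_mul, mul_assoc]

/-- The Leibniz rule for two chains: the faces of `(v, g, u)` split at the letter `g`. -/
theorem hd_hCup_NN {s t r r' : ℕ} {p' q' : ℤ}
    (hr : Int.negSucc s + Int.negSucc t = Int.negSucc r) (hp : Int.negSucc s + 1 = p')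
    (hq : Int.negSucc t + 1 = q') (hr' : Int.negSucc r + 1 = Int.negSucc r')
    (h₁ : p' + Int.negSucc t = Int.negSucc r') (h₂ : Int.negSucc s + q' = Int.negSucc r')
    (x : HTate k G (Int.negSucc s)) (y : HTate k G (Int.negSucc t)) :
    hd k G _ _ hr' (hCup k G _ _ _ hr x y)
      = (-1 : ℤ) ^ (t + 1) • hCup k G _ _ _ h₁ (hd k G _ _ hp x) y
        + (-1 : ℤ) ^ 0 • hCup k G _ _ _ h₂ x (hd k G _ _ hq y) := by
  induction x using hTate_induction with
  | hadd x x' hx hx' => simp only [map_add, LinearMap.add_apply, hx, hx', smul_add]; abel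
  | hword l z hl =>
  induction y using hTate_induction with
  | hadd y y' hy hy' => simp only [map_add, hy, hy', smul_add]; abel
  | hword v w hv =>
    rw [hCup_NN k hr hl hv, hCup_chain_hd_chain k hq h₂ hl hv, hCup_hd_chain_chain k hp h₁ hl hv,
      map_sum, Finset.smul_sum, pow_zero, one_smul, ← Finset.sum_add_distrib]
    refine Finset.sum_congr rfl fun g _ => ?_
    rw [hd_chain k hr' (by simp; omega), faces_append, hv, add_comm]
    simp [el_one, mul_assoc]

/-- The Leibniz rule for two cochains: the word splits at the letter `a` following the letters of `α`,
and the two terms in which `a` acts between the values of `α` and `β` cancel. -/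
theorem hd_hCup_PP {n m r n' m' r' : ℕ} (hr : Int.ofNat n + Int.ofNat m = Int.ofNat r)
    (hp : Int.ofNat n + 1 = Int.ofNat n') (hq : Int.ofNat m + 1 = Int.ofNat m')
    (hr' : Int.ofNat r + 1 = Int.ofNat r') (h₁ : Int.ofNat n' + Int.ofNat m = Int.ofNat r')
    (h₂ : Int.ofNat n + Int.ofNat m' = Int.ofNat r')
    (α : HTate k G (Int.ofNat n)) (β : HTate k G (Int.ofNat m)) :
    hd k G _ _ hr' (hCup k G _ _ _ hr α β)
      = (-1 : ℤ) ^ 0 • hCup k G _ _ _ h₁ (hd k G _ _ hp α) β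
        + (-1 : ℤ) ^ n • hCup k G _ _ _ h₂ α (hd k G _ _ hq β) := by
  refine hEval_ext k fun l hl => ?_
  have hr0 := hr
  have hp0 := hp
  have hq0 := hq
  have hr0' := hr'
  simp only [Int.ofNat_eq_natCast] at hr0 hp0 hq0 hr0'
  obtain ⟨u, w, rfl, hu⟩ := exists_append_of_le_length (l := l) (j := n) (by omega)
  obtain ⟨a, v, rfl⟩ : ∃ a v, w = a :: v := by
    cases w with
    | nil => simp at hl; omega
    | cons a v => exact ⟨a, v, rfl⟩
  have hv : v.length = m := by simp at hl; omega
  have e1 := hCup_PP k h₁ (hd k G _ _ hp α) β (u := u ++ [a]) (v := v) (by simp; omega) hv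
  have e2 := hCup_PP k h₂ α (hd k G _ _ hq β) (u := u) (v := a :: v) hu (by simp; omega)
  rw [List.append_assoc, List.singleton_append] at e1
  simp only [map_add, map_zsmul, Pi.add_apply, Pi.smul_apply]
  rw [e1, e2, hd_cochain k hr' _ hl, hd_cochain k hp _ (by simp; omega),
    hd_cochain k hq _ (by simp; omega), faces_append, faces_concat, faces_cons]
  have h3 : leftFaces 1 (u ++ [a]) (fun x' l' =>
      el k x' * hEval k r (hCup k G _ _ _ hr α β) (l' ++ v) * el k 1)
      = leftFaces 1 (u ++ [a]) (fun x' l' => el k x' * hEval k n α l' * el k 1)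
        * hEval k m β v := by
    have := mul_leftFaces_mul k 1 (hEval k m β v) 1 (u ++ [a])
      fun x' l' => el k x' * hEval k n α l' * el k 1
    rw [one_mul] at this
    rw [this]
    refine leftFaces_congr fun x' l' hl' => ?_
    rw [hCup_PP k hr α β (by simp at hl'; omega) hv]
    simp [el_one, mul_assoc]
  have h4 : rightFaces (a :: v) 1 (fun m' y => el k 1 *
      hEval k r (hCup k G _ _ _ hr α β) (u ++ m') * el k y)
      = hEval k n α u * rightFaces (a :: v) 1 fun m' y => el k 1 * hEval k m β m' * el k y := by
    have := mul_rightFaces_mul k (hEval k n α u) 1 (a :: v) 1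
      fun m' y => el k 1 * hEval k m β m' * el k y
    rw [mul_one] at this
    rw [this]
    refine rightFaces_congr fun m' y hl' => ?_
    rw [hCup_PP k hr α β hu (by simp at hl'; omega)]
    simp [el_one, mul_assoc]
  rw [h3, h4, hu]
  simp only [el_one, one_mul, mul_one, pow_succ, pow_zero, one_smul, add_mul, mul_sub, smul_sub,
    mul_neg, neg_smul, neg_mul, smul_mul_assoc, mul_assoc]
  abel

/-- The Leibniz rule for a cochain and a chain whose product has degree at most `-2`. -/
theorem hd_hCup_PN_N {n t c n' t' c' : ℕ} (hr : Int.ofNat n + Int.negSucc t = Int.negSucc c)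
    (hp : Int.ofNat n + 1 = Int.ofNat n') (hq : Int.negSucc t + 1 = Int.negSucc t')
    (hr' : Int.negSucc c + 1 = Int.negSucc c')
    (h₁ : Int.ofNat n' + Int.negSucc t = Int.negSucc c')
    (h₂ : Int.ofNat n + Int.negSucc t' = Int.negSucc c')
    (α : HTate k G (Int.ofNat n)) (y : HTate k G (Int.negSucc t)) :
    hd k G _ _ hr' (hCup k G _ _ _ hr α y)
      = (-1 : ℤ) ^ (c' + 1) • hCup k G _ _ _ h₁ (hd k G _ _ hp α) y
        + (-1 : ℤ) ^ 0 • hCup k G _ _ _ h₂ α (hd k G _ _ hq y) := by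
  induction y using hTate_induction with
  | hadd y y' hy hy' => simp only [map_add, hy, hy', smul_add]; abel
  | hword l z hl =>
  have hr0 := hr
  have hp0 := hp
  have hr0' := hr'
  simp only [Int.ofNat_eq_natCast] at hr0 hp0 hr0'
  obtain ⟨u, w, rfl, hu⟩ := exists_append_of_le_length (l := l) (j := c') (by omega)
  obtain ⟨a, v, rfl⟩ : ∃ a v, w = a :: v := by
    cases w with
    | nil => simp at hl; omega
    | cons a v => exact ⟨a, v, rfl⟩
  have hv : v.length = n := by simp at hl; omega
  have e1 := hCup_PN_N k hr α (u := u ++ [a]) (v := v) (by simp; omega) hv z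
  have e2 := hCup_PN_N k h₁ (hd k G _ _ hp α) (u := u) (v := a :: v) hu (by simp; omega) z
  rw [List.append_assoc, List.singleton_append] at e1
  have e3 : hCup k G _ _ _ h₂ α (hd k G _ _ hq (hChain k t (u ++ a :: v) z))
      = faces 1 (u ++ a :: v) 1 fun x l' y =>
        hCup k G _ _ _ h₂ α (hChain k t' l' (el k y * z * el k x)) := by
    rw [hd_chain k hq hl]
    exact faces_map (hCup k G _ _ _ h₂ α).toAddMonoidHom _ _ _ _
  have e4 : hChain k c' u (rightFaces (a :: v) 1 (fun m y => el k 1 * hEval k n α m * el k y) * z)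
      = rightFaces (a :: v) 1 fun m y =>
        hCup k G _ _ _ h₂ α (hChain k t' (u ++ m) (el k y * z * el k 1)) := by
    refine (rightFaces_map ((hChain k c' u).toAddMonoidHom.comp (AddMonoidHom.mulRight z))
      _ _ _).trans (rightFaces_congr fun m y hm => ?_)
    rw [hCup_PN_N k h₂ α hu (by simp at hm; omega)]
    simp [el_one, mul_assoc]
  have e5 : leftFaces 1 (u ++ [a]) (fun x m => hChain k c' m (el k 1 * (hEval k n α v * z) * el k x))
      = leftFaces 1 (u ++ [a]) fun x m =>
        hCup k G _ _ _ h₂ α (hChain k t' (m ++ v) (el k 1 * z * el k x)) := by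
    refine leftFaces_congr fun x m hm => ?_
    rw [hCup_PN_N k h₂ α (by simp at hm; omega) hv]
    simp [el_one, mul_assoc]
  rw [e1, e2, e3, hd_chain k hr' (by simp; omega), hd_cochain k hp _ (by simp; omega), faces_concat,
    faces_append, faces_cons, sub_mul, map_sub, e4, e5, hu]
  simp only [el_one, one_mul, mul_one, pow_succ, pow_zero, one_smul, smul_sub, mul_neg, neg_smul,
    mul_assoc]
  abel

/-- The Leibniz rule for a cochain and a chain whose product has degree `-1`, so that its boundary is
a trace. -/
theorem hd_hCup_PN_trace {n t c n' w' : ℕ} {q' : ℤ}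
    (hr : Int.ofNat n + Int.negSucc t = Int.negSucc c)
    (hp : Int.ofNat n + 1 = Int.ofNat n') (hq : Int.negSucc t + 1 = q')
    (hr' : Int.negSucc c + 1 = Int.ofNat w')
    (h₁ : Int.ofNat n' + Int.negSucc t = Int.ofNat w') (h₂ : Int.ofNat n + q' = Int.ofNat w')
    (α : HTate k G (Int.ofNat n)) (y : HTate k G (Int.negSucc t)) :
    hd k G _ _ hr' (hCup k G _ _ _ hr α y)
      = (-1 : ℤ) ^ 0 • hCup k G _ _ _ h₁ (hd k G _ _ hp α) y
        + (-1 : ℤ) ^ 0 • hCup k G _ _ _ h₂ α (hd k G _ _ hq y) := by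
  induction y using hTate_induction with
  | hadd y y' hy hy' => simp only [map_add, hy, hy', smul_add]; abel
  | hword v z hv =>
  have hr0 := hr
  have hp0 := hp
  have hr0' := hr'
  simp only [Int.ofNat_eq_natCast] at hr0 hp0 hr0'
  refine hEval_ext k fun l hl => ?_
  obtain rfl : l = [] := List.length_eq_zero_iff.1 (by omega)
  have e1 := hCup_PN_N k hr α (u := []) (v := v) (by simp; omega) (by omega) z
  rw [List.nil_append] at e1
  simp only [map_add, Pi.add_apply, pow_zero, one_smul]
  rw [e1, hd_trace k hr' (by simp; omega) hl, hCup_PN_P k h₁ _ hl hv,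
    hCup_hd_chain_of_cochain k hq h₂ α hl hv, ← Finset.sum_add_distrib]
  refine Finset.sum_congr rfl fun g _ => ?_
  simp only [List.nil_append]
  have h := mul_rightFaces_mul k 1 (z * el k g⁻¹) (g :: v) 1
    fun m y => el k 1 * hEval k n α m * el k y
  simp only [one_mul, el_one, mul_assoc] at h
  rw [hd_cochain k hp _ (by simp; omega), faces_cons]
  simp only [one_mul, mul_one, el_one, mul_assoc, sub_mul, h]
  abel

/-- The Leibniz rule for a cochain and a chain whose product has degree at least `0`. -/
theorem hd_hCup_PN_P {n t w n' w' : ℕ} {q' : ℤ}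
    (hr : Int.ofNat n + Int.negSucc t = Int.ofNat w)
    (hp : Int.ofNat n + 1 = Int.ofNat n') (hq : Int.negSucc t + 1 = q')
    (hr' : Int.ofNat w + 1 = Int.ofNat w')
    (h₁ : Int.ofNat n' + Int.negSucc t = Int.ofNat w') (h₂ : Int.ofNat n + q' = Int.ofNat w')
    (α : HTate k G (Int.ofNat n)) (y : HTate k G (Int.negSucc t)) :
    hd k G _ _ hr' (hCup k G _ _ _ hr α y)
      = (-1 : ℤ) ^ 0 • hCup k G _ _ _ h₁ (hd k G _ _ hp α) y
        + (-1 : ℤ) ^ w' • hCup k G _ _ _ h₂ α (hd k G _ _ hq y) := by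
  induction y using hTate_induction with
  | hadd y y' hy hy' => simp only [map_add, hy, hy', smul_add]; abel
  | hword v z hv =>
  have hr0 := hr
  have hp0 := hp
  have hr0' := hr'
  simp only [Int.ofNat_eq_natCast] at hr0 hp0 hr0'
  refine hEval_ext k fun u hu => ?_
  simp only [map_add, map_zsmul, Pi.add_apply, Pi.smul_apply, pow_zero, one_smul]
  have e1 : hEval k w' (hd k G _ _ hr' (hCup k G _ _ _ hr α (hChain k t v z))) u
      = ∑ g : G, leftFaces 1 (u ++ [g])
        fun x m => el k x * hEval k n α (m ++ v) * z * el k g⁻¹ := by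
    rw [hd_cochain k hr' _ hu, sum_leftFaces_concat _ (by rintro rfl; simp at hu; omega)]
    refine faces_congr_length fun x l y hl => ?_
    rw [hCup_PN_P k hr α (by omega) hv, Finset.mul_sum, Finset.sum_mul]
    simp [-MonoidAlgebra.single_mul_single, el_mul, mul_assoc]
  rw [e1, hCup_PN_P k h₁ _ hu hv, hCup_hd_chain_of_cochain k hq h₂ α hu hv, Finset.smul_sum,
    ← Finset.sum_add_distrib]
  refine Finset.sum_congr rfl fun g _ => ?_
  have h := mul_rightFaces_mul k 1 (z * el k g⁻¹) (g :: v) 1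
    fun m y => el k 1 * hEval k n α (u ++ m) * el k y
  have h' := mul_leftFaces_mul k 1 (z * el k g⁻¹) 1 (u ++ [g])
    fun x m => el k x * hEval k n α (m ++ v) * el k 1
  simp only [one_mul, mul_one, el_one, mul_assoc] at h h'
  rw [hd_cochain k hp _ (by simp; omega), faces_append, hu]
  simp only [one_mul, mul_one, el_one, mul_assoc, add_mul, smul_mul_assoc, h, h', pow_succ,
    mul_neg, neg_smul, neg_mul]
  abel

/-- The Leibniz rule for a chain and a cochain whose product has degree at most `-2`. -/
theorem hd_hCup_NP_N {s m c s' m' c' : ℕ} (hr : Int.negSucc s + Int.ofNat m = Int.negSucc c)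
    (hp : Int.negSucc s + 1 = Int.negSucc s') (hq : Int.ofNat m + 1 = Int.ofNat m')
    (hr' : Int.negSucc c + 1 = Int.negSucc c')
    (h₁ : Int.negSucc s' + Int.ofNat m = Int.negSucc c')
    (h₂ : Int.negSucc s + Int.ofNat m' = Int.negSucc c')
    (x : HTate k G (Int.negSucc s)) (β : HTate k G (Int.ofNat m)) :
    hd k G _ _ hr' (hCup k G _ _ _ hr x β)
      = (-1 : ℤ) ^ m • hCup k G _ _ _ h₁ (hd k G _ _ hp x) β
        + (-1 : ℤ) ^ (m + 1) • hCup k G _ _ _ h₂ x (hd k G _ _ hq β) := by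
  induction x using hTate_induction with
  | hadd x x' hx hx' => simp only [map_add, LinearMap.add_apply, hx, hx', smul_add]; abel
  | hword l z hl =>
  have hr0 := hr
  have hq0 := hq
  have hr0' := hr'
  simp only [Int.ofNat_eq_natCast] at hr0 hq0 hr0'
  obtain ⟨u, w, rfl, hu⟩ := exists_append_of_le_length (l := l) (j := m) (by omega)
  obtain ⟨a, v, rfl⟩ : ∃ a v, w = a :: v := by
    cases w with
    | nil => simp at hl; omega
    | cons a v => exact ⟨a, v, rfl⟩
  have hv : v.length = c' := by simp at hl; omega
  have e1 := hCup_NP_N k hr β (u := u) (v := a :: v) hu (by simp; omega) z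
  have e2 := hCup_NP_N k h₂ (hd k G _ _ hq β) (u := u ++ [a]) (v := v) (by simp; omega) hv z
  rw [List.append_assoc, List.singleton_append] at e2
  have e3 : hCup k G _ _ _ h₁ (hd k G _ _ hp (hChain k s (u ++ a :: v) z)) β
      = faces 1 (u ++ a :: v) 1 fun x l' y =>
        hCup k G _ _ _ h₁ (hChain k s' l' (el k y * z * el k x)) β := by
    rw [hd_chain k hp hl]
    exact faces_map ((hCup k G _ _ _ h₁).flip β).toAddMonoidHom _ _ _ _
  have e4 : hChain k c' v (z * leftFaces 1 (u ++ [a])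
        (fun x m' => el k x * hEval k m β m' * el k 1))
      = leftFaces 1 (u ++ [a]) fun x m' =>
        hCup k G _ _ _ h₁ (hChain k s' (m' ++ v) (el k 1 * z * el k x)) β := by
    refine (leftFaces_map ((hChain k c' v).toAddMonoidHom.comp (AddMonoidHom.mulLeft z))
      _ _ _).trans (leftFaces_congr fun x m' hm => ?_)
    rw [hCup_NP_N k h₁ β (by simp at hm; omega) hv]
    simp [el_one, mul_assoc]
  have e5 : rightFaces (a :: v) 1 (fun m' y =>
        hChain k c' m' (el k y * (z * hEval k m β u) * el k 1))
      = rightFaces (a :: v) 1 fun m' y =>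
        hCup k G _ _ _ h₁ (hChain k s' (u ++ m') (el k y * z * el k 1)) β := by
    refine rightFaces_congr fun m' y hm => ?_
    rw [hCup_NP_N k h₁ β hu (by simp at hm; omega)]
    simp [el_one, mul_assoc]
  rw [e1, e2, e3, hd_chain k hr' (by simp; omega), hd_cochain k hq _ (by simp; omega), faces_append,
    faces_concat, faces_cons, mul_add, map_add, e4, e5, hu, mul_smul_comm, map_zsmul]
  have hsq : (-1 : ℤ) ^ m * (-1) ^ m = 1 := by rw [← mul_pow]; simp
  simp only [el_one, one_mul, mul_one, pow_succ, smul_add, mul_neg, neg_smul, smul_neg,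
    mul_assoc, smul_smul, neg_mul, neg_neg, hsq, one_smul]
  abel

/-- The Leibniz rule for a chain and a cochain whose product has degree `-1`, so that its boundary is
a trace. -/
theorem hd_hCup_NP_trace {s m c m' w' : ℕ} {p' : ℤ}
    (hr : Int.negSucc s + Int.ofNat m = Int.negSucc c)
    (hp : Int.negSucc s + 1 = p') (hq : Int.ofNat m + 1 = Int.ofNat m')
    (hr' : Int.negSucc c + 1 = Int.ofNat w')
    (h₁ : p' + Int.ofNat m = Int.ofNat w') (h₂ : Int.negSucc s + Int.ofNat m' = Int.ofNat w')
    (x : HTate k G (Int.negSucc s)) (β : HTate k G (Int.ofNat m)) :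
    hd k G _ _ hr' (hCup k G _ _ _ hr x β)
      = (-1 : ℤ) ^ m • hCup k G _ _ _ h₁ (hd k G _ _ hp x) β
        + (-1 : ℤ) ^ (m + 1) • hCup k G _ _ _ h₂ x (hd k G _ _ hq β) := by
  induction x using hTate_induction with
  | hadd x x' hx hx' => simp only [map_add, LinearMap.add_apply, hx, hx', smul_add]; abel
  | hword u z hu =>
  have hr0 := hr
  have hq0 := hq
  have hr0' := hr'
  simp only [Int.ofNat_eq_natCast] at hr0 hq0 hr0'
  refine hEval_ext k fun l hl => ?_
  obtain rfl : l = [] := List.length_eq_zero_iff.1 (by omega)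
  have e1 := hCup_NP_N k hr β (u := u) (v := []) (by omega) (by simp; omega) z
  rw [List.append_nil] at e1
  have e2 : ∑ g : G, el k g * (z * hEval k m β u) * el k g⁻¹
      = ∑ g : G, el k g⁻¹ * (z * hEval k m β u) * el k g :=
    Fintype.sum_equiv (Equiv.inv G) _ _ fun g => by simp
  simp only [map_add, map_zsmul, Pi.add_apply, Pi.smul_apply]
  rw [e1, hd_trace k hr' (by simp; omega) hl, e2, hCup_NP_P k h₂ _ hu hl,
    hCup_hd_cochain_of_chain k hp h₁ β hu hl, Finset.smul_sum, Finset.smul_sum,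
    ← Finset.sum_add_distrib]
  refine Finset.sum_congr rfl fun g _ => ?_
  simp only [List.append_nil]
  have h := mul_leftFaces_mul k (el k g⁻¹ * z) 1 1 (u ++ [g])
    fun x m' => el k x * hEval k m β m' * el k 1
  simp only [mul_one, el_one, mul_assoc] at h
  rw [hd_cochain k hq _ (by simp; omega), faces_concat]
  have hsq : (-1 : ℤ) ^ m * (-1) ^ m = 1 := by rw [← mul_pow]; simp
  simp only [one_mul, mul_one, el_one, mul_assoc, mul_add, h, show u.length = m by omega, pow_succ,
    smul_add, mul_smul_comm, mul_neg, neg_smul, smul_neg, smul_smul, neg_mul, neg_neg, hsq, one_smul]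
  abel

/-- The Leibniz rule for a chain and a cochain whose product has degree at least `0`. -/
theorem hd_hCup_NP_P {s m w m' w' : ℕ} {p' : ℤ}
    (hr : Int.negSucc s + Int.ofNat m = Int.ofNat w)
    (hp : Int.negSucc s + 1 = p') (hq : Int.ofNat m + 1 = Int.ofNat m')
    (hr' : Int.ofNat w + 1 = Int.ofNat w')
    (h₁ : p' + Int.ofNat m = Int.ofNat w') (h₂ : Int.negSucc s + Int.ofNat m' = Int.ofNat w')
    (x : HTate k G (Int.negSucc s)) (β : HTate k G (Int.ofNat m)) :
    hd k G _ _ hr' (hCup k G _ _ _ hr x β)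
      = (-1 : ℤ) ^ s • hCup k G _ _ _ h₁ (hd k G _ _ hp x) β
        + (-1 : ℤ) ^ (s + 1) • hCup k G _ _ _ h₂ x (hd k G _ _ hq β) := by
  induction x using hTate_induction with
  | hadd x x' hx hx' => simp only [map_add, LinearMap.add_apply, hx, hx', smul_add]; abel
  | hword u z hu =>
  have hr0 := hr
  have hq0 := hq
  have hr0' := hr'
  simp only [Int.ofNat_eq_natCast] at hr0 hq0 hr0'
  refine hEval_ext k fun v hv => ?_
  simp only [map_add, map_zsmul, Pi.add_apply, Pi.smul_apply]
  have e1 : hEval k w' (hd k G _ _ hr' (hCup k G _ _ _ hr (hChain k s u z) β)) v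
      = ∑ g : G, rightFaces (g :: v) 1
        fun m' y => el k g⁻¹ * (z * hEval k m β (u ++ m') * el k y) := by
    rw [hd_cochain k hr' _ hv, sum_rightFaces_cons _ (by rintro rfl; simp at hv; omega)]
    refine faces_congr_length fun x l y hl => ?_
    rw [hCup_NP_P k hr β hu (by omega), Finset.mul_sum, Finset.sum_mul]
    simp [-MonoidAlgebra.single_mul_single, el_mul, mul_assoc]
  rw [e1, hCup_NP_P k h₂ _ hu hv, hCup_hd_cochain_of_chain k hp h₁ β hu hv, Finset.smul_sum,
    Finset.smul_sum, ← Finset.sum_add_distrib]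
  refine Finset.sum_congr rfl fun g _ => ?_
  have h := mul_rightFaces_mul k (el k g⁻¹ * z) 1 (g :: v) 1
    fun m' y => el k 1 * hEval k m β (u ++ m') * el k y
  have h' := mul_leftFaces_mul k (el k g⁻¹ * z) 1 1 (u ++ [g])
    fun x m' => el k x * hEval k m β (m' ++ v) * el k 1
  simp only [one_mul, mul_one, el_one, mul_assoc] at h h'
  rw [hd_cochain k hq _ (by simp; omega), faces_append, hu]
  have hsq : (-1 : ℤ) ^ s * (-1) ^ s = 1 := by rw [← mul_pow]; simp
  simp only [one_mul, mul_one, el_one, mul_assoc, mul_add, h, h', pow_succ,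
    smul_add, mul_smul_comm, mul_neg, neg_smul, smul_neg, smul_smul, neg_mul, neg_neg, hsq, one_smul]
  abel

/-- The Leibniz rule for the cup product on the Tate-Hochschild complex.  Its two signs depend on
the degrees only, in a way that differs between the six cases of the definition. -/
theorem hd_hCup {p q r p' q' r' : ℤ} (hr : p + q = r) (hp : p + 1 = p') (hq : q + 1 = q')
    (hr' : r + 1 = r') (h₁ : p' + q = r') (h₂ : p + q' = r') :
    ∃ i j : ℕ, ∀ (x : HTate k G p) (y : HTate k G q),
      hd k G r r' hr' (hCup k G p q r hr x y)
        = (-1 : ℤ) ^ i • hCup k G p' q r' h₁ (hd k G p p' hp x) y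
          + (-1 : ℤ) ^ j • hCup k G p q' r' h₂ x (hd k G q q' hq y) := by
  have neg (n m : ℕ) : ¬ Int.ofNat n + 1 = Int.negSucc m := by
    simp only [Int.ofNat_eq_natCast]; omega
  have pos (n m l : ℕ) : ¬ Int.ofNat n + Int.ofNat m = Int.negSucc l := by
    simp only [Int.ofNat_eq_natCast]; omega
  have pos' (n m l : ℕ) : ¬ Int.negSucc n + Int.negSucc m = Int.ofNat l := by
    simp only [Int.ofNat_eq_natCast]; omega
  rcases p with n | s
  · rcases p' with n' | _
    swap
    · exact (neg _ _ hp).elim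
    rcases q with m | t
    · rcases q' with m' | _
      swap
      · exact (neg _ _ hq).elim
      rcases r with r | _
      swap
      · exact (pos _ _ _ hr).elim
      rcases r' with r' | _
      swap
      · exact (neg _ _ hr').elim
      exact ⟨_, _, hd_hCup_PP k hr hp hq hr' h₁ h₂⟩
    · rcases r with w | c
      · rcases r' with w' | _
        swap
        · exact (neg _ _ hr').elim
        exact ⟨_, _, hd_hCup_PN_P k hr hp hq hr' h₁ h₂⟩
      · rcases r' with w' | c'
        · exact ⟨_, _, hd_hCup_PN_trace k hr hp hq hr' h₁ h₂⟩
        · rcases q' with _ | t'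
          · exact (pos _ _ _ h₂).elim
          · exact ⟨_, _, hd_hCup_PN_N k hr hp hq hr' h₁ h₂⟩
  · rcases q with m | t
    · rcases q' with m' | _
      swap
      · exact (neg _ _ hq).elim
      rcases r with w | c
      · rcases r' with w' | _
        swap
        · exact (neg _ _ hr').elim
        exact ⟨_, _, hd_hCup_NP_P k hr hp hq hr' h₁ h₂⟩
      · rcases r' with w' | c'
        · exact ⟨_, _, hd_hCup_NP_trace k hr hp hq hr' h₁ h₂⟩
        · rcases p' with _ | s'
          · exact (pos _ _ _ h₁).elim
          · exact ⟨_, _, hd_hCup_NP_N k hr hp hq hr' h₁ h₂⟩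
    · rcases r with _ | r
      · exact (pos' _ _ _ hr).elim
      rcases r' with r' | r'
      · have := hr
        have := hr'
        simp only [Int.ofNat_eq_natCast] at *
        omega
      · exact ⟨_, _, hd_hCup_NN k hr hp hq hr' h₁ h₂⟩

/-- The Tate-Hochschild complex is a complex. -/
theorem hd_hd {p q r : ℤ} (h : p + 1 = q) (h' : q + 1 = r) (x : HTate k G p) :
    hd k G q r h' (hd k G p q h x) = 0 := by
  rcases p with n | s
  · rcases q with m | _
    swap
    · have h0 := h; simp only [Int.ofNat_eq_natCast] at h0; omega
    rcases r with l | _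
    swap
    · have h0 := h'; simp only [Int.ofNat_eq_natCast] at h0; omega
    have h0 := h
    have h0' := h'
    simp only [Int.ofNat_eq_natCast] at h0 h0'
    refine hEval_ext k fun w hw => ?_
    rw [hd_cochain k h' _ hw, map_zero, Pi.zero_apply,
      ← faces_faces 1 1 (l := w) (fun x' l' y' => el k x' * hEval k n x l' * el k y') (by omega)]
    refine faces_congr_length fun a l' b hl' => ?_
    rw [hd_cochain k h _ (by omega), mul_faces_mul]
    have := faces_mul a b 1 1 (l := l') fun x' l' y' => el k x' * hEval k n x l' * el k y'
    rw [mul_one, one_mul] at this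
    rw [← this]
    simp [-MonoidAlgebra.single_mul_single, el_mul, mul_assoc]
  · induction x using hTate_induction with
    | hadd x x' hx hx' => rw [map_add, map_add, hx, hx', add_zero]
    | hword l z hl =>
    rcases q with m | t
    · have h0 := h
      simp only [Int.ofNat_eq_natCast] at h0
      obtain rfl : m = 0 := by omega
      obtain rfl := List.length_eq_zero_iff.1 (by omega : l.length = 0)
      rcases r with n | _
      swap
      · have h0 := h'; simp only [Int.ofNat_eq_natCast] at h0; omega
      obtain rfl : n = 1 := by have h0 := h'; simp only [Int.ofNat_eq_natCast] at h0; omega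
      refine hEval_ext k fun w hw => ?_
      obtain ⟨a, rfl⟩ := List.length_eq_one_iff.1 hw
      rw [hd_cochain k h' _ hw]
      simp only [faces, hd_trace k h hl (List.length_nil), one_mul, mul_one, el_one, map_zero,
        Pi.zero_apply, Finset.mul_sum, Finset.sum_mul, sub_eq_zero]
      refine Fintype.sum_equiv (Equiv.mulLeft a) _ _ fun g => ?_
      simp [-MonoidAlgebra.single_mul_single, el_mul, mul_assoc, el_inv_mul]
    · rw [hd_chain k h hl]
      rcases r with m | r
      · have h0 := h'
        simp only [Int.ofNat_eq_natCast] at h0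
        obtain rfl : m = 0 := by omega
        obtain rfl : t = 0 := by omega
        obtain rfl : s = 1 := by omega
        obtain ⟨a, rfl⟩ := List.length_eq_one_iff.1 hl
        refine hEval_ext k fun w hw => ?_
        obtain rfl := List.length_eq_zero_iff.1 hw
        simp only [faces, map_sub, Pi.sub_apply, hd_trace k h' List.length_nil List.length_nil,
          one_mul, mul_one, el_one, map_zero, Pi.zero_apply, sub_eq_zero]
        refine Fintype.sum_equiv (Equiv.mulRight a⁻¹) _ _ fun g => ?_
        simp only [Equiv.coe_mulRight, el_mul, mul_inv_rev, inv_inv, mul_assoc]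
        rw [← mul_assoc (el k a⁻¹) (el k a), el_inv_mul, one_mul]
      · rw [← faces_faces 1 1 (l := l)
          (fun x' l' y' => hChain k r l' (el k y' * z * el k x')) (by omega)]
        refine (faces_map (hd k G _ _ h').toAddMonoidHom _ _ _ _).trans ?_
        refine faces_congr_length fun a l' b hl' => ?_
        refine (hd_chain k h' (by omega) _).trans ?_
        have := faces_mul a b 1 1 (l := l')
          fun x' l' y' => hChain k r l' (el k y' * z * el k x')
        rw [mul_one, one_mul] at this
        rw [← this]
        simp [-MonoidAlgebra.single_mul_single, el_mul, mul_assoc]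

end Leibniz

/-! ### Connes' operator and its dual -/

section Connes

variable (k : Type u) [Field k] {G : Type v} [Group G]

/-- The coefficient of an element of `kG` at a group element. -/
def coef {G : Type*} (x : G) : MonoidAlgebra k G →ₗ[k] k :=
  Finsupp.lapply x ∘ₗ (MonoidAlgebra.coeffLinearEquiv k).toLinearMap

theorem coef_single {G : Type*} [DecidableEq G] (x y : G) (c : k) :
    coef k x (MonoidAlgebra.single y c) = if y = x then c else 0 := by
  simp [coef, Finsupp.single_apply]

theorem coef_ext {G : Type*} {z w : MonoidAlgebra k G} (h : ∀ x, coef k x z = coef k x w) : z = w := by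
  ext x
  exact h x

theorem coef_el_mul_mul_el (x a b : G) (z : MonoidAlgebra k G) :
    coef k x (el k a * z * el k b) = coef k (a⁻¹ * x * b⁻¹) z := by
  classical
  induction z using MonoidAlgebra.induction_linear with
  | zero => simp
  | add f g hf hg => simp [mul_add, add_mul, hf, hg]
  | single y c =>
    simp only [el, MonoidAlgebra.single_mul_single, coef_single, one_mul, mul_one]
    congr 1
    rw [eq_mul_inv_iff_mul_eq, eq_inv_mul_iff_mul_eq, mul_assoc]

theorem coef_sum_smul_el [Fintype G] (c : G → k) (x : G) :
    coef k x (∑ g : G, c g • el k g⁻¹) = c x⁻¹ := by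
  classical
  simp only [map_sum, map_smul, el, coef_single, smul_eq_mul, mul_ite, mul_one, mul_zero,
    inv_eq_iff_eq_inv]
  simp

theorem ofFn_rot {G : Type*} {m : ℕ} (g : Fin (m + 1) → G) (i : Fin (m + 1)) :
    List.ofFn (rot g i) = (List.ofFn g).rotate i := by
  refine List.ext_getElem (by simp) fun j h₁ h₂ => ?_
  rw [List.getElem_rotate]
  simp only [List.getElem_ofFn, rot, List.length_ofFn]
  congr 1

theorem cycSum_ofFn {G M : Type*} [AddCommGroup M] [Module k M] {m : ℕ} (g : Fin (m + 1) → G)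
    (F : List G → M) :
    cycSum (List.ofFn g) F
      = ∑ i : Fin (m + 1), (-1 : k) ^ (i.val * m) • F (List.ofFn (rot g i)) := by
  rw [cycSum, List.length_ofFn, Finset.sum_range]
  refine Finset.sum_congr rfl fun i _ => ?_
  rw [neg_one_pow_smul, ofFn_rot, Nat.add_sub_cancel, mul_comm]

theorem cycSum_eq_zero {M : Type*} [AddCommGroup M] {l : List G} {F : List G → M}
    (hF : ∀ m, 1 ∈ m → F m = 0) (hl : 1 ∈ l) : cycSum l F = 0 := by
  rw [cycSum_congr (F' := fun _ => 0) fun m _ hm => hF m ((hm 1).2 hl)]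
  simp [cycSum]

/-- The operator `Δ` is the transpose of Connes' operator: its coefficients are signed cyclic sums of
coefficients at `1`. -/
theorem hΔ_word [Fintype G] {m : ℕ} (α : HCochain k G (m + 1)) {l : List G} (hl : l.length = m)
    (g : G) : coef k g⁻¹ (evalWord k m (hΔ k G m α) l)
      = cycSum (g :: l) fun w => coef k 1 (evalWord k (m + 1) α w) := by
  have h : evalWord k m (hΔ k G m α) l
      = ∑ g : G, (cycSum (g :: l) fun w => coef k 1 (evalWord k (m + 1) α w)) • el k g⁻¹ := by
    refine evalWord_eq k (α := hΔ k G m α) (F := fun l =>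
      ∑ g : G, (cycSum (g :: l) fun w => coef k 1 (evalWord k (m + 1) α w)) • el k g⁻¹)
      (fun l h1 => Finset.sum_eq_zero fun g _ => ?_) (fun g => ?_) hl
    · rw [cycSum_eq_zero (fun w hw => by rw [evalWord_of_one_mem k α hw, map_zero])
        (List.mem_cons_of_mem g h1), zero_smul]
    · simp only [hΔ, LinearMap.pi_apply, LinearMap.sum_apply, LinearMap.smul_apply,
        LinearMap.comp_apply, LinearMap.toSpanSingleton_apply]
      refine Finset.sum_congr rfl fun g₀ _ => ?_
      rw [← List.ofFn_cons, cycSum_ofFn k, Finset.sum_smul]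
      refine Finset.sum_congr rfl fun i _ => ?_
      rw [evalWord_ofFn, smul_assoc]
      rfl
  rw [h, coef_sum_smul_el, inv_inv]

theorem hB_word {s : ℕ} {l : List G} (hl : l.length = s) (x : G) :
    hB k G s (hWord k s l (el k x)) = cycSum (x :: l) fun w => hWord k (s + 1) w 1 := by
  by_cases h1 : 1 ∈ l
  · rw [hWord_of_one_mem k h1, cycSum_eq_zero (fun w hw => by rw [hWord_of_one_mem k hw]; rfl)
      (List.mem_cons_of_mem x h1), LinearMap.zero_apply, map_zero]
  · obtain ⟨g, rfl⟩ := exists_eq_ofFn_vals hl h1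
    rw [hWord_ofFn_vals, el, hPlace_single, hB, Finsupp.linearCombination_single, one_smul,
      ← List.ofFn_cons, cycSum_ofFn k]
    refine Finset.sum_congr rfl fun i _ => ?_
    rw [hBasis_eq]
    rfl

theorem hEval_of_one_mem {n : ℕ} (α : HTate k G (Int.ofNat n)) {l : List G} (hl : 1 ∈ l) :
    hEval k n α l = 0 :=
  evalWord_of_one_mem k _ hl

theorem hChain_of_one_mem {s : ℕ} {l : List G} (hl : 1 ∈ l) : hChain k s l = 0 :=
  hWord_of_one_mem k hl

/-- Elements of negative degree are linear combinations of chains `(g, l)` with `g ∈ G`. -/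
theorem hTate_induction_el {s : ℕ} {p : HTate k G (Int.negSucc s) → Prop}
    (hadd : ∀ x y, p x → p y → p (x + y)) (hsmul : ∀ (c : k) x, p x → p (c • x))
    (hword : ∀ l g, l.length = s → p (hChain k s l (el k g))) (x : HTate k G (Int.negSucc s)) :
    p x := by
  refine hTate_induction k hadd (fun l z hl => ?_) x
  induction z using MonoidAlgebra.induction_linear with
  | zero => simpa using hsmul 0 _ (hword l 1 hl)
  | add f g hf hg => rw [map_add]; exact hadd _ _ hf hg
  | single y c =>
    have : MonoidAlgebra.single y c = c • el k y := by simp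
    rw [this, map_smul]
    exact hsmul _ _ (hword l y hl)

variable [Fintype G] (ε : ℤˣ)

theorem hBV_cochain {n m : ℕ} (e : Int.ofNat m + 1 = Int.ofNat n) (α : HTate k G (Int.ofNat n))
    {l : List G} (hl : l.length = m) (g : G) :
    coef k g⁻¹ (hEval k m (hBV k G ε _ _ e α) l)
      = cycSum (g :: l) fun w => coef k 1 (hEval k n α w) := by
  obtain rfl : n = m + 1 := by simp only [Int.ofNat_eq_natCast] at e; omega
  exact hΔ_word k α hl g

theorem hBV_chain {s t : ℕ} (e : Int.negSucc t + 1 = Int.negSucc s) {l : List G}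
    (hl : l.length = s) (x : G) :
    hBV k G ε _ _ e (hChain k s l (el k x))
      = ((ε ^ (s + 1) : ℤˣ) : ℤ) • cycSum (x :: l) fun w => hChain k t w 1 := by
  obtain rfl : t = s + 1 := by omega
  exact congrArg (((ε ^ (s + 1) : ℤˣ) : ℤ) • ·) (hB_word k hl x)

/-- `Δ̂` has square zero, since all words occurring in the square contain the letter `1`. -/
theorem hBV_hBV {p q r : ℤ} (h : q + 1 = p) (h' : r + 1 = q) (x : HTate k G p) :
    hBV k G ε q r h' (hBV k G ε p q h x) = 0 := by
  rcases p with n | s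
  · rcases q with m | t
    · rcases r with l | _
      · refine hEval_ext k fun w hw => coef_ext k fun g => ?_
        rw [← inv_inv g, hBV_cochain k ε h' _ hw]
        simp only [map_zero, Pi.zero_apply]
        have h1 : cycSum (g⁻¹ :: w) (fun w' => coef k 1 (hEval k m (hBV k G ε _ _ h x) w'))
            = cycSum (g⁻¹ :: w) fun _ => 0 := by
          refine cycSum_congr fun w' hw' _ => ?_
          have := hBV_cochain k ε h x (l := w') (by
            have h0 := h'
            simp only [Int.ofNat_eq_natCast] at h0
            simp at hw'
            omega) 1
          rw [inv_one] at this
          rw [this]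
          exact cycSum_eq_zero (fun v hv => by rw [hEval_of_one_mem k x hv, map_zero]) (by simp)
        rw [h1]
        simp [cycSum]
      · rfl
    · exact map_zero _
  · rcases q with m | t
    · have h0 := h; simp only [Int.ofNat_eq_natCast] at h0; omega
    · rcases r with l | r
      · have h0 := h'; simp only [Int.ofNat_eq_natCast] at h0; omega
      induction x using hTate_induction_el with
      | hadd x x' hx hx' => rw [map_add, map_add, hx, hx', add_zero]
      | hsmul c x hx => rw [map_smul, map_smul, hx, smul_zero]
      | hword l g hl =>
        rw [hBV_chain k ε h hl, map_zsmul]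
        have h1 : hBV k G ε _ _ h' (cycSum (g :: l) fun w => hChain k t w 1)
            = cycSum (g :: l) fun _ => 0 := by
          refine (cycSum_map (hBV k G ε _ _ h').toAddMonoidHom _ _).trans ?_
          refine cycSum_congr fun w hw _ => ?_
          refine (hBV_chain k ε h' (l := w) (by simp at hw; omega) 1).trans ?_
          rw [cycSum_eq_zero (fun v hv => by rw [hChain_of_one_mem k hv]; rfl) (by simp), smul_zero]
        rw [h1]
        simp [cycSum]

/-- `Δ̂` commutes with the differential up to a sign depending on the degree. -/
theorem hBV_hd {p p' q : ℤ} (h : p + 1 = p') (h' : q + 1 = p) :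
    ∃ c : ℤˣ, ∀ x : HTate k G p,
      hBV k G ε p' p h (hd k G p p' h x) = (c : ℤ) • hd k G q p h' (hBV k G ε p q h' x) := by
  rcases p with n | s
  · rcases p' with n' | _
    swap
    · have h0 := h; simp only [Int.ofNat_eq_natCast] at h0; omega
    -- The values of `Δ` are known through their coefficients at inverses.
    refine ⟨-1, fun x => hEval_ext k fun l hl => coef_ext k fun g => ?_⟩
    have h0 := h
    simp only [Int.ofNat_eq_natCast] at h0
    rw [← inv_inv g, hBV_cochain k ε h _ hl]
    have h1 : cycSum (g⁻¹ :: l) (fun w => coef k 1 (hEval k n' (hd k G _ _ h x) w))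
        = cycSum (g⁻¹ :: l) fun w => faces 1 w 1
          fun a m b => coef k 1 (el k a * hEval k n x m * el k b) := by
      refine cycSum_congr fun w hw _ => ?_
      rw [hd_cochain k h x (by simp at hw; omega)]
      exact faces_map (coef k 1).toAddMonoidHom _ _ _ _
    rw [h1]
    rcases q with m | _
    · have hl0 : l ≠ [] := by
        rintro rfl
        have h0 := h'
        simp only [Int.ofNat_eq_natCast] at h0
        simp at hl
        omega
      rw [cycSum_faces _ hl0 _ fun a m => by
        rw [coef_el_mul_mul_el, coef_el_mul_mul_el]; simp]
      simp only [Units.val_neg, Units.val_one, neg_smul, one_smul, map_neg, Pi.neg_apply]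
      congr 1
      have h2 := faces_mul g⁻¹ 1 1 1 (l := l)
        fun x' l' y' => cycSum (y' * x' :: l') fun m => coef k 1 (el k 1 * hEval k n x m * el k 1)
      simp only [mul_one] at h2
      rw [← h2, hd_cochain k h' _ hl]
      refine Eq.trans ?_ (faces_map (coef k g⁻¹⁻¹).toAddMonoidHom _ _ _ _).symm
      refine faces_congr_length fun a l' b hl' => ?_
      refine Eq.trans ?_ (coef_el_mul_mul_el k _ a b _).symm
      have := hBV_cochain k ε h' x (l := l') (by
        have h0 := h'
        simp only [Int.ofNat_eq_natCast] at h0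
        omega) (b * (g⁻¹ * a))
      simp only [mul_inv_rev, mul_assoc] at this ⊢
      rw [this]
      simp [el_one]
    -- In degree `0` the right-hand side vanishes by definition of `Δ̂`.
    · have hl0 : n = 0 := by
        have h0 := h'
        simp only [Int.ofNat_eq_natCast] at h0
        omega
      obtain rfl := List.length_eq_zero_iff.1 (hl.trans hl0)
      have : hBV k G ε (Int.ofNat n) _ h' x = 0 := rfl
      rw [this]
      simp [cycSum, faces, coef_el_mul_mul_el]
  · rcases q with m | t
    · have h0 := h'; simp only [Int.ofNat_eq_natCast] at h0; omega
    have hdB (l : List G) (hl : l.length = s) (g : G) :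
        hd k G _ _ h' (hBV k G ε _ _ h' (hChain k s l (el k g)))
          = ((ε ^ (s + 1) : ℤˣ) : ℤ) • cycSum (g :: l) fun w => faces 1 w 1
            fun a m b => hChain k s m (el k (b * a)) := by
      rw [hBV_chain k ε h' hl, map_zsmul]
      congr 1
      refine (cycSum_map (hd k G _ _ h').toAddMonoidHom _ _).trans ?_
      refine cycSum_congr fun w hw _ => ?_
      refine (hd_chain k h' (by simp at hw; omega) _).trans ?_
      simp [el_mul, -MonoidAlgebra.single_mul_single]
    rcases p' with m | s'
    · have hs : s = 0 := by have h0 := h; simp only [Int.ofNat_eq_natCast] at h0; omega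
      -- The trace lies in degree `0`, where `Δ̂` is zero, and the two faces of `B(g)` cancel.
      refine ⟨1, fun x => ?_⟩
      have h1 : hBV k G ε (Int.ofNat m) (Int.negSucc s) h = 0 := rfl
      rw [h1, LinearMap.zero_apply]
      symm
      induction x using hTate_induction_el with
      | hadd x x' hx hx' => simp only [map_add, smul_add, hx, hx', add_zero]
      | hsmul c x hx => rw [map_smul, map_smul, smul_comm, hx, smul_zero]
      | hword l g hl =>
        obtain rfl := List.length_eq_zero_iff.1 (hl.trans hs)
        rw [hdB _ hl]
        simp [cycSum, faces]
    · refine ⟨-ε, fun x => ?_⟩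
      induction x using hTate_induction_el with
      | hadd x x' hx hx' => simp only [map_add, smul_add, hx, hx']
      | hsmul c x hx => rw [map_smul, map_smul, map_smul, map_smul, smul_comm _ c, hx]
      | hword l g hl =>
        have hl0 : l ≠ [] := by
          rintro rfl
          simp at hl
          omega
        rw [hdB _ hl, hd_chain k h hl, cycSum_faces _ hl0 _ fun a m => by simp]
        have h2 := faces_mul g 1 1 1 (l := l)
          fun x' l' y' => cycSum (y' * x' :: l') fun m => hChain k s m (el k (1 * 1))
        simp only [mul_one] at h2
        simp only [mul_one]
        rw [← h2, smul_neg, ← neg_smul, smul_smul]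
        have h3 : ((-ε : ℤˣ) : ℤ) * -((ε ^ (s + 1) : ℤˣ) : ℤ) = ((ε ^ (s' + 1) : ℤˣ) : ℤ) := by
          obtain rfl : s = s' + 1 := by omega
          rcases Int.units_eq_one_or ε with rfl | rfl <;> simp [pow_succ]
        rw [h3]
        refine (faces_map (hBV k G ε _ _ h).toAddMonoidHom _ _ _ _).trans (Eq.trans ?_
          (faces_map (DistribSMul.toAddMonoidHom _ ((ε ^ (s' + 1) : ℤˣ) : ℤ)) _ _ _ _).symm)
        refine faces_congr_length fun a l' b hl' => ?_
        rw [← el_mul, ← el_mul]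
        refine (hBV_chain k ε h (by omega) _).trans ?_
        rw [mul_assoc]
        rfl

end Connes

/-! ### The Tate complex on words -/

section TateComponents

variable (k : Type u) [Field k] {G : Type v} [Group G]

theorem gδ_word {n : ℕ} (α : GCochain k G n) {l : List G} (hl : l.length = n + 1) :
    evalWord k (n + 1) (gδ k G n α) l = faces 1 l 1 fun _ l' _ => evalWord k n α l' := by
  refine evalWord_eq k (fun l h1 => faces_eq_zero_of_one_mem (fun x l' y h => ?_) h1)
    (fun g => ?_) hl
  · rw [evalWord_of_one_mem k α h]
  · rw [faces_ofFn]
    have h2 : List.ofFn (Fin.tail (vals g)) = List.ofFn (vals (Fin.tail g)) := rfl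
    have h3 : List.ofFn (Fin.init (vals g)) = List.ofFn (vals (Fin.init g)) := rfl
    simp only [gδ, LinearMap.pi_apply, LinearMap.add_apply, LinearMap.sum_apply,
      LinearMap.smul_apply, neg_one_pow_smul, h2, h3, evalWord_ofFn]

theorem gBd_word {s : ℕ} {l : List G} (hl : l.length = s + 1) :
    gBd k G s (gWord k (s + 1) l) = faces 1 l 1 fun _ l' _ => gWord k s l' := by
  by_cases h1 : 1 ∈ l
  · rw [gWord_of_one_mem k h1, map_zero,
      faces_eq_zero_of_one_mem (fun x l' y h => gWord_of_one_mem k h) h1]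
  · obtain ⟨g, rfl⟩ := exists_eq_ofFn_vals hl h1
    have h2 : List.ofFn (Fin.tail (vals g)) = List.ofFn (vals (Fin.tail g)) := rfl
    have h3 : List.ofFn (Fin.init (vals g)) = List.ofFn (vals (Fin.init g)) := rfl
    rw [faces_ofFn, gWord_ofFn_vals, gBd, Finsupp.linearCombination_single]
    simp only [h2, h3, neg_one_pow_smul, gBasis_eq, one_smul]

theorem evalWord_zero_nil {M : Type*} [AddCommGroup M] [Module k M]
    (α : (Fin 0 → NonId G) → M) : evalWord k 0 α [] = α Fin.elim0 := by
  have := evalWord_ofFn k α (vals (Fin.elim0 : Fin 0 → NonId G))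
  rwa [evalAt_vals] at this

theorem gτ_word [Fintype G] : evalWord k 0 (gτ k G (gWord k 0 [])) [] = ∑ _g : G, (1 : k) := by
  have h0 := gWord_ofFn_vals k (Fin.elim0 : Fin 0 → NonId G)
  simp only [List.ofFn_zero] at h0
  rw [h0, evalWord_zero_nil, gτ, Finsupp.linearCombination_single, one_smul]

theorem gCupPP_word {n m : ℕ} (α : GCochain k G n) (β : GCochain k G m) {u v : List G}
    (hu : u.length = n) (hv : v.length = m) :
    evalWord k (n + m) (gCupPP k G n m α β) (u ++ v) = evalWord k n α u * evalWord k m β v := by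
  by_cases h1 : 1 ∈ u
  · simp [evalWord_of_one_mem k _ h1, evalWord_of_one_mem k _ (List.mem_append_left v h1)]
  by_cases h2 : 1 ∈ v
  · simp [evalWord_of_one_mem k _ h2, evalWord_of_one_mem k _ (List.mem_append_right u h2)]
  obtain ⟨g, rfl⟩ := exists_eq_ofFn_vals hu h1
  obtain ⟨h, rfl⟩ := exists_eq_ofFn_vals hv h2
  rw [ofFn_vals_append, evalWord_ofFn, evalWord_ofFn, evalWord_ofFn]
  simp [evalAt_vals, gCupPP]

theorem gCupNN_word [Fintype G] {s t : ℕ} {l r : List G} (hl : l.length = s) (hr : r.length = t) :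
    gCupNN k G s t (gWord k s l) (gWord k t r)
      = ∑ g : G, gWord k (t + (s + 1)) (r ++ g :: l) := by
  by_cases h1 : 1 ∈ l
  · rw [gWord_of_one_mem k h1, Finset.sum_eq_zero]
    · simp
    · intro g _
      rw [gWord_of_one_mem k (by simp [h1])]
  by_cases h2 : 1 ∈ r
  · rw [gWord_of_one_mem k h2, Finset.sum_eq_zero]
    · simp
    · intro g _
      rw [gWord_of_one_mem k (by simp [h2])]
  obtain ⟨a, rfl⟩ := exists_eq_ofFn_vals hl h1
  obtain ⟨b, rfl⟩ := exists_eq_ofFn_vals hr h2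
  rw [gWord_ofFn_vals, gWord_ofFn_vals, gCupNN, Finsupp.linearCombination_single,
    LinearMap.smul_apply, Finsupp.linearCombination_single, one_smul, one_smul]
  refine Finset.sum_congr rfl fun g _ => ?_
  rw [gBasis_eq, ofFn_append_cons]

theorem gCupPN_N_word {n r : ℕ} (α : GCochain k G n) {u v : List G} (hu : u.length = r)
    (hv : v.length = n) :
    gCupPN_N k G n r α (gWord k (r + n) (u ++ v)) = evalWord k n α v • gWord k r u := by
  by_cases h1 : 1 ∈ u
  · simp [gWord_of_one_mem k h1, gWord_of_one_mem k (List.mem_append_left v h1)]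
  by_cases h2 : 1 ∈ v
  · simp [evalWord_of_one_mem k _ h2, gWord_of_one_mem k (List.mem_append_right u h2)]
  obtain ⟨a, rfl⟩ := exists_eq_ofFn_vals hu h1
  obtain ⟨b, rfl⟩ := exists_eq_ofFn_vals hv h2
  rw [ofFn_vals_append, gWord_ofFn_vals, gWord_ofFn_vals, evalWord_ofFn, evalAt_vals, gCupPN_N,
    LinearMap.flip_apply, Finsupp.linearCombination_single]
  simp

theorem gCupPN_P_word [Fintype G] {w t : ℕ} (α : GCochain k G (w + (t + 1))) {u v : List G}
    (hu : u.length = w) (hv : v.length = t) :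
    evalWord k w (gCupPN_P k G w t α (gWord k t v)) u
      = ∑ g : G, evalWord k (w + (t + 1)) α (u ++ g :: v) := by
  by_cases h1 : 1 ∈ u
  · rw [evalWord_of_one_mem k _ h1, Finset.sum_eq_zero]
    intro g _
    rw [evalWord_of_one_mem k _ (by simp [h1])]
  by_cases h2 : 1 ∈ v
  · rw [gWord_of_one_mem k h2, Finset.sum_eq_zero]
    · simp
    · intro g _
      rw [evalWord_of_one_mem k _ (by simp [h2])]
  obtain ⟨a, rfl⟩ := exists_eq_ofFn_vals hu h1
  obtain ⟨b, rfl⟩ := exists_eq_ofFn_vals hv h2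
  rw [gWord_ofFn_vals, gCupPN_P, LinearMap.flip_apply, Finsupp.linearCombination_single,
    evalWord_ofFn, evalAt_vals]
  simp only [LinearMap.pi_apply, LinearMap.sum_apply, one_smul]
  refine Finset.sum_congr rfl fun g _ => ?_
  rw [← evalWord_ofFn, ofFn_append_cons]

theorem gCupNP_N_word {m r : ℕ} (β : GCochain k G m) {u v : List G} (hu : u.length = m)
    (hv : v.length = r) :
    gCupNP_N k G m r (gWord k (m + r) (u ++ v)) β = evalWord k m β u • gWord k r v := by
  by_cases h1 : 1 ∈ u
  · simp [evalWord_of_one_mem k _ h1, gWord_of_one_mem k (List.mem_append_left v h1)]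
  by_cases h2 : 1 ∈ v
  · simp [gWord_of_one_mem k h2, gWord_of_one_mem k (List.mem_append_right u h2)]
  obtain ⟨a, rfl⟩ := exists_eq_ofFn_vals hu h1
  obtain ⟨b, rfl⟩ := exists_eq_ofFn_vals hv h2
  rw [ofFn_vals_append, gWord_ofFn_vals, gWord_ofFn_vals, evalWord_ofFn, evalAt_vals, gCupNP_N,
    Finsupp.linearCombination_single]
  simp

theorem gCupNP_P_word [Fintype G] {s w : ℕ} (β : GCochain k G (s + (w + 1))) {u v : List G}
    (hu : u.length = s) (hv : v.length = w) :
    evalWord k w (gCupNP_P k G s w (gWord k s u) β) v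
      = ∑ g : G, evalWord k (s + (w + 1)) β (u ++ g :: v) := by
  by_cases h1 : 1 ∈ v
  · rw [evalWord_of_one_mem k _ h1, Finset.sum_eq_zero]
    intro g _
    rw [evalWord_of_one_mem k _ (by simp [h1])]
  by_cases h2 : 1 ∈ u
  · rw [gWord_of_one_mem k h2, Finset.sum_eq_zero]
    · simp
    · intro g _
      rw [evalWord_of_one_mem k _ (by simp [h2])]
  obtain ⟨a, rfl⟩ := exists_eq_ofFn_vals hv h1
  obtain ⟨b, rfl⟩ := exists_eq_ofFn_vals hu h2
  rw [gWord_ofFn_vals, gCupNP_P, Finsupp.linearCombination_single, evalWord_ofFn, evalAt_vals]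
  simp only [LinearMap.pi_apply, LinearMap.sum_apply, one_smul]
  refine Finset.sum_congr rfl fun g _ => ?_
  rw [← evalWord_ofFn, ofFn_append_cons]

theorem gΔ_word {m : ℕ} (α : GCochain k G (m + 1)) {l : List G} (hl : l.length = m) :
    evalWord k m (gΔ k G m α) l = cycSum (l.prod⁻¹ :: l) fun w => evalWord k (m + 1) α w := by
  refine evalWord_eq k (α := gΔ k G m α)
    (F := fun l => cycSum (l.prod⁻¹ :: l) fun w => evalWord k (m + 1) α w)
    (fun l h1 => cycSum_eq_zero (fun w hw => evalWord_of_one_mem k α hw)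
      (List.mem_cons_of_mem _ h1)) (fun g => ?_) hl
  rw [← List.ofFn_cons, cycSum_ofFn k]
  simp only [gΔ, LinearMap.pi_apply, LinearMap.sum_apply, LinearMap.smul_apply, evalWord_ofFn]
  rfl

theorem gB_word {s : ℕ} {l : List G} (hl : l.length = s) :
    gB k G s (gWord k s l) = cycSum (l.prod⁻¹ :: l) fun w => gWord k (s + 1) w := by
  by_cases h1 : 1 ∈ l
  · rw [gWord_of_one_mem k h1, map_zero, cycSum_eq_zero (fun w hw => gWord_of_one_mem k hw)
      (List.mem_cons_of_mem _ h1)]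
  · obtain ⟨g, rfl⟩ := exists_eq_ofFn_vals hl h1
    rw [gWord_ofFn_vals, gB, Finsupp.linearCombination_single, one_smul, ← List.ofFn_cons,
      cycSum_ofFn k]
    simp only [gBasis_eq]
    rfl

end TateComponents

section TateDegrees

variable (k : Type u) [Field k] {G : Type v} [Group G]

/-- Value on words of an element of nonnegative degree of the Tate complex. -/
def gEval (n : ℕ) : GTate k G (Int.ofNat n) →ₗ[k] (List G → k) :=
  (evalWord k n : GCochain k G n →ₗ[k] (List G → k))

/-- The chain `l` as an element of degree `-s-1` of the Tate complex. -/
def gChain (s : ℕ) (l : List G) : GTate k G (Int.negSucc s) :=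
  (gWord k s l : GChain k G s)

theorem gEval_ext {n : ℕ} {α β : GTate k G (Int.ofNat n)}
    (h : ∀ l : List G, l.length = n → gEval k n α l = gEval k n β l) : α = β :=
  evalWord_ext k (α := (α : GCochain k G n)) (β := (β : GCochain k G n)) h

theorem gTate_ext {M : Type*} [AddCommGroup M] [Module k M] {s : ℕ}
    {f f' : GTate k G (Int.negSucc s) →ₗ[k] M}
    (h : ∀ l, l.length = s → f (gChain k s l) = f' (gChain k s l)) : f = f' :=
  gChain_ext k (f := (f : GChain k G s →ₗ[k] M)) (f' := (f' : GChain k G s →ₗ[k] M)) h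

theorem gBV_cochain (ε : ℤˣ) {n m : ℕ} (e : Int.ofNat m + 1 = Int.ofNat n) (α : GTate k G (Int.ofNat n))
    {l : List G} (hl : l.length = m) :
    gEval k m (gBV k G ε _ _ e α) l = cycSum (l.prod⁻¹ :: l) fun w => gEval k n α w := by
  obtain rfl : n = m + 1 := by simp only [Int.ofNat_eq_natCast] at e; omega
  exact gΔ_word k α hl

theorem gBV_chain (ε : ℤˣ) {s t : ℕ} (e : Int.negSucc t + 1 = Int.negSucc s) {l : List G}
    (hl : l.length = s) :
    gBV k G ε _ _ e (gChain k s l)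
      = ((ε ^ (s + 1) : ℤˣ) : ℤ) • cycSum (l.prod⁻¹ :: l) fun w => gChain k t w := by
  obtain rfl : t = s + 1 := by omega
  exact congrArg (((ε ^ (s + 1) : ℤˣ) : ℤ) • ·) (gB_word k hl)

variable (G) [Fintype G]

/-- The differential of the Tate complex.  The last four patterns cannot satisfy `p + 1 = q`. -/
def gd : ∀ p q : ℤ, p + 1 = q → GTate k G p →ₗ[k] GTate k G q
  | .ofNat n, .ofNat m, e =>
      have h : m = n + 1 := by simp only [Int.ofNat_eq_natCast] at e; omega
      h ▸ gδ k G n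
  | .negSucc (s + 1), .negSucc t, e =>
      have h : t = s := by omega
      h ▸ gBd k G s
  | .negSucc 0, .ofNat 0, _ => gτ k G
  | .negSucc (_ + 1), .ofNat _, _ => 0
  | .negSucc 0, .ofNat (_ + 1), _ => 0
  | .ofNat _, .negSucc _, _ => 0
  | .negSucc 0, .negSucc _, _ => 0

variable {G}

theorem gCocycles_eq (p q : ℤ) (e : p + 1 = q) : gCocycles k G p = LinearMap.ker (gd k G p q e) := by
  subst e
  rcases p with n | _ | s <;> rfl

theorem gCoboundaries_eq (p q : ℤ) (e : p + 1 = q) :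
    gCoboundaries k G q = LinearMap.range (gd k G p q e) := by
  subst e
  rcases p with n | _ | s <;> rfl

theorem gd_cochain {n m : ℕ} (e : Int.ofNat n + 1 = Int.ofNat m) (α : GTate k G (Int.ofNat n))
    {l : List G} (hl : l.length = m) :
    gEval k m (gd k G _ _ e α) l = faces 1 l 1 fun _ l' _ => gEval k n α l' := by
  obtain rfl : m = n + 1 := by simp only [Int.ofNat_eq_natCast] at e; omega
  exact gδ_word k α hl

theorem gd_chain {s t : ℕ} (e : Int.negSucc s + 1 = Int.negSucc t) {l : List G}
    (hl : l.length = s) :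
    gd k G _ _ e (gChain k s l) = faces 1 l 1 fun _ l' _ => gChain k t l' := by
  obtain rfl : s = t + 1 := by omega
  exact gBd_word k hl

theorem gd_trace {s m : ℕ} (e : Int.negSucc s + 1 = Int.ofNat m) {l u : List G}
    (hl : l.length = s) (hu : u.length = m) :
    gEval k m (gd k G _ _ e (gChain k s l)) u = ∑ _g : G, (1 : k) := by
  simp only [Int.ofNat_eq_natCast] at e
  obtain rfl : s = 0 := by omega
  obtain rfl : m = 0 := by omega
  obtain rfl := List.length_eq_zero_iff.1 hl
  obtain rfl := List.length_eq_zero_iff.1 hu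
  exact gτ_word k

theorem gCup_PP {n m r : ℕ} (e : Int.ofNat n + Int.ofNat m = Int.ofNat r)
    (α : GTate k G (Int.ofNat n)) (β : GTate k G (Int.ofNat m)) {u v : List G}
    (hu : u.length = n) (hv : v.length = m) :
    gEval k r (gCup k G _ _ _ e α β) (u ++ v) = gEval k n α u * gEval k m β v := by
  obtain rfl : r = n + m := by simp only [Int.ofNat_eq_natCast] at e; omega
  exact gCupPP_word k α β hu hv

theorem gCup_NN {s t r : ℕ} (e : Int.negSucc s + Int.negSucc t = Int.negSucc r) {u v : List G}
    (hu : u.length = s) (hv : v.length = t) :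
    gCup k G _ _ _ e (gChain k s u) (gChain k t v) = ∑ g : G, gChain k r (v ++ g :: u) := by
  obtain rfl : r = t + (s + 1) := by omega
  exact gCupNN_word k hu hv

theorem gCup_PN_N {n t r : ℕ} (e : Int.ofNat n + Int.negSucc t = Int.negSucc r)
    (α : GTate k G (Int.ofNat n)) {u v : List G} (hu : u.length = r) (hv : v.length = n) :
    gCup k G _ _ _ e α (gChain k t (u ++ v)) = gEval k n α v • gChain k r u := by
  obtain rfl : t = r + n := by simp only [Int.ofNat_eq_natCast] at e; omega
  exact gCupPN_N_word k α hu hv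

theorem gCup_PN_P {n t w : ℕ} (e : Int.ofNat n + Int.negSucc t = Int.ofNat w)
    (α : GTate k G (Int.ofNat n)) {u v : List G} (hu : u.length = w) (hv : v.length = t) :
    gEval k w (gCup k G _ _ _ e α (gChain k t v)) u = ∑ g : G, gEval k n α (u ++ g :: v) := by
  obtain rfl : n = w + (t + 1) := by simp only [Int.ofNat_eq_natCast] at e; omega
  exact gCupPN_P_word k α hu hv

theorem gCup_NP_N {s m r : ℕ} (e : Int.negSucc s + Int.ofNat m = Int.negSucc r)
    (β : GTate k G (Int.ofNat m)) {u v : List G} (hu : u.length = m) (hv : v.length = r) :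
    gCup k G _ _ _ e (gChain k s (u ++ v)) β = gEval k m β u • gChain k r v := by
  obtain rfl : s = m + r := by simp only [Int.ofNat_eq_natCast] at e; omega
  exact gCupNP_N_word k β hu hv

theorem gCup_NP_P {s m w : ℕ} (e : Int.negSucc s + Int.ofNat m = Int.ofNat w)
    (β : GTate k G (Int.ofNat m)) {u v : List G} (hu : u.length = s) (hv : v.length = w) :
    gEval k w (gCup k G _ _ _ e (gChain k s u) β) v = ∑ g : G, gEval k m β (u ++ g :: v) := by
  obtain rfl : m = s + (w + 1) := by simp only [Int.ofNat_eq_natCast] at e; omega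
  exact gCupNP_P_word k β hu hv

end TateDegrees

/-! ### The summand of the conjugacy class of the identity -/

section Inclusion

variable (k : Type u) [Field k] {G : Type v} [Group G]

theorem iotaHat_cochain {n : ℕ} (α : GTate k G (Int.ofNat n)) {l : List G} (hl : l.length = n) :
    hEval k n (iotaHat k G _ α) l = gEval k n α l • el k l.prod := by
  refine evalWord_eq k (α := (iotaHat k G _ α : HCochain k G n))
    (F := fun l => gEval k n α l • el k l.prod)
    (fun l h1 => ?_) (fun g => ?_) hl
  · have : gEval k n α l = 0 := evalWord_of_one_mem k _ h1
    rw [this, zero_smul]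
  · have : gEval k n α (List.ofFn (vals g)) = (α : GCochain k G n) g := by
      rw [← evalAt_vals k g (α : GCochain k G n)]
      exact evalWord_ofFn k _ _
    rw [this]
    rfl

theorem iotaHat_chain {s : ℕ} {l : List G} (hl : l.length = s) :
    iotaHat k G _ (gChain k s l) = hChain k s l (el k l.prod⁻¹) := by
  change (Finsupp.lmapDomain k k fun g => ((tupleProd (vals g))⁻¹, g) :
      GChain k G s →ₗ[k] HChain k G s) (gWord k s l) = hWord k s l (el k l.prod⁻¹)
  by_cases h1 : 1 ∈ l
  · rw [gWord_of_one_mem k h1, hWord_of_one_mem k h1, map_zero]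
    rfl
  · obtain ⟨g, rfl⟩ := exists_eq_ofFn_vals hl h1
    rw [gWord_ofFn_vals, hWord_ofFn_vals, el, hPlace_single, Finsupp.lmapDomain_apply,
      Finsupp.mapDomain_single]
    rfl

variable (G)

/-- The projection of the Tate-Hochschild complex onto the summand of the conjugacy class of `1`: it
sends a cochain `φ` to `g ↦ ⟨φ(g₁, …, gₙ), g₁ ⋯ gₙ⟩`, and a chain `(g₀, g₁, …, gₛ)` to
`(g₁, …, gₛ)` if `g₀ g₁ ⋯ gₛ = 1` and to zero otherwise. -/
def piHat : ∀ n, HTate k G n →ₗ[k] GTate k G n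
  | .ofNat n => (LinearMap.pi fun g => coef k (tupleProd (vals g)) ∘ₗ LinearMap.proj g :
      HCochain k G n →ₗ[k] GCochain k G n)
  | .negSucc s => (Finsupp.linearCombination k fun b =>
      coef k (tupleProd (vals b.2))⁻¹ (el k b.1) • Finsupp.single b.2 1 :
      HChain k G s →ₗ[k] GChain k G s)

variable {G}

theorem piHat_cochain {n : ℕ} (α : HTate k G (Int.ofNat n)) {l : List G} (hl : l.length = n) :
    gEval k n (piHat k G _ α) l = coef k l.prod (hEval k n α l) := by
  refine evalWord_eq k (α := (piHat k G _ α : GCochain k G n))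
    (F := fun l => coef k l.prod (hEval k n α l))
    (fun l h1 => ?_) (fun g => ?_) hl
  · rw [hEval_of_one_mem k α h1, map_zero]
  · have : hEval k n α (List.ofFn (vals g)) = (α : HCochain k G n) g := by
      rw [← evalAt_vals k g (α : HCochain k G n)]
      exact evalWord_ofFn k _ _
    rw [this]
    rfl

theorem piHat_chain {s : ℕ} {l : List G} (hl : l.length = s) (z : MonoidAlgebra k G) :
    piHat k G _ (hChain k s l z) = coef k l.prod⁻¹ z • gChain k s l := by
  change (Finsupp.linearCombination k fun b =>
      coef k (tupleProd (vals b.2))⁻¹ (el k b.1) • Finsupp.single b.2 1 :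
      HChain k G s →ₗ[k] GChain k G s) (hWord k s l z) = coef k l.prod⁻¹ z • gWord k s l
  by_cases h1 : 1 ∈ l
  · rw [gWord_of_one_mem k h1, hWord_of_one_mem k h1, smul_zero]
    exact map_zero _
  · obtain ⟨g, rfl⟩ := exists_eq_ofFn_vals hl h1
    rw [gWord_ofFn_vals, hWord_ofFn_vals]
    induction z using MonoidAlgebra.induction_linear with
    | zero => simp
    | add f g hf hg => rw [map_add, map_add, map_add, add_smul, hf, hg]
    | single y c =>
      rw [hPlace_single, Finsupp.linearCombination_single]
      have : MonoidAlgebra.single y c = c • el k y := by simp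
      rw [this, map_smul, smul_smul, smul_eq_mul]
      rfl

theorem piHat_iotaHat {n : ℤ} (x : GTate k G n) : piHat k G n (iotaHat k G n x) = x := by
  classical
  rcases n with n | s
  · refine gEval_ext k fun l hl => ?_
    rw [piHat_cochain k _ hl, iotaHat_cochain k _ hl, map_smul, el, coef_single, if_pos rfl,
      smul_eq_mul, mul_one]
  · have : piHat k G _ ∘ₗ iotaHat k G (Int.negSucc s) = LinearMap.id := by
      refine gTate_ext k fun l hl => ?_
      rw [LinearMap.comp_apply, iotaHat_chain k hl, piHat_chain k hl, el, coef_single, if_pos rfl,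
        one_smul]
      rfl
    exact DFunLike.congr_fun this x

theorem iotaHat_one : iotaHat k G 0 (gOne k G) = hOne k G := by
  refine hEval_ext k (n := 0) fun l hl => ?_
  obtain rfl := List.length_eq_zero_iff.1 hl
  refine (iotaHat_cochain k (n := 0) _ hl).trans ?_
  have h1 : gEval k 0 (gOne k G) [] = 1 := evalWord_zero_nil k _
  have h2 : hEval k 0 (hOne k G) [] = 1 := evalWord_zero_nil k _
  rw [h1, h2, one_smul]
  rfl

theorem prod_rotate_eq_one_iff (l : List G) (i : ℕ) : (l.rotate i).prod = 1 ↔ l.prod = 1 := by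
  refine ⟨fun h => ?_, fun h => List.prod_rotate_eq_one_of_prod_eq_one h i⟩
  obtain ⟨j, hj⟩ := List.IsRotated.symm (l := l) ⟨i, rfl⟩
  rw [← hj]
  exact List.prod_rotate_eq_one_of_prod_eq_one h j

variable [Fintype G]

theorem iotaHat_gd {p q : ℤ} (h : p + 1 = q) (x : GTate k G p) :
    iotaHat k G q (gd k G p q h x) = hd k G p q h (iotaHat k G p x) := by
  rcases p with n | s
  · rcases q with m | _
    swap
    · have h0 := h; simp only [Int.ofNat_eq_natCast] at h0; omega
    refine hEval_ext k fun l hl => ?_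
    rw [iotaHat_cochain k _ hl, gd_cochain k h _ hl, hd_cochain k h _ hl]
    refine (faces_map ((LinearMap.toSpanSingleton k _ (el k l.prod)).toAddMonoidHom)
      _ _ _ _).trans ?_
    refine faces_congr fun a l' b hl' hp => ?_
    rw [iotaHat_cochain k x (by have h0 := h; simp only [Int.ofNat_eq_natCast] at h0; omega),
      mul_smul_comm, smul_mul_assoc, ← el_mul, ← el_mul, hp]
    simp
  · have : iotaHat k G q ∘ₗ gd k G _ q h = hd k G _ q h ∘ₗ iotaHat k G (Int.negSucc s) := by
      refine gTate_ext k fun l hl => ?_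
      simp only [LinearMap.comp_apply]
      rw [iotaHat_chain k hl]
      rcases q with m | t
      · refine hEval_ext k fun w hw => ?_
        rw [iotaHat_cochain k _ hw, gd_trace k h hl hw, hd_trace k h hl hw, Finset.sum_smul]
        have h0 := h
        simp only [Int.ofNat_eq_natCast] at h0
        obtain rfl := List.length_eq_zero_iff.1 (hl.trans (by omega : s = 0))
        obtain rfl := List.length_eq_zero_iff.1 (hw.trans (by omega : m = 0))
        refine Finset.sum_congr rfl fun g _ => ?_
        rw [← el_mul, ← el_mul]
        simp
      · rw [gd_chain k h hl, hd_chain k h hl]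
        refine (faces_map (iotaHat k G (Int.negSucc t)).toAddMonoidHom _ _ _ _).trans ?_
        refine faces_congr fun a l' b hl' hp => ?_
        refine (iotaHat_chain k (by omega)).trans ?_
        rw [← el_mul, ← el_mul]
        congr 2
        simp only [one_mul, mul_one] at hp
        rw [← hp]
        simp [mul_assoc]
    exact DFunLike.congr_fun this x

/-- The summand of the conjugacy class of `1` is a direct summand of complexes: taking faces does not
change the product of the letters of a word. -/
theorem piHat_hd {p q : ℤ} (h : p + 1 = q) (x : HTate k G p) :
    piHat k G q (hd k G p q h x) = gd k G p q h (piHat k G p x) := by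
  rcases p with n | s
  · rcases q with m | _
    swap
    · have h0 := h; simp only [Int.ofNat_eq_natCast] at h0; omega
    refine gEval_ext k fun l hl => ?_
    rw [piHat_cochain k _ hl, gd_cochain k h _ hl, hd_cochain k h _ hl]
    refine (faces_map (coef k l.prod).toAddMonoidHom _ _ _ _).trans ?_
    refine faces_congr fun a l' b hl' hp => ?_
    refine (coef_el_mul_mul_el k _ _ _ _).trans ?_
    rw [piHat_cochain k x (by have h0 := h; simp only [Int.ofNat_eq_natCast] at h0; omega)]
    simp only [one_mul, mul_one] at hp
    rw [← hp]
    simp [mul_assoc]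
  · induction x using hTate_induction with
    | hadd x y hx hy => simp only [map_add, hx, hy]
    | hword l z hl =>
      rw [piHat_chain k hl, map_smul]
      rcases q with m | t
      · refine gEval_ext k fun w hw => ?_
        rw [map_smul, Pi.smul_apply, piHat_cochain k _ hw, gd_trace k h hl hw,
          hd_trace k h hl hw, map_sum, Finset.smul_sum]
        have h0 := h
        simp only [Int.ofNat_eq_natCast] at h0
        obtain rfl := List.length_eq_zero_iff.1 (hl.trans (by omega : s = 0))
        obtain rfl := List.length_eq_zero_iff.1 (hw.trans (by omega : m = 0))
        refine Finset.sum_congr rfl fun g _ => ?_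
        rw [coef_el_mul_mul_el]
        simp
      · rw [gd_chain k h hl, hd_chain k h hl]
        refine (faces_map (piHat k G (Int.negSucc t)).toAddMonoidHom _ _ _ _).trans (Eq.trans ?_
          (faces_map (DistribSMul.toAddMonoidHom _ (coef k l.prod⁻¹ z)) _ _ _ _).symm)
        refine faces_congr fun a l' b hl' hp => ?_
        refine (piHat_chain k (by omega) _).trans ?_
        rw [coef_el_mul_mul_el]
        simp only [one_mul, mul_one] at hp
        rw [← hp]
        simp [mul_assoc]

theorem iotaHat_gCup {p q r : ℤ} (h : p + q = r) (x : GTate k G p) (y : GTate k G q) :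
    iotaHat k G r (gCup k G p q r h x y) = hCup k G p q r h (iotaHat k G p x) (iotaHat k G q y) := by
  rcases p with n | s
  · rcases q with m | t
    · rcases r with l | _
      swap
      · have h0 := h; simp only [Int.ofNat_eq_natCast] at h0; omega
      refine hEval_ext k fun w hw => ?_
      have h0 := h
      simp only [Int.ofNat_eq_natCast] at h0
      obtain ⟨u, v, rfl, hu⟩ := exists_append_of_le_length (l := w) (j := n) (by omega)
      have hv : v.length = m := by simp at hw; omega
      rw [iotaHat_cochain k _ hw, gCup_PP k h x y hu hv, hCup_PP k h _ _ hu hv,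
        iotaHat_cochain k _ hu, iotaHat_cochain k _ hv, smul_mul_smul_comm, ← el_mul,
        List.prod_append]
    · have : iotaHat k G r ∘ₗ gCup k G _ _ r h x
          = hCup k G _ _ r h (iotaHat k G _ x) ∘ₗ iotaHat k G (Int.negSucc t) := by
        refine gTate_ext k fun l hl => ?_
        simp only [LinearMap.comp_apply]
        rw [iotaHat_chain k hl]
        rcases r with w | c
        · refine hEval_ext k fun u hu => ?_
          rw [iotaHat_cochain k _ hu, gCup_PN_P k h x hu hl, hCup_PN_P k h _ hu hl, Finset.sum_smul]
          refine Finset.sum_congr rfl fun g _ => ?_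
          rw [iotaHat_cochain k x (by
            have h0 := h; simp only [Int.ofNat_eq_natCast] at h0; simp; omega), smul_mul_assoc,
            smul_mul_assoc, ← el_mul, ← el_mul]
          simp [mul_assoc]
        · have h0 := h
          simp only [Int.ofNat_eq_natCast] at h0
          obtain ⟨u, v, rfl, hu⟩ := exists_append_of_le_length (l := l) (j := c) (by omega)
          have hv : v.length = n := by simp at hl; omega
          rw [gCup_PN_N k h x hu hv, hCup_PN_N k h _ hu hv, map_smul, iotaHat_chain k hu,
            iotaHat_cochain k x hv, smul_mul_assoc, map_smul, ← el_mul]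
          simp
      exact DFunLike.congr_fun this y
  · have : (gCup k G _ _ r h).compr₂ (iotaHat k G r)
        = (hCup k G _ _ r h).compl₁₂ (iotaHat k G (Int.negSucc s)) (iotaHat k G q) := by
      refine gTate_ext k fun l hl => ?_
      rcases q with m | t
      · refine LinearMap.ext fun β => ?_
        simp only [LinearMap.compr₂_apply, LinearMap.compl₁₂_apply]
        rw [iotaHat_chain k hl]
        rcases r with w | c
        · refine hEval_ext k fun v hv => ?_
          rw [iotaHat_cochain k _ hv, gCup_NP_P k h β hl hv, hCup_NP_P k h _ hl hv, Finset.sum_smul]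
          refine Finset.sum_congr rfl fun g _ => ?_
          rw [iotaHat_cochain k β (by
            have h0 := h; simp only [Int.ofNat_eq_natCast] at h0; simp; omega), mul_smul_comm,
            ← el_mul, ← el_mul]
          simp [mul_assoc]
        · have h0 := h
          simp only [Int.ofNat_eq_natCast] at h0
          obtain ⟨u, v, rfl, hu⟩ := exists_append_of_le_length (l := l) (j := m) (by omega)
          have hv : v.length = c := by simp at hl; omega
          rw [gCup_NP_N k h β hu hv, hCup_NP_N k h _ hu hv, map_smul, iotaHat_chain k hv,
            iotaHat_cochain k β hu, mul_smul_comm, map_smul, ← el_mul]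
          simp
      · refine gTate_ext k fun l' hl' => ?_
        simp only [LinearMap.compr₂_apply, LinearMap.compl₁₂_apply]
        rw [iotaHat_chain k hl, iotaHat_chain k hl']
        rcases r with w | c
        · have h0 := h; simp only [Int.ofNat_eq_natCast] at h0; omega
        rw [gCup_NN k h hl hl', hCup_NN k h hl hl', map_sum]
        refine Finset.sum_congr rfl fun g _ => ?_
        rw [iotaHat_chain k (by simp; omega), ← el_mul, ← el_mul]
        simp [mul_assoc]
    exact DFunLike.congr_fun (DFunLike.congr_fun this x) y

/-- The inclusion commutes with `Δ̂`: in the sum over `g ∈ G` defining `Δ`, only the word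
`(g, l)` with product `1` contributes, and rotations of a word preserve the condition that its product
is `1`. -/
theorem iotaHat_gBV (ε : ℤˣ) {p q : ℤ} (h : q + 1 = p) (x : GTate k G p) :
    iotaHat k G q (gBV k G ε p q h x) = hBV k G ε p q h (iotaHat k G p x) := by
  classical
  rcases p with n | s
  · rcases q with m | _
    swap
    · exact map_zero _
    refine hEval_ext k fun l hl => coef_ext k fun g => ?_
    rw [← inv_inv g, iotaHat_cochain k _ hl, gBV_cochain k ε h x hl, hBV_cochain k ε h _ hl,
      map_smul, el, coef_single]
    have h1 : ∀ i, coef k 1 (hEval k n (iotaHat k G _ x) ((g⁻¹ :: l).rotate i))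
        = if l.prod = g then gEval k n x ((g⁻¹ :: l).rotate i) else 0 := by
      intro i
      rw [iotaHat_cochain k x (by
        have h0 := h; simp only [Int.ofNat_eq_natCast] at h0; simp; omega), map_smul, el,
        coef_single, smul_eq_mul, mul_ite, mul_one, mul_zero]
      refine if_congr ?_ rfl rfl
      rw [prod_rotate_eq_one_iff, List.prod_cons, inv_mul_eq_one, eq_comm]
    simp only [cycSum, h1, inv_inv]
    split_ifs with h2
    · subst h2
      simp
    · simp
  · rcases q with m | t
    · have h0 := h; simp only [Int.ofNat_eq_natCast] at h0; omega
    have : iotaHat k G _ ∘ₗ gBV k G ε _ _ h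
        = hBV k G ε _ (Int.negSucc t) h ∘ₗ iotaHat k G (Int.negSucc s) := by
      refine gTate_ext k fun l hl => ?_
      simp only [LinearMap.comp_apply]
      rw [iotaHat_chain k hl, gBV_chain k ε h hl, hBV_chain k ε h hl, map_zsmul]
      congr 1
      refine (cycSum_map (iotaHat k G (Int.negSucc t)).toAddMonoidHom _ _).trans ?_
      refine Finset.sum_congr rfl fun i _ => ?_
      congr 1
      refine (iotaHat_chain k (by simp; omega)).trans ?_
      rw [List.prod_rotate_eq_one_of_prod_eq_one (by simp), inv_one]
      rfl
    exact DFunLike.congr_fun this x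

end Inclusion

/-! ### Descent to cohomology -/

section Descent

variable {k : Type*} [Field k]

section Represents

variable {M N P : Type*} [AddCommGroup M] [Module k M] [AddCommGroup N] [Module k N]
  [AddCommGroup P] [Module k P] {Z B : Submodule k M} {Z' B' : Submodule k N} {Z'' B'' : Submodule k P}

theorem Represents.mk (B : Submodule k M) {x : M} (h : x ∈ Z) :
    Represents x (Submodule.Quotient.mk ⟨x, h⟩ : Z ⧸ B.submoduleOf Z) :=
  ⟨h, rfl⟩

theorem exists_represents (c : Z ⧸ B.submoduleOf Z) : ∃ x : M, Represents x c := by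
  obtain ⟨x, rfl⟩ := Submodule.Quotient.mk_surjective _ c
  exact ⟨x, x.2, rfl⟩

theorem Represents.sub_mem {x y : M} {c : Z ⧸ B.submoduleOf Z} (hx : Represents x c)
    (hy : Represents y c) : x - y ∈ B := by
  obtain ⟨hx, rfl⟩ := hx
  obtain ⟨hy, h⟩ := hy
  have h2 := (Submodule.Quotient.eq (B.submoduleOf Z)).1 h.symm
  exact h2

theorem Represents.congr {x y : M} {c : Z ⧸ B.submoduleOf Z} (hx : Represents x c) (hy : y ∈ Z)
    (h : y - x ∈ B) : Represents y c := by
  obtain ⟨hx, rfl⟩ := hx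
  exact ⟨hy, (Submodule.Quotient.eq _).2 h⟩

theorem Represents.unique {x : M} {c c' : Z ⧸ B.submoduleOf Z} (h : Represents x c)
    (h' : Represents x c') : c = c' := by
  obtain ⟨hx, rfl⟩ := h
  exact h'.2

theorem Represents.add {x y : M} {c d : Z ⧸ B.submoduleOf Z} (hx : Represents x c)
    (hy : Represents y d) : Represents (x + y) (c + d) := by
  obtain ⟨hx, rfl⟩ := hx
  obtain ⟨hy, rfl⟩ := hy
  exact ⟨Z.add_mem hx hy, rfl⟩

theorem Represents.smul (a : k) {x : M} {c : Z ⧸ B.submoduleOf Z} (hx : Represents x c) :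
    Represents (a • x) (a • c) := by
  obtain ⟨hx, rfl⟩ := hx
  exact ⟨Z.smul_mem a hx, rfl⟩

theorem represents_zero_iff {x : M} :
    Represents x (0 : Z ⧸ B.submoduleOf Z) ↔ x ∈ Z ∧ x ∈ B := by
  refine ⟨fun ⟨hx, h⟩ => ⟨hx, ?_⟩, fun ⟨hx, h⟩ => ⟨hx, (Submodule.Quotient.mk_eq_zero _).2 h⟩⟩
  have h2 := (Submodule.Quotient.mk_eq_zero (B.submoduleOf Z)).1 h
  exact h2

/-- A linear map preserving cocycles and coboundaries induces a map on cohomology. -/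
theorem exists_induced (f : M →ₗ[k] N) (hZ : ∀ x ∈ Z, f x ∈ Z')
    (hB : ∀ x ∈ Z, x ∈ B → f x ∈ B') :
    ∃ F : (Z ⧸ B.submoduleOf Z) →ₗ[k] (Z' ⧸ B'.submoduleOf Z'),
      ∀ x a, Represents x a → Represents (f x) (F a) := by
  refine ⟨Submodule.mapQ _ _ (f.restrict hZ) fun x hx => hB x x.2 hx, ?_⟩
  rintro x a ⟨hx, rfl⟩
  exact ⟨hZ x hx, rfl⟩

/-- A bilinear map preserving cocycles, for which products of a coboundary and a cocycle are
coboundaries, induces a product on cohomology. -/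
theorem exists_induced₂ (f : M →ₗ[k] N →ₗ[k] P) (hZ : ∀ x ∈ Z, ∀ y ∈ Z', f x y ∈ Z'')
    (hB : ∀ x ∈ B, ∀ y ∈ Z', f x y ∈ B'') (hB' : ∀ x ∈ Z, ∀ y ∈ B', f x y ∈ B'') :
    ∃ F : (Z ⧸ B.submoduleOf Z) →ₗ[k] (Z' ⧸ B'.submoduleOf Z') →ₗ[k] (Z'' ⧸ B''.submoduleOf Z''),
      ∀ x a y b, Represents x a → Represents y b → Represents (f x y) (F a b) := by
  have key : ∀ (a : Z ⧸ B.submoduleOf Z) (b : Z' ⧸ B'.submoduleOf Z'),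
      ∃ c : Z'' ⧸ B''.submoduleOf Z'', ∀ x y, Represents x a → Represents y b →
        Represents (f x y) c := by
    intro a b
    obtain ⟨x₀, hx₀⟩ := exists_represents a
    obtain ⟨y₀, hy₀⟩ := exists_represents b
    refine ⟨_, fun x y hx hy =>
      (Represents.mk B'' (hZ x₀ hx₀.1 y₀ hy₀.1)).congr (hZ x hx.1 y hy.1) ?_⟩
    have : f x y - f x₀ y₀ = f (x - x₀) y + f x₀ (y - y₀) := by
      simp only [map_sub, LinearMap.sub_apply]
      abel
    rw [this]
    exact B''.add_mem (hB _ (hx.sub_mem hx₀) _ hy.1) (hB' _ hx₀.1 _ (hy.sub_mem hy₀))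
  choose F hF using key
  refine ⟨LinearMap.mk₂ k F ?_ ?_ ?_ ?_, fun x a y b hx hy => hF a b x y hx hy⟩
  · intro a a' b
    obtain ⟨x, hx⟩ := exists_represents a
    obtain ⟨x', hx'⟩ := exists_represents a'
    obtain ⟨y, hy⟩ := exists_represents b
    refine (hF _ _ _ _ (hx.add hx') hy).unique ?_
    rw [map_add, LinearMap.add_apply]
    exact (hF _ _ _ _ hx hy).add (hF _ _ _ _ hx' hy)
  · intro c a b
    obtain ⟨x, hx⟩ := exists_represents a
    obtain ⟨y, hy⟩ := exists_represents b
    refine (hF _ _ _ _ (hx.smul c) hy).unique ?_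
    rw [map_smul, LinearMap.smul_apply]
    exact (hF _ _ _ _ hx hy).smul c
  · intro a b b'
    obtain ⟨x, hx⟩ := exists_represents a
    obtain ⟨y, hy⟩ := exists_represents b
    obtain ⟨y', hy'⟩ := exists_represents b'
    refine (hF _ _ _ _ hx (hy.add hy')).unique ?_
    rw [map_add]
    exact (hF _ _ _ _ hx hy).add (hF _ _ _ _ hx hy')
  · intro c a b
    obtain ⟨x, hx⟩ := exists_represents a
    obtain ⟨y, hy⟩ := exists_represents b
    refine (hF _ _ _ _ hx (hy.smul c)).unique ?_
    rw [map_smul]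
    exact (hF _ _ _ _ hx hy).smul c

end Represents

/-- Operations on a complex with the unit and square-zero laws, which are compatible with cocycles
and coboundaries, induce BV operations on cohomology. -/
theorem exists_bvOps {M : ℤ → Type*} [∀ n, AddCommGroup (M n)] [∀ n, Module k (M n)]
    (Z B : ∀ n, Submodule k (M n)) (one : M 0)
    (cup : ∀ p q r : ℤ, p + q = r → M p →ₗ[k] M q →ₗ[k] M r)
    (Δ : ∀ p q : ℤ, q + 1 = p → M p →ₗ[k] M q) (hone : one ∈ Z 0)
    (hcup : ∀ p q r h, ∀ x ∈ Z p, ∀ y ∈ Z q, cup p q r h x y ∈ Z r)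
    (hcup_left : ∀ p q r h, ∀ x ∈ B p, ∀ y ∈ Z q, cup p q r h x y ∈ B r)
    (hcup_right : ∀ p q r h, ∀ x ∈ Z p, ∀ y ∈ B q, cup p q r h x y ∈ B r)
    (hΔ : ∀ p q h, ∀ x ∈ Z p, Δ p q h x ∈ Z q) (hΔ' : ∀ p q h, ∀ x ∈ B p, Δ p q h x ∈ B q)
    (one_cup : ∀ p x, cup 0 p p (zero_add p) one x = x)
    (cup_one : ∀ p x, cup p 0 p (add_zero p) x one = x)
    (Δ_Δ : ∀ p q r h h' x, Δ q r h' (Δ p q h x) = 0) :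
    ∃ A : BVOps k fun n => Z n ⧸ (B n).submoduleOf (Z n),
      Represents one A.one ∧
      (∀ p q r h x a y b, Represents x a → Represents y b →
        Represents (cup p q r h x y) (A.mul p q r h a b)) ∧
      ∀ p q h x a, Represents x a → Represents (Δ p q h x) (A.Δ p q h a) := by
  choose mul hmul using fun p q r h => exists_induced₂ (cup p q r h) (hcup p q r h)
    (hcup_left p q r h) (hcup_right p q r h)
  choose D hD using fun p q h => exists_induced (B := B p) (B' := B q) (Δ p q h) (hΔ p q h)
    fun x _ hx => hΔ' p q h x hx
  have h1 := Represents.mk (B 0) hone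
  refine ⟨⟨_, mul, D, fun p a => ?_, fun p a => ?_, fun p q r h h' a => ?_⟩, h1, hmul, hD⟩
  · obtain ⟨x, hx⟩ := exists_represents a
    refine (hmul _ _ _ _ _ _ _ _ h1 hx).unique ?_
    rwa [one_cup]
  · obtain ⟨x, hx⟩ := exists_represents a
    refine (hmul _ _ _ _ _ _ _ _ hx h1).unique ?_
    rwa [cup_one]
  · obtain ⟨x, hx⟩ := exists_represents a
    have h2 := hD _ _ h' _ _ (hD _ _ h _ _ hx)
    rw [Δ_Δ] at h2
    exact h2.unique (represents_zero_iff.2 ⟨Submodule.zero_mem _, Submodule.zero_mem _⟩)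

/-- The bracket is determined by the product and the BV operator, so it is preserved by a map that
preserves these. -/
theorem BVOps.isUnitalEmbedding {H K : ℤ → Type*} [∀ n, AddCommGroup (H n)]
    [∀ n, Module k (H n)] [∀ n, AddCommGroup (K n)] [∀ n, Module k (K n)] {A : BVOps k H}
    {B : BVOps k K} {f : ∀ n, H n →ₗ[k] K n} (hf : ∀ n, Function.Injective (f n))
    (hone : f 0 A.one = B.one)
    (hmul : ∀ (p q r : ℤ) (h : p + q = r) (a : H p) (b : H q),
      f r (A.mul p q r h a b) = B.mul p q r h (f p a) (f q b))
    (hΔ : ∀ (p q : ℤ) (h : q + 1 = p) (a : H p), f q (A.Δ p q h a) = B.Δ p q h (f p a)) :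
    A.IsUnitalEmbedding B f where
  injective := hf
  map_one := hone
  map_mul := hmul
  map_Δ := hΔ
  map_bracket p q r h a b := by
    simp only [BVOps.bracket, map_neg, Units.smul_def, map_zsmul, map_sub, hmul, hΔ]

end Descent

section Cohomology

variable (k : Type u) [Field k] {G : Type v} [Group G]

theorem iotaHat_injective (n : ℤ) : Function.Injective (iotaHat k G n) :=
  Function.LeftInverse.injective (piHat_iotaHat k)

variable [Fintype G]

theorem mem_hCocycles {p q : ℤ} (h : p + 1 = q) {x : HTate k G p} :
    x ∈ hCocycles k G p ↔ hd k G p q h x = 0 := by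
  rw [hCocycles_eq k p q h, LinearMap.mem_ker]

theorem mem_hCoboundaries {p q : ℤ} (h : p + 1 = q) {x : HTate k G q} :
    x ∈ hCoboundaries k G q ↔ ∃ y, hd k G p q h y = x := by
  rw [hCoboundaries_eq k p q h, LinearMap.mem_range]

theorem hCoboundaries_le (n : ℤ) : hCoboundaries k G n ≤ hCocycles k G n := by
  intro x hx
  obtain ⟨y, rfl⟩ := (mem_hCoboundaries k (sub_add_cancel n 1)).1 hx
  rw [mem_hCocycles k rfl]
  exact hd_hd k _ _ y

theorem hOne_mem : hOne k G ∈ hCocycles k G 0 := by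
  rw [mem_hCocycles k (q := Int.ofNat 1) rfl]
  refine hEval_ext k fun l hl => ?_
  obtain ⟨g, rfl⟩ := List.length_eq_one_iff.1 hl
  have h1 : hEval k 0 (hOne k G) [] = 1 := evalWord_zero_nil k _
  refine (hd_cochain k (n := 0) (m := 1) rfl _ hl).trans ?_
  simp only [faces, h1]
  simp

theorem hCup_mem_hCocycles {p q r : ℤ} (h : p + q = r) {x : HTate k G p} (hx : x ∈ hCocycles k G p)
    {y : HTate k G q} (hy : y ∈ hCocycles k G q) : hCup k G p q r h x y ∈ hCocycles k G r := by
  obtain ⟨i, j, hL⟩ := hd_hCup k (G := G) h rfl rfl rfl (by omega) (by omega)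
  rw [mem_hCocycles k rfl] at hx hy ⊢
  rw [hL, hx, hy]
  simp

theorem neg_one_pow_smul_cancel {M : Type*} [AddCommGroup M] (i : ℕ) (x : M) :
    (-1 : ℤ) ^ i • (-1 : ℤ) ^ i • x = x := by
  rw [smul_smul, ← mul_pow]
  simp

theorem hCup_mem_left {p q r : ℤ} (h : p + q = r) {x : HTate k G p} (hx : x ∈ hCoboundaries k G p)
    {y : HTate k G q} (hy : y ∈ hCocycles k G q) : hCup k G p q r h x y ∈ hCoboundaries k G r := by
  obtain ⟨z, rfl⟩ := (mem_hCoboundaries k (sub_add_cancel p 1)).1 hx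
  obtain ⟨i, j, hL⟩ := hd_hCup k (G := G) (p := p - 1) (q := q) (r := r - 1) (by omega)
    (sub_add_cancel p 1) rfl (sub_add_cancel r 1) h (by omega)
  rw [mem_hCocycles k rfl] at hy
  rw [mem_hCoboundaries k (sub_add_cancel r 1)]
  refine ⟨(-1 : ℤ) ^ i • hCup k G _ _ _ (by omega) z y, ?_⟩
  rw [map_zsmul, hL, hy, map_zero, smul_zero, add_zero, neg_one_pow_smul_cancel]

theorem hCup_mem_right {p q r : ℤ} (h : p + q = r) {x : HTate k G p} (hx : x ∈ hCocycles k G p)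
    {y : HTate k G q} (hy : y ∈ hCoboundaries k G q) :
    hCup k G p q r h x y ∈ hCoboundaries k G r := by
  obtain ⟨z, rfl⟩ := (mem_hCoboundaries k (sub_add_cancel q 1)).1 hy
  obtain ⟨i, j, hL⟩ := hd_hCup k (G := G) (p := p) (q := q - 1) (r := r - 1) (by omega)
    rfl (sub_add_cancel q 1) (sub_add_cancel r 1) (by omega) h
  rw [mem_hCocycles k rfl] at hx
  rw [mem_hCoboundaries k (sub_add_cancel r 1)]
  refine ⟨(-1 : ℤ) ^ j • hCup k G _ _ _ (by omega) x z, ?_⟩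
  rw [map_zsmul, hL, hx, map_zero, LinearMap.zero_apply, smul_zero, zero_add,
    neg_one_pow_smul_cancel]

theorem hBV_mem_hCocycles (ε : ℤˣ) {p q : ℤ} (h : q + 1 = p) {x : HTate k G p}
    (hx : x ∈ hCocycles k G p) : hBV k G ε p q h x ∈ hCocycles k G q := by
  obtain ⟨c, hc⟩ := hBV_hd k (G := G) ε rfl h
  rw [mem_hCocycles k rfl] at hx
  rw [mem_hCocycles k h]
  have h1 := hc x
  rw [hx, map_zero] at h1
  exact (smul_eq_zero_iff_eq c).1 h1.symm

theorem hBV_mem_hCoboundaries (ε : ℤˣ) {p q : ℤ} (h : q + 1 = p) {x : HTate k G p}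
    (hx : x ∈ hCoboundaries k G p) : hBV k G ε p q h x ∈ hCoboundaries k G q := by
  subst h
  obtain ⟨z, rfl⟩ := (mem_hCoboundaries k rfl).1 hx
  obtain ⟨c, hc⟩ := hBV_hd k (G := G) ε (p := q) rfl (sub_add_cancel q 1)
  rw [mem_hCoboundaries k (sub_add_cancel q 1)]
  refine ⟨(c : ℤ) • hBV k G ε _ _ (sub_add_cancel q 1) z, ?_⟩
  rw [hc, map_zsmul]

theorem hOne_hCup (p : ℤ) (x : HTate k G p) : hCup k G 0 p p (zero_add p) (hOne k G) x = x := by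
  have h1 : hEval k 0 (hOne k G) [] = 1 := evalWord_zero_nil k _
  rcases p with n | s
  · refine hEval_ext k fun l hl => ?_
    refine (hCup_PP k (n := 0) (zero_add _) (hOne k G) x (u := []) rfl hl).trans ?_
    rw [h1, one_mul]
  · induction x using hTate_induction with
    | hadd x y hx hy => rw [map_add, hx, hy]
    | hword l z hl =>
      have h2 := hCup_PN_N k (n := 0) (zero_add _) (hOne k G) hl (v := []) rfl z
      rw [List.append_nil, h1, one_mul] at h2
      exact h2

theorem hCup_hOne (p : ℤ) (x : HTate k G p) : hCup k G p 0 p (add_zero p) x (hOne k G) = x := by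
  have h1 : hEval k 0 (hOne k G) [] = 1 := evalWord_zero_nil k _
  rcases p with n | s
  · refine hEval_ext k fun l hl => ?_
    have h2 := hCup_PP k (m := 0) (add_zero _) x (hOne k G) hl (v := []) rfl
    rw [List.append_nil, h1, mul_one] at h2
    exact h2
  · induction x using hTate_induction with
    | hadd x y hx hy => rw [map_add, LinearMap.add_apply, hx, hy]
    | hword l z hl =>
      have h2 := hCup_NP_N k (m := 0) (add_zero _) (hOne k G) (u := []) rfl hl z
      rw [h1, mul_one] at h2
      exact h2

theorem iotaHat_mem_hCocycles {p : ℤ} {x : GTate k G p} :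
    iotaHat k G p x ∈ hCocycles k G p ↔ x ∈ gCocycles k G p := by
  rw [mem_hCocycles k rfl, gCocycles_eq k p _ rfl, LinearMap.mem_ker, ← iotaHat_gd,
    map_eq_zero_iff _ (iotaHat_injective k _)]

/-- A cochain of the Tate complex that bounds in the Tate-Hochschild complex bounds already in the
Tate complex: project the bounding element to the summand of the conjugacy class of `1`. -/
theorem iotaHat_mem_hCoboundaries {p : ℤ} {x : GTate k G p} :
    iotaHat k G p x ∈ hCoboundaries k G p ↔ x ∈ gCoboundaries k G p := by
  rw [mem_hCoboundaries k (sub_add_cancel p 1), gCoboundaries_eq k _ p (sub_add_cancel p 1),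
    LinearMap.mem_range]
  constructor
  · rintro ⟨y, hy⟩
    refine ⟨piHat k G _ y, ?_⟩
    rw [← piHat_hd, hy, piHat_iotaHat]
  · rintro ⟨y, rfl⟩
    exact ⟨iotaHat k G _ y, (iotaHat_gd k _ y).symm⟩

end Cohomology

end TateHH

end

open TateHH in
theorem corollary6p6 (k : Type*) [Field k] (G : Type*) [Group G] [Fintype G] (ε : ℤˣ) :
    (∀ n, gCoboundaries k G n ≤ gCocycles k G n) ∧
    (∀ n, hCoboundaries k G n ≤ hCocycles k G n) ∧
    ∃ (A : BVOps k (HHat k G)) (B : BVOps k (HHHat k G))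
      (ι : ∀ n, HHat k G n →ₗ[k] HHHat k G n),
      -- the operations on cohomology and the map `ι` are induced by those on cochains
      Represents (gOne k G) A.one ∧
      (∀ (p q r : ℤ) (h : p + q = r) (x : GTate k G p) (a : HHat k G p) (y : GTate k G q)
        (b : HHat k G q), Represents x a → Represents y b →
          Represents (gCup k G p q r h x y) (A.mul p q r h a b)) ∧
      (∀ (p q : ℤ) (h : q + 1 = p) (x : GTate k G p) (a : HHat k G p), Represents x a →
          Represents (gBV k G ε p q h x) (A.Δ p q h a)) ∧
      Represents (hOne k G) B.one ∧
      (∀ (p q r : ℤ) (h : p + q = r) (x : HTate k G p) (a : HHHat k G p) (y : HTate k G q)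
        (b : HHHat k G q), Represents x a → Represents y b →
          Represents (hCup k G p q r h x y) (B.mul p q r h a b)) ∧
      (∀ (p q : ℤ) (h : q + 1 = p) (x : HTate k G p) (a : HHHat k G p), Represents x a →
          Represents (hBV k G ε p q h x) (B.Δ p q h a)) ∧
      (∀ (n : ℤ) (x : GTate k G n) (a : HHat k G n), Represents x a →
          Represents (iotaHat k G n x) (ι n a)) ∧
      A.IsUnitalEmbedding B ι := by
  have hmem : ∀ n, gCoboundaries k G n ≤ gCocycles k G n := fun n x hx =>
    (iotaHat_mem_hCocycles k).1 (hCoboundaries_le k n ((iotaHat_mem_hCoboundaries k).2 hx))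
  refine ⟨hmem, hCoboundaries_le k, ?_⟩
  obtain ⟨B, hB1, hB2, hB3⟩ := exists_bvOps (hCocycles k G) (hCoboundaries k G) (hOne k G)
    (hCup k G) (hBV k G ε) (hOne_mem k)
    (fun p q r h x hx y hy => hCup_mem_hCocycles k h hx hy)
    (fun p q r h x hx y hy => hCup_mem_left k h hx hy)
    (fun p q r h x hx y hy => hCup_mem_right k h hx hy)
    (fun p q h x hx => hBV_mem_hCocycles k ε h hx)
    (fun p q h x hx => hBV_mem_hCoboundaries k ε h hx)
    (hOne_hCup k) (hCup_hOne k) (fun p q r h h' x => hBV_hBV k ε h h' x)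
  obtain ⟨A, hA1, hA2, hA3⟩ := exists_bvOps (gCocycles k G) (gCoboundaries k G) (gOne k G)
    (gCup k G) (gBV k G ε)
    (by rw [← iotaHat_mem_hCocycles, iotaHat_one]; exact hOne_mem k)
    (fun p q r h x hx y hy => by
      rw [← iotaHat_mem_hCocycles] at *
      rw [iotaHat_gCup]
      exact hCup_mem_hCocycles k h hx hy)
    (fun p q r h x hx y hy => by
      rw [← iotaHat_mem_hCoboundaries] at *
      rw [← iotaHat_mem_hCocycles] at hy
      rw [iotaHat_gCup]
      exact hCup_mem_left k h hx hy)
    (fun p q r h x hx y hy => by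
      rw [← iotaHat_mem_hCoboundaries] at *
      rw [← iotaHat_mem_hCocycles] at hx
      rw [iotaHat_gCup]
      exact hCup_mem_right k h hx hy)
    (fun p q h x hx => by
      rw [← iotaHat_mem_hCocycles] at *
      rw [iotaHat_gBV]
      exact hBV_mem_hCocycles k ε h hx)
    (fun p q h x hx => by
      rw [← iotaHat_mem_hCoboundaries] at *
      rw [iotaHat_gBV]
      exact hBV_mem_hCoboundaries k ε h hx)
    (fun p x => iotaHat_injective k p (by rw [iotaHat_gCup, iotaHat_one, hOne_hCup]))
    (fun p x => iotaHat_injective k p (by rw [iotaHat_gCup, iotaHat_one, hCup_hOne]))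
    (fun p q r h h' x => iotaHat_injective k r (by
      rw [iotaHat_gBV, iotaHat_gBV, hBV_hBV, map_zero]))
  choose ι hι using fun n : ℤ => exists_induced (Z := gCocycles k G n) (B := gCoboundaries k G n)
    (Z' := hCocycles k G n) (B' := hCoboundaries k G n) (iotaHat k G n)
    (fun x hx => (iotaHat_mem_hCocycles k).2 hx)
    (fun x _ hx => (iotaHat_mem_hCoboundaries k).2 hx)
  refine ⟨A, B, ι, hA1, hA2, hA3, hB1, hB2, hB3, hι, BVOps.isUnitalEmbedding (fun n => ?_) ?_ ?_ ?_⟩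
  · rw [injective_iff_map_eq_zero]
    intro a ha
    obtain ⟨x, hx⟩ := exists_represents a
    have h1 := hι n x a hx
    rw [ha, represents_zero_iff, iotaHat_mem_hCocycles, iotaHat_mem_hCoboundaries] at h1
    exact hx.unique (represents_zero_iff.2 h1)
  · have h1 := hι 0 _ _ hA1
    rw [iotaHat_one] at h1
    exact h1.unique hB1
  · intro p q r h a b
    obtain ⟨x, hx⟩ := exists_represents a
    obtain ⟨y, hy⟩ := exists_represents b
    have h1 := hι _ _ _ (hA2 _ _ _ h _ _ _ _ hx hy)
    rw [iotaHat_gCup] at h1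
    exact h1.unique (hB2 _ _ _ h _ _ _ _ (hι _ _ _ hx) (hι _ _ _ hy))
  · intro p q h a
    obtain ⟨x, hx⟩ := exists_represents a
    have h1 := hι _ _ _ (hA3 _ _ h _ _ hx)
    rw [iotaHat_gBV] at h1
    exact h1.unique (hB3 _ _ h _ _ (hι _ _ _ hx))
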